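/- **Theorem.** In the qutrit ZX-calculus (non-zero scalars being ignored), every qutrit stabilizer state diagram can be rewritten into some GS-LC diagram. **Diagrams.** Diagrams $a\to b$ (read from top to bottom) are built, by sequential composition $\circ$ and parallel composition $\otimes$, from green spiders $Z^{n}_{m}(\alpha,\beta):n\to m$ and red spiders $X^{n}_{m}(\alpha,\beta):n\to m$ ($n,m\ge 0$, $\alpha,\beta\in\mathbb R/2\pi\mathbb Z$), the nodes $H,H^\dagger:1\to1$, the swap $\sigma:2\to 2$, the wire $1\to 1$ and the empty diagram $0\to 0$. With $\omega=e^{2\pi i/3}$ and $|\chi_j\rangle=\sum_{y}\omega^{jy}|y\rangle$ ($j,y\in\mathbb Z_3$), the standard interpretation is $$Z^n_m(\alpha,\beta)\mapsto |0\rangle^{\otimes m}\langle 0|^{\otimes n}+e^{i\alpha}|1\rangle^{\otimes m}\langle 1|^{\otimes n}+e^{i\beta}|2\rangle^{\otimes m}\langle 2|^{\otimes n},$$ $$X^n_m(\alpha,\beta)\mapsto |\chi_0\rangle^{\otimes m}\langle \chi_0|^{\otimes n}+e^{i\alpha}|\chi_1\rangle^{\otimes m}\langle \chi_1|^{\otimes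 n}+e^{i\beta}|\chi_2\rangle^{\otimes m}\langle \chi_2|^{\otimes n},$$ $H\mapsto\sum_j|\chi_j\rangle\langle j|$, $H^\dagger\mapsto\sum_j|j\rangle\langle\chi_j|$, and the obvious maps for the other generators and for $\circ,\otimes$. **Rewriting.** $D$ can be rewritten into $D'$ if $D=D'$ in the least congruence (for $\circ$ and $\otimes$) that contains the structure rules of a strict symmetric monoidal category, identifies every diagram $0\to 0$ of non-zero interpretation with the empty diagram, and contains the following rules. Write $k$ for the angle $2\pi k/3$ and omit zero phases. * (S1) Two green spiders joined by at least one wire fuse and their phases add: $(\alpha,\beta),(\gamma,\delta)\mapsto(\alpha+\gamma,\beta+\delta)$. (S2) $Z^1_1$ is the wire. (S3) Crossing legs of a green spider does not change it. * (B1) $Z^1_2\circ X^0_1=X^0_1\otimes X^0_1$. (B2) $(X^2_1\otimes X^2_1)\circ(1\otimes\sigma\otimes1)\circ(Z^1_2\otimes Z^1_2)=Z^1_2\circ X^2_1$. * (K1) $Z^1_n\circ R=R^{\otimes n}\circ Z^1_n$ for $n\ge 0$ and $R\in\{X^1_1(1,2),X^1_1(2,1)\}$. (K2) $X^1_1(1,2)\circ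 Z^1_1(\alpha,\beta)=Z^1_1(\beta-\alpha,-\alpha)\circ X^1_1(1,2)$ and $X^1_1(2,1)\circ Z^1_1(\alpha,\beta)=Z^1_1(-\beta,\alpha-\beta)\circ X^1_1(2,1)$. * (H1) $H^\dagger\circ H$ and $H\circ H^\dagger$ are the wire. (EU) $H=Z^1_1(2,2)\circ X^1_1(2,2)\circ Z^1_1(2,2)$. (H2) $H^{\otimes m}\circ Z^n_m(\alpha,\beta)\circ (H^{\dagger})^{\otimes n}=X^n_m(\alpha,\beta)$. (H2$'$) $(H^{\dagger})^{\otimes m}\circ Z^n_m(\alpha,\beta)\circ H^{\otimes n}=X^n_m(\beta,\alpha)$. * (P1) $H\circ H=H^\dagger\circ H^\dagger=(X^2_0\otimes1)\circ(1\otimes Z^0_2)=(Z^2_0\otimes1)\circ(1\otimes X^0_2)$. **Stabilizer state diagrams.** A stabilizer diagram is a diagram all of whose phases are integer multiples of $2\pi/3$. A stabilizer state diagram on $n\ge0$ qutrits is a stabilizer diagram $0\to n$ whose standard interpretation is a state, i.e. a non-zero vector. **GS-LC diagrams.** Let $\Gamma$ be a symmetric $n\times n$ matrix over $\mathbb Z_3$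 with zero diagonal. Its graph state diagram $0\to n$ has one phase-free green node with one output for each vertex and, for each pair $i<j$ with $\Gamma_{ij}\neq0$, one node joining the green nodes of $i$ and $j$, which is $H$ if $\Gamma_{ij}=1$ and $H^\dagger$ if $\Gamma_{ij}=2$. A GS-LC diagram is a graph state diagram followed by a single-qutrit Clifford operator on each output, where a diagram of a single-qutrit Clifford operator is a sequential composite of wires, $H$, $H^\dagger$ and phase gates $Z^1_1(\alpha,\beta)$, $X^1_1(\alpha,\beta)$ with $\alpha,\beta\in\frac{2\pi}{3}\mathbb Z$. Claim: for every stabilizer state diagram $D:0\to n$ there is a GS-LC diagram $G:0\to n$ with $D=G$ in the calculus. -/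

import Mathlib

namespace QutritZX

/-- Diagrams of the qutrit ZX-calculus with `a` inputs and `b` outputs.  Phases are real numbers
modulo `2π`.  `Z n m α β` is the green spider `R_Z^{(n,m)}(α/β)`, `X n m α β` the red spider
`R_X^{(n,m)}(α/β)`, `had` is `H`, `hadDag` is `H†`, `swap` is `σ`, `wire` the identity on one
wire, and `empty` the empty diagram.  `seq D E` is `D` followed by `E`; `par D E` is `D` placed to
the left of `E`. -/
inductive Diagram : ℕ → ℕ → Type
  | Z (n m : ℕ) (α β : Real.Angle) : Diagram n m
  | X (n m : ℕ) (α β : Real.Angle) : Diagram n m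
  | had : Diagram 1 1
  | hadDag : Diagram 1 1
  | swap : Diagram 2 2
  | wire : Diagram 1 1
  | empty : Diagram 0 0
  | seq {a b c : ℕ} (D : Diagram a b) (E : Diagram b c) : Diagram a c
  | par {a b c d : ℕ} (D : Diagram a b) (E : Diagram c d) : Diagram (a + c) (b + d)

infixl:65 " ⨾ᵈ " => Diagram.seq
infixl:75 " ⊗ᵈ " => Diagram.par

open Diagram

/-- Replace the numbers of inputs and outputs in the type by equal numbers. -/
def Diagram.cast {a b a' b' : ℕ} (ha : a = a') (hb : b = b') (D : Diagram a b) : Diagram a' b' :=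
  ha ▸ hb ▸ D

/-! ### Standard interpretation -/

/-- The primitive cube root of unity `ω = e^{2πi/3}`. -/
noncomputable def omega : ℂ := Complex.exp (2 * Real.pi * Complex.I / 3)

/-- The coefficients `1, e^{iα}, e^{iβ}`, indexed by `0, 1, 2`. -/
noncomputable def phaseCoeff (α β : Real.Angle) (j : ZMod 3) : ℂ :=
  if j = 0 then 1 else if j = 1 then (α.toCircle : ℂ) else (β.toCircle : ℂ)

/-- The standard interpretation of a diagram with `a` inputs and `b` outputs as a linear map
`(ℂ³)^{⊗a} → (ℂ³)^{⊗b}`, written as a matrix in the computational bases.  In the red case the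
vectors `∑ y, ω^{jy} |y⟩` for `j = 0, 1, 2` are `|+⟩`, `|ω⟩`, `|ω̄⟩`. -/
noncomputable def Diagram.interp : {a b : ℕ} → Diagram a b →
    Matrix (Fin b → ZMod 3) (Fin a → ZMod 3) ℂ
  | _, _, .Z _ _ α β => fun y x =>
      ∑ j : ZMod 3, if (∀ i, y i = j) ∧ (∀ i, x i = j) then phaseCoeff α β j else 0
  | _, _, .X _ _ α β => fun y x =>
      ∑ j : ZMod 3, phaseCoeff α β j * (∏ i, omega ^ (j * y i).val) *
        ∏ i, omega ^ (-(j * x i)).val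
  | _, _, .had => fun y x => omega ^ (y 0 * x 0).val
  | _, _, .hadDag => fun y x => omega ^ (-(y 0 * x 0)).val
  | _, _, .swap => fun y x => if y 0 = x 1 ∧ y 1 = x 0 then 1 else 0
  | _, _, .wire => 1
  | _, _, .empty => 1
  | _, _, .seq D E => E.interp * D.interp
  | _, _, .par (a := a) (b := b) (c := c) (d := d) D E => fun y x =>
      D.interp (fun i => y (Fin.castAdd d i)) (fun i => x (Fin.castAdd c i)) *
        E.interp (fun i => y (Fin.natAdd b i)) (fun i => x (Fin.natAdd a i))

/-! ### Wires and crossings -/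

/-- `U 0 ⊗ U 1 ⊗ ⋯ ⊗ U (n-1)` for one-wire diagrams `U i`. -/
def layer : {n : ℕ} → (Fin n → Diagram 1 1) → Diagram n n
  | 0, _ => empty
  | _ + 1, U => layer (fun i => U i.castSucc) ⊗ᵈ U (Fin.last _)

/-- The identity diagram on `n` wires. -/
def wires (n : ℕ) : Diagram n n := layer fun _ => wire

/-- The crossing that moves the last of `a + 1` wires to the front. -/
def lastToFront : (a : ℕ) → Diagram (a + 1) (1 + a)
  | 0 => wire
  | a + 1 => (wires a ⊗ᵈ swap).cast rfl rfl ⨾ᵈ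
      (lastToFront a ⊗ᵈ wire).cast (a' := a + 2) (b' := 1 + (a + 1)) rfl rfl

/-- The crossing of `m` wires with `n` wires. -/
def braid (m : ℕ) : (n : ℕ) → Diagram (m + n) (n + m)
  | 0 => (wires m).cast rfl (Nat.zero_add m).symm
  | n + 1 => (braid m n ⊗ᵈ wire).cast (a' := m + (n + 1)) (b' := n + (m + 1)) rfl rfl ⨾ᵈ
      (wires n ⊗ᵈ lastToFront m).cast rfl (by omega)

/-! ### The calculus -/

/-- The angle `k · 2π/3`. -/
noncomputable def ang (k : ℤ) : Real.Angle := ((k * (2 * Real.pi / 3) : ℝ) : Real.Angle)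

/-- Equality of diagrams in the qutrit ZX-calculus, non-zero scalars being ignored: the least
congruence containing the structure rules of a strict symmetric monoidal category and the
rewriting rules.  The relation is stated between diagrams whose types need not be syntactically the
same, so that associativity of `⊗` needs no transport; related diagrams always have equal
numbers of inputs and of outputs. -/
inductive ZXEq : {a b a' b' : ℕ} → Diagram a b → Diagram a' b' → Prop
  -- congruence
  | refl {a b : ℕ} (D : Diagram a b) : ZXEq D D
  | symm {a b a' b' : ℕ} {D : Diagram a b} {E : Diagram a' b'} : ZXEq D E → ZXEq E D
  | trans {a b a' b' a'' b'' : ℕ} {D : Diagram a b} {E : Diagram a' b'} {F : Diagram a'' b''} :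
      ZXEq D E → ZXEq E F → ZXEq D F
  | seq_congr {a b c a' b' c' : ℕ} {D : Diagram a b} {E : Diagram b c}
      {D' : Diagram a' b'} {E' : Diagram b' c'} :
      ZXEq D D' → ZXEq E E' → ZXEq (D ⨾ᵈ E) (D' ⨾ᵈ E')
  | par_congr {a b c d a' b' c' d' : ℕ} {D : Diagram a b} {E : Diagram c d}
      {D' : Diagram a' b'} {E' : Diagram c' d'} :
      ZXEq D D' → ZXEq E E' → ZXEq (D ⊗ᵈ E) (D' ⊗ᵈ E')
  -- strict symmetric monoidal category
  | seq_assoc {a b c d : ℕ} (D : Diagram a b) (E : Diagram b c) (F : Diagram c d) :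
      ZXEq (D ⨾ᵈ E ⨾ᵈ F) (D ⨾ᵈ (E ⨾ᵈ F))
  | wires_seq {a b : ℕ} (D : Diagram a b) : ZXEq (wires a ⨾ᵈ D) D
  | seq_wires {a b : ℕ} (D : Diagram a b) : ZXEq (D ⨾ᵈ wires b) D
  | par_assoc {a b c d e f : ℕ} (D : Diagram a b) (E : Diagram c d) (F : Diagram e f) :
      ZXEq (D ⊗ᵈ E ⊗ᵈ F) (D ⊗ᵈ (E ⊗ᵈ F))
  | empty_par {a b : ℕ} (D : Diagram a b) : ZXEq (empty ⊗ᵈ D) D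
  | par_empty {a b : ℕ} (D : Diagram a b) : ZXEq (D ⊗ᵈ empty) D
  | interchange {a b c d e f : ℕ} (D : Diagram a b) (E : Diagram b c)
      (F : Diagram d e) (G : Diagram e f) :
      ZXEq ((D ⨾ᵈ E) ⊗ᵈ (F ⨾ᵈ G)) ((D ⊗ᵈ F) ⨾ᵈ (E ⊗ᵈ G))
  | swap_swap : ZXEq (swap ⨾ᵈ swap) (wires 2)
  | braid_natural {a b c d : ℕ} (D : Diagram a b) (E : Diagram c d) :
      ZXEq ((D ⊗ᵈ E) ⨾ᵈ braid b d) (braid a c ⨾ᵈ (E ⊗ᵈ D))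
  -- non-zero scalars are ignored
  | scalar (D : Diagram 0 0) : D.interp ≠ 0 → ZXEq D empty
  -- (S1): green spiders joined by `k ≥ 1` wires fuse
  | s1 (n m k l p : ℕ) (hk : 0 < k) (α β γ δ : Real.Angle) :
      ZXEq ((Z n (m + k) α β ⊗ᵈ wires l) ⨾ᵈ
          (wires m ⊗ᵈ Z (k + l) p γ δ).cast (Nat.add_assoc m k l).symm rfl)
        (Z (n + l) (m + p) (α + γ) (β + δ))
  -- (S2)
  | s2 : ZXEq (Z 1 1 0 0) wire
  -- (S3): the legs of a green spider (in particular of a green cup or cap) may be crossed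
  | s3_out (n a b : ℕ) (α β : Real.Angle) :
      ZXEq (Z n (a + 2 + b) α β ⨾ᵈ (wires a ⊗ᵈ swap ⊗ᵈ wires b)) (Z n (a + 2 + b) α β)
  | s3_in (m a b : ℕ) (α β : Real.Angle) :
      ZXEq ((wires a ⊗ᵈ swap ⊗ᵈ wires b) ⨾ᵈ Z (a + 2 + b) m α β) (Z (a + 2 + b) m α β)
  -- (B1): copy rule
  | b1 : ZXEq (X 0 1 0 0 ⨾ᵈ Z 1 2 0 0) (X 0 1 0 0 ⊗ᵈ X 0 1 0 0)
  -- (B2): bialgebra rule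
  | b2 : ZXEq ((Z 1 2 0 0 ⊗ᵈ Z 1 2 0 0) ⨾ᵈ
        (wire ⊗ᵈ swap ⊗ᵈ wire).cast (a' := 2 + 2) (b' := 2 + 2) rfl rfl ⨾ᵈ
        (X 2 1 0 0 ⊗ᵈ X 2 1 0 0)) (X 2 1 0 0 ⨾ᵈ Z 1 2 0 0)
  -- (K1)
  | k1_12 (n : ℕ) : ZXEq (X 1 1 (ang 1) (ang 2) ⨾ᵈ Z 1 n 0 0)
        (Z 1 n 0 0 ⨾ᵈ layer fun _ : Fin n => X 1 1 (ang 1) (ang 2))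
  | k1_21 (n : ℕ) : ZXEq (X 1 1 (ang 2) (ang 1) ⨾ᵈ Z 1 n 0 0)
        (Z 1 n 0 0 ⨾ᵈ layer fun _ : Fin n => X 1 1 (ang 2) (ang 1))
  -- (K2)
  | k2_12 (α β : Real.Angle) : ZXEq (Z 1 1 α β ⨾ᵈ X 1 1 (ang 1) (ang 2))
        (X 1 1 (ang 1) (ang 2) ⨾ᵈ Z 1 1 (β - α) (-α))
  | k2_21 (α β : Real.Angle) : ZXEq (Z 1 1 α β ⨾ᵈ X 1 1 (ang 2) (ang 1))
        (X 1 1 (ang 2) (ang 1) ⨾ᵈ Z 1 1 (-β) (α - β))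
  -- (H1)
  | h1 : ZXEq (had ⨾ᵈ hadDag) wire
  | h1' : ZXEq (hadDag ⨾ᵈ had) wire
  -- (EU): Euler decomposition of `H`
  | eu : ZXEq had (Z 1 1 (ang 2) (ang 2) ⨾ᵈ X 1 1 (ang 2) (ang 2) ⨾ᵈ Z 1 1 (ang 2) (ang 2))
  -- (H2), (H2'): colour change
  | h2 (n m : ℕ) (α β : Real.Angle) :
      ZXEq ((layer fun _ : Fin n => hadDag) ⨾ᵈ Z n m α β ⨾ᵈ layer fun _ : Fin m => had)
        (X n m α β)
  | h2' (n m : ℕ) (α β : Real.Angle) :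
      ZXEq ((layer fun _ : Fin n => had) ⨾ᵈ Z n m α β ⨾ᵈ layer fun _ : Fin m => hadDag)
        (X n m β α)
  -- (P1): the dualiser, made of a cup of one colour and a cap of the other
  | p1_had : ZXEq (had ⨾ᵈ had) (hadDag ⨾ᵈ hadDag)
  | p1_cup : ZXEq (had ⨾ᵈ had)
      ((wire ⊗ᵈ Z 0 2 0 0) ⨾ᵈ (X 2 0 0 0 ⊗ᵈ wire).cast (a' := 1 + 2) (b' := 1) rfl rfl)
  | p1_cap : ZXEq (had ⨾ᵈ had)
      ((wire ⊗ᵈ X 0 2 0 0) ⨾ᵈ (Z 2 0 0 0 ⊗ᵈ wire).cast (a' := 1 + 2) (b' := 1) rfl rfl)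

/-! ### Stabilizer diagrams and GS-LC diagrams -/

/-- The angle is an integer multiple of `2π/3`. -/
def IsStabAngle (α : Real.Angle) : Prop := ∃ k : ℤ, α = ang k

/-- All phase angles in the diagram are integer multiples of `2π/3`. -/
def Diagram.IsStabilizer : {a b : ℕ} → Diagram a b → Prop
  | _, _, .Z _ _ α β => IsStabAngle α ∧ IsStabAngle β
  | _, _, .X _ _ α β => IsStabAngle α ∧ IsStabAngle β
  | _, _, .had => True
  | _, _, .hadDag => True
  | _, _, .swap => True
  | _, _, .wire => True
  | _, _, .empty => True
  | _, _, .seq D E => D.IsStabilizer ∧ E.IsStabilizer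
  | _, _, .par D E => D.IsStabilizer ∧ E.IsStabilizer

/-- Diagrams of single-qutrit Clifford operators: sequential composites of stabilizer phase gates
of either colour (among them `𝒮 = Z 1 1 0 (2π/3)`), `H` and `H†`. -/
inductive IsClifford : Diagram 1 1 → Prop
  | wire : IsClifford wire
  | had : IsClifford had
  | hadDag : IsClifford hadDag
  | green (α β : Real.Angle) : IsStabAngle α → IsStabAngle β → IsClifford (Z 1 1 α β)
  | red (α β : Real.Angle) : IsStabAngle α → IsStabAngle β → IsClifford (X 1 1 α β)
  | seq (D E : Diagram 1 1) : IsClifford D → IsClifford E → IsClifford (D ⨾ᵈ E)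

/-- `c 0 + c 1 + ⋯ + c (n-1)`. -/
def total : {n : ℕ} → (Fin n → ℕ) → ℕ
  | 0, _ => 0
  | _ + 1, c => c 0 + total fun i => c i.succ

theorem total_zero : (n : ℕ) → total (fun _ : Fin n => 0) = 0
  | 0 => rfl
  | n + 1 => by simp [total, total_zero n]

/-- The number of wires of an edge of weight `g`: none if `g = 0`, otherwise one. -/
def numWires (g : ZMod 3) : ℕ := if g = 0 then 0 else 1

/-- Side by side, for each entry of `g`: nothing for `0`, an `H` node for `1`, an `H†` node
for `2`. -/
def edgeNodes : {n : ℕ} → (g : Fin n → ZMod 3) →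
    Diagram (total fun i => numWires (g i)) (total fun i => numWires (g i))
  | 0, _ => empty
  | _ + 1, g => (layer fun _ : Fin (numWires (g 0)) => if g 0 = 1 then had else hadDag) ⊗ᵈ
      edgeNodes fun i => g i.succ

/-- The crossing that takes bundles of `w 0, w 1, …` wires followed by bundles of `c 0, c 1, …`
wires to the order `w 0, c 0, w 1, c 1, …`. -/
def distribute : {n : ℕ} → (w c : Fin n → ℕ) →
    Diagram (total w + total c) (total fun i => w i + c i)
  | 0, _, _ => empty
  | _ + 1, w, c =>
      (wires (w 0) ⊗ᵈ braid (total fun i => w i.succ) (c 0) ⊗ᵈ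
          wires (total fun i => c i.succ)).cast
        (a' := w 0 + (total fun i => w i.succ) + (c 0 + total fun i => c i.succ))
        (b' := w 0 + c 0 + ((total fun i => w i.succ) + total fun i => c i.succ))
        (by omega) (by omega) ⨾ᵈ
      (wires (w 0 + c 0) ⊗ᵈ distribute (fun i => w i.succ) fun i => c i.succ)

/-- The diagram of the weighted graph `Γ` in which vertex `i` has `c i` additional input wires:
for each vertex one green node with one output, and for each pair `i < j` with `Γ i j ≠ 0` one
`H` node (`Γ i j = 1`) or `H†` node (`Γ i j = 2`) joining the green nodes of `i` and `j`.
The first vertex is drawn with the edges that leave it, and these become inputs of the others. -/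
noncomputable def openGraph : {n : ℕ} → (Γ : Matrix (Fin n) (Fin n) (ZMod 3)) → (c : Fin n → ℕ) →
    Diagram (total c) n
  | 0, _, _ => empty
  | n + 1, Γ, c =>
      let g : Fin n → ZMod 3 := fun i => Γ 0 i.succ
      let w : Fin n → ℕ := fun i => numWires (g i)
      let c' : Fin n → ℕ := fun i => c i.succ
      (Z (c 0) (1 + total w) 0 0 ⨾ᵈ (wire ⊗ᵈ edgeNodes g)) ⊗ᵈ wires (total c') ⨾ᵈ
      (wire ⊗ᵈ (distribute w c' ⨾ᵈ
          openGraph (fun i j => Γ i.succ j.succ) fun i => w i + c' i)).cast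
        (Nat.add_assoc 1 (total w) (total c')).symm (Nat.add_comm 1 n)

/-- The graph state diagram of the `ℤ/3`-weighted graph with adjacency matrix `Γ`. -/
noncomputable def graphState {n : ℕ} (Γ : Matrix (Fin n) (Fin n) (ZMod 3)) : Diagram 0 n :=
  (openGraph Γ fun _ => 0).cast (total_zero n) rfl

/-- GS-LC diagrams: a graph state diagram with a single-qutrit Clifford operator on each
output. -/
def IsGSLC {n : ℕ} (D : Diagram 0 n) : Prop :=
  ∃ (Γ : Matrix (Fin n) (Fin n) (ZMod 3)) (U : Fin n → Diagram 1 1),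
    Γ.IsSymm ∧ (∀ v, Γ v v = 0) ∧ (∀ v, IsClifford (U v)) ∧ D = graphState Γ ⨾ᵈ layer U

end QutritZX

namespace QutritZX

open Diagram

/-! ### Stable diagrams: the monoid of diagrams up to adding wires on the right -/

/-! The calculations take place in a monoid `M`: diagrams modulo the calculus and modulo extra wires
on the right. Composition is the product, and adding wires on the left is an endomorphism `↟`. The
tensor product then becomes `ι D * ι E ↟ b`, and the interchange law becomes the sliding rule
`HasAr.comm`. Nothing is lost for diagrams of the same type (`zxEq_of_ι_eq`), because padding wires
can be closed off by a non-zero scalar.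

A stabilizer phase is a quadratic function `a x + b x²` on ℤ/3. A graph with such phases (`Gr`)
grows one vertex at a time: a new green node enters in front, is coupled to the older wires by
controlled phase gates and is carried past them (`row`). The rewriting has two halves.

First, every stabilizer diagram `0 → n` is a graph with some vertices closed by green effects
(`FA.ι`). Closed graphs are stable under crossings, phases, controlled phase gates, new vertices and
green effects. `H`, `H†`, copying and merging are composites of these, for instance `H` as a new
vertex joined to an old one that is then closed (`Hd_eq`).

Second, closed vertices are removed one by one (`Gr.eliminate`). If the closed vertex has `b ≠ 0`, a
controlled shift `V t` aimed at it acts, by completing the square, as a controlled phase gate of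
weight `2bt` (`Zs_Zs_V`). An edge at that vertex is traded for such a shift, which changes the
weights of the other vertex (`V_T_T`) and dies at the green effect (`V_ef`). When all edges are gone
a non-zero Gauss sum remains (`Gr.close`). If `b = 0` and there is a neighbour, then up to `H†` and
a quadratic phase on the neighbour the closed vertex can be removed as well (`Gr.pivot`). That
operator either turns into a phase at another closed vertex or joins the local Clifford operators on
the outputs. If `b = 0` and there is no edge, the vertex is a scalar, non-zero because the state is.

The gate identities rest on two facts: controlled phase gates add their weights (`CZ_mul`), and
controlled shifts act linearly on them (`V_CZ`). Both come from the bialgebra rule; the first also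
uses the Euler decomposition through `b(x+y)² = bx² + 2bxy + by²`. Soundness enters only to make
non-vanishing of the interpretation an invariant of classes in `M`.

It remains to identify the prescribed graph state diagram, built from its first vertex on, with a
product of controlled phase gates (`ι_openGraph`), and to reorder this product so that the last
vertex is split off (`allCZ_last`), which is how `Gr` grows. -/

theorem ZXEq.src_eq {a b a' b' : ℕ} {D : Diagram a b} {E : Diagram a' b'} (h : ZXEq D E) :
    a = a' := by
  induction h <;> omega

theorem ZXEq.tgt_eq {a b a' b' : ℕ} {D : Diagram a b} {E : Diagram a' b'} (h : ZXEq D E) :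
    b = b' := by
  induction h <;> omega

theorem ZXEq.cast {a b a' b' : ℕ} (ha : a = a') (hb : b = b') (D : Diagram a b) :
    ZXEq (D.cast ha hb) D := by
  subst ha; subst hb; exact .refl _

theorem ZXEq.wires_congr {m n : ℕ} (h : m = n) : ZXEq (wires m) (wires n) := by
  subst h; exact .refl _

theorem ZXEq.wires_par (m : ℕ) : (n : ℕ) → ZXEq (wires m ⊗ᵈ wires n) (wires (m + n))
  | 0 => .par_empty _
  | n + 1 => .trans (.symm (.par_assoc (wires m) (wires n) wire))
      (.par_congr (ZXEq.wires_par m n) (.refl wire))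

theorem ZXEq.wires_one : ZXEq (wires 1) wire := .empty_par _

/-- Composition of diagrams whose middle arities are only propositionally equal. -/
def Diagram.comp {a b b' c : ℕ} (h : b = b') (D : Diagram a b) (E : Diagram b' c) : Diagram a c :=
  D.cast rfl h ⨾ᵈ E

theorem ZXEq.comp_congr {a b c b₀ a' b' c' b₀' : ℕ} (h : b = b₀) (h' : b' = b₀')
    {D : Diagram a b} {E : Diagram b₀ c} {D' : Diagram a' b'} {E' : Diagram b₀' c'}
    (hD : ZXEq D D') (hE : ZXEq E E') : ZXEq (D.comp h E) (D'.comp h' E') :=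
  .seq_congr (.trans (.cast _ _ D) (.trans hD (.symm (.cast _ _ D')))) hE

theorem ZXEq.comp_assoc {a b b' c c' d : ℕ} (h : b = b') (h' : c = c') (D : Diagram a b)
    (E : Diagram b' c) (F : Diagram c' d) :
    ZXEq ((D.comp h E).comp h' F) (D.comp h (E.comp h' F)) := by
  subst h; subst h'; exact .seq_assoc _ _ _

theorem ZXEq.comp_par {a b b' c d e e' f : ℕ} (h : b = b') (h' : e = e') (D : Diagram a b)
    (E : Diagram b' c) (F : Diagram d e) (G : Diagram e' f) :
    ZXEq (D.comp h E ⊗ᵈ F.comp h' G) ((D ⊗ᵈ F).comp (by rw [h, h']) (E ⊗ᵈ G)) := by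
  subst h; subst h'; exact .interchange _ _ _ _

theorem ZXEq.comp_par_wires {a b b' c : ℕ} (h : b = b') (D : Diagram a b) (E : Diagram b' c)
    (n : ℕ) : ZXEq (D.comp h E ⊗ᵈ wires n)
      ((D ⊗ᵈ wires n).comp (by rw [h]) (E ⊗ᵈ wires n)) :=
  .trans (.par_congr (.refl _) (.symm (.wires_seq (wires n)))) (.comp_par h rfl D E _ _)

theorem ZXEq.wires_par_comp {a b b' c : ℕ} (h : b = b') (D : Diagram a b) (E : Diagram b' c)
    (n : ℕ) : ZXEq (wires n ⊗ᵈ D.comp h E)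
      ((wires n ⊗ᵈ D).comp (by rw [h]) (wires n ⊗ᵈ E)) :=
  .trans (.par_congr (.symm (.wires_seq (wires n))) (.refl _)) (.comp_par rfl h _ _ D E)

theorem ZXEq.par_wires_par {a b : ℕ} (D : Diagram a b) (k l : ℕ) :
    ZXEq (D ⊗ᵈ wires k ⊗ᵈ wires l) (D ⊗ᵈ wires (k + l)) :=
  .trans (.par_assoc _ _ _) (.par_congr (.refl _) (.wires_par k l))

/-- Diagrams with any numbers of inputs and outputs. -/
abbrev AnyDiagram : Type := Σ a b : ℕ, Diagram a b

/-- Equality in the calculus after adding wires on the right. -/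
def StableEq (D E : AnyDiagram) : Prop :=
  ∃ k l : ℕ, ZXEq (D.2.2 ⊗ᵈ wires k) (E.2.2 ⊗ᵈ wires l)

theorem StableEq.of_zxEq {a b a' b' : ℕ} {D : Diagram a b} {E : Diagram a' b'} (h : ZXEq D E) :
    StableEq ⟨a, b, D⟩ ⟨a', b', E⟩ := ⟨0, 0, .par_congr h (.refl _)⟩

theorem StableEq.pad {a b : ℕ} (D : Diagram a b) (k : ℕ) :
    StableEq ⟨_, _, D ⊗ᵈ wires k⟩ ⟨_, _, D⟩ := ⟨0, k, .par_empty _⟩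

theorem StableEq.symm {D E : AnyDiagram} (h : StableEq D E) : StableEq E D :=
  let ⟨k, l, h⟩ := h
  ⟨l, k, .symm h⟩

theorem StableEq.trans {D E F : AnyDiagram} (h : StableEq D E) (h' : StableEq E F) :
    StableEq D F := by
  obtain ⟨k, l, h⟩ := h
  obtain ⟨m, n, h'⟩ := h'
  -- The middle diagram carries `l` wires in one equation and `m` in the other; padding each
  -- equation by the other's number makes them meet.
  refine ⟨k + m, n + l, ?_⟩
  refine .trans (.symm (.par_wires_par _ _ _)) (.trans (.par_congr h (.refl _)) ?_)
  refine .trans (.par_wires_par _ _ _)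
    (.trans (.par_congr (.refl _) (.wires_congr (Nat.add_comm l m))) ?_)
  · exact .trans (.symm (.par_wires_par _ _ _)) (.trans (.par_congr h' (.refl _))
      (.par_wires_par _ _ _))

instance stableSetoid : Setoid AnyDiagram where
  r := StableEq
  iseqv :=
    { refl := fun _ => ⟨0, 0, .refl _⟩
      symm := StableEq.symm
      trans := StableEq.trans }

/-- Diagrams modulo the calculus and modulo adding wires on the right. -/
def M : Type := Quotient stableSetoid

/-- The class of a diagram. -/
def ι {a b : ℕ} (D : Diagram a b) : M := Quotient.mk stableSetoid ⟨a, b, D⟩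

theorem ι_eq {a b a' b' : ℕ} {D : Diagram a b} {E : Diagram a' b'} (h : ZXEq D E) : ι D = ι E :=
  Quotient.sound (StableEq.of_zxEq h)

theorem ι_cast {a b a' b' : ℕ} (ha : a = a') (hb : b = b') (D : Diagram a b) :
    ι (D.cast ha hb) = ι D := ι_eq (.cast ha hb D)

theorem ι_pad {a b : ℕ} (D : Diagram a b) (k : ℕ) : ι (D ⊗ᵈ wires k) = ι D :=
  Quotient.sound (StableEq.pad D k)

/-- Composition after padding. -/
def padComp (D E : AnyDiagram) : AnyDiagram :=
  ⟨D.1 + E.1, E.2.1 + D.2.1,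
    (D.2.2 ⊗ᵈ wires E.1).comp (Nat.add_comm _ _) (E.2.2 ⊗ᵈ wires D.2.1)⟩

/-- Any two paddings that make the factors composable give composites which differ only by wires on
the right, so a product in the monoid may be computed with whichever padding is convenient. -/
theorem stableEq_padComp {a b c d k l : ℕ} (D : Diagram a b) (E : Diagram c d)
    (h : b + k = c + l) :
    StableEq ⟨_, _, (D ⊗ᵈ wires k).comp h (E ⊗ᵈ wires l)⟩ (padComp ⟨a, b, D⟩ ⟨c, d, E⟩) := by
  refine ⟨c, k, ?_⟩
  refine .trans (.comp_par_wires _ _ _ _) (.trans ?_ (.symm (.comp_par_wires _ _ _ _)))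
  refine .comp_congr _ _ ?_ ?_
  · refine .trans (.par_wires_par _ _ _) (.trans (.par_congr (.refl _) ?_)
      (.symm (.par_wires_par _ _ _)))
    exact .wires_congr (by dsimp only; omega)
  · refine .trans (.par_wires_par _ _ _) (.trans (.par_congr (.refl _) ?_)
      (.symm (.par_wires_par _ _ _)))
    exact .wires_congr (by dsimp only; omega)

theorem padComp_congr {D D' E E' : AnyDiagram} (hD : StableEq D D') (hE : StableEq E E') :
    StableEq (padComp D E) (padComp D' E') := by
  obtain ⟨a, b, D⟩ := D
  obtain ⟨a', b', D'⟩ := D'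
  obtain ⟨c, d, E⟩ := E
  obtain ⟨c', d', E'⟩ := E'
  obtain ⟨k, k', hD⟩ := hD
  obtain ⟨l, l', hE⟩ := hE
  dsimp only at hD hE
  have hb : b + k = b' + k' := hD.tgt_eq
  have hc : c + l = c' + l' := hE.src_eq
  -- The padding contains the wires that the two given equations need, so that these can be applied
  -- factor by factor.
  have h1 := stableEq_padComp D E (k := k + (c + l)) (l := l + (b + k)) (by omega)
  have h2 := stableEq_padComp D' E' (k := k' + (c' + l')) (l := l' + (b' + k')) (by omega)
  refine (StableEq.symm h1).trans (StableEq.trans (StableEq.of_zxEq ?_) h2)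
  refine .comp_congr _ _ ?_ ?_
  · refine .trans (.symm (.par_wires_par _ _ _)) (.trans (.par_congr hD ?_)
      (.par_wires_par _ _ _))
    exact .wires_congr hc
  · refine .trans (.symm (.par_wires_par _ _ _)) (.trans (.par_congr hE ?_)
      (.par_wires_par _ _ _))
    exact .wires_congr hb

theorem padComp_assoc (D E F : AnyDiagram) :
    StableEq (padComp (padComp D E) F) (padComp D (padComp E F)) := by
  obtain ⟨a, b, D⟩ := D
  obtain ⟨c, d, E⟩ := E
  obtain ⟨e, f, F⟩ := F
  refine StableEq.of_zxEq ?_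
  refine .trans (.comp_congr _ ?_ (.comp_par_wires _ _ _ _) (.refl _)) ?_
  · simp only [padComp]; omega
  refine .trans (.comp_assoc _ _ _ _ _) ?_
  refine .trans ?_ (.comp_congr ?_ _ (.refl _) (.symm (.comp_par_wires _ _ _ _)))
  · refine .comp_congr _ _ (.par_wires_par _ _ _) (.comp_congr _ _ ?_ ?_)
    · refine .trans (.par_wires_par _ _ _) (.trans (.par_congr (.refl _) ?_)
        (.symm (.par_wires_par _ _ _)))
      exact .wires_congr (by simp only; omega)
    · exact (.symm (.par_wires_par _ _ _))
  · simp only [padComp]; omega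

noncomputable instance : Monoid M where
  mul := Quotient.map₂ padComp (fun _ _ h _ _ h' => padComp_congr h h')
  one := ι empty
  mul_assoc x y z := by
    induction x using Quotient.inductionOn
    induction y using Quotient.inductionOn
    induction z using Quotient.inductionOn
    exact Quotient.sound (padComp_assoc _ _ _)
  one_mul x := by
    induction x using Quotient.inductionOn with
    | h D =>
      refine Quotient.sound (StableEq.of_zxEq (E := D.2.2) ?_)
      refine .trans (.comp_congr _ rfl (.empty_par _) (.par_empty _)) (.wires_seq _)
  mul_one x := by
    induction x using Quotient.inductionOn with
    | h D =>
      refine Quotient.sound (StableEq.of_zxEq (E := D.2.2) ?_)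
      refine .trans (.comp_congr _ rfl (.par_empty _) (.empty_par _)) (.seq_wires _)

theorem ι_comp {a b b' c : ℕ} (h : b = b') (D : Diagram a b) (E : Diagram b' c) :
    ι (D.comp h E) = ι D * ι E := by
  refine Quotient.sound (StableEq.trans (StableEq.of_zxEq ?_)
    (stableEq_padComp D E (k := 0) (l := 0) (by omega)))
  exact .comp_congr _ _ (.symm (.par_empty _)) (.symm (.par_empty _))

theorem ι_seq {a b c : ℕ} (D : Diagram a b) (E : Diagram b c) : ι (D ⨾ᵈ E) = ι D * ι E :=
  ι_comp rfl D E

theorem ι_wires (n : ℕ) : ι (wires n) = 1 :=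
  (ι_eq (.symm (.empty_par _))).trans (ι_pad empty n)

theorem ι_wire : ι wire = 1 := (ι_eq (.symm .wires_one)).trans (ι_wires 1)

/-- Adding wires on the left. -/
noncomputable def shift (i : ℕ) : M →* M where
  toFun := Quotient.map (fun D => ⟨i + D.1, i + D.2.1, wires i ⊗ᵈ D.2.2⟩) (by
    rintro D E ⟨k, l, h⟩
    exact ⟨k, l, .trans (.par_assoc _ _ _) (.trans (.par_congr (.refl _) h)
      (.symm (.par_assoc _ _ _)))⟩)
  map_one' := (ι_pad (wires i) 0).trans (ι_wires i)
  map_mul' x y := by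
    induction x using Quotient.inductionOn with | h D => ?_
    induction y using Quotient.inductionOn with | h E => ?_
    refine (ι_eq (.wires_par_comp _ _ _ _)).trans ?_
    rw [ι_comp]
    congr 1
    · exact (ι_eq (.symm (.par_assoc _ _ _))).trans (ι_pad _ _)
    · exact (ι_eq (.symm (.par_assoc _ _ _))).trans (ι_pad _ _)

/-- `x` with `i` wires added on the left. -/
noncomputable def sh (x : M) (i : ℕ) : M := shift i x

infixl:80 " ↟ " => sh

theorem ι_shift {a b : ℕ} (D : Diagram a b) (i : ℕ) : ι D ↟ i = ι (wires i ⊗ᵈ D) := rfl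

theorem shift_zero (x : M) : x ↟ 0 = x := by
  induction x using Quotient.inductionOn with | h D => exact ι_eq (.empty_par _)

theorem shift_shift (x : M) (i j : ℕ) : x ↟ i ↟ j = x ↟ (i + j) := by
  induction x using Quotient.inductionOn with | h D => ?_
  refine ι_eq (.trans (.symm (.par_assoc _ _ _)) (.par_congr (.trans (.wires_par _ _) ?_)
    (.refl _)))
  exact .wires_congr (Nat.add_comm _ _)

theorem mul_shift (x y : M) (i : ℕ) : (x * y) ↟ i = x ↟ i * y ↟ i := map_mul _ _ _

theorem one_shift (i : ℕ) : (1 : M) ↟ i = 1 := map_one _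

/-- Perform `D` first and then `E` beside the outputs of `D`; `ι_par'` uses the opposite order,
beside the inputs. -/
theorem ι_par {a b c d : ℕ} (D : Diagram a b) (E : Diagram c d) :
    ι (D ⊗ᵈ E) = ι D * ι E ↟ b := by
  rw [ι_shift, ← ι_pad D c, ← ι_seq]
  exact ι_eq (.trans (.par_congr (.symm (.seq_wires D)) (.symm (.wires_seq E)))
    (.interchange _ _ _ _))

theorem ι_par' {a b c d : ℕ} (D : Diagram a b) (E : Diagram c d) :
    ι (D ⊗ᵈ E) = ι E ↟ a * ι D := by
  rw [ι_shift, ← ι_pad D d, ← ι_seq]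
  exact ι_eq (.trans (.par_congr (.symm (.wires_seq D)) (.symm (.seq_wires E)))
    (.interchange _ _ _ _))

/-- `x` is the class of a diagram with `a` inputs and `b` outputs. -/
class HasAr (x : M) (a b : outParam ℕ) : Prop where
  ex : ∃ D : Diagram a b, ι D = x

theorem hasAr_ι {a b : ℕ} (D : Diagram a b) : HasAr (ι D) a b := ⟨D, rfl⟩

/-- Both sides are the same parallel composite, performed in the two possible orders. This is the
form the interchange law takes in the monoid, and all sliding lemmas are instances of it. -/
theorem HasAr.comm {x : M} {a b : ℕ} (hx : HasAr x a b) (y : M) : x * y ↟ b = y ↟ a * x := by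
  obtain ⟨D, rfl⟩ := hx
  induction y using Quotient.inductionOn with | h E => ?_
  exact (ι_par D E.2.2).symm.trans (ι_par' D E.2.2)

theorem hasAr_one (n : ℕ) : HasAr 1 n n := ⟨wires n, ι_wires n⟩

theorem HasAr.mul {x y : M} {a b c : ℕ} (hx : HasAr x a b) (hy : HasAr y b c) :
    HasAr (x * y) a c := by
  obtain ⟨D, rfl⟩ := hx
  obtain ⟨E, rfl⟩ := hy
  exact ⟨D ⨾ᵈ E, ι_seq D E⟩

theorem HasAr.congr {x : M} {a b a' b' : ℕ} (hx : HasAr x a b) (ha : a = a') (hb : b = b') :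
    HasAr x a' b' := by
  subst ha; subst hb; exact hx

theorem HasAr.shift {x : M} {a b : ℕ} (hx : HasAr x a b) (i : ℕ) :
    HasAr (x ↟ i) (i + a) (i + b) := by
  obtain ⟨D, rfl⟩ := hx
  exact ⟨wires i ⊗ᵈ D, rfl⟩

theorem HasAr.pad {x : M} {a b : ℕ} (hx : HasAr x a b) (k : ℕ) : HasAr x (a + k) (b + k) := by
  obtain ⟨D, rfl⟩ := hx
  exact ⟨D ⊗ᵈ wires k, ι_pad D k⟩

theorem HasAr.slide {x : M} {a b : ℕ} (hx : HasAr x a b) (y : M) {i j : ℕ} (k : ℕ)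
    (hi : i = b + k) (hj : j = a + k) : x * y ↟ i = y ↟ j * x := by
  subst hi hj
  exact (hx.pad k).comm y

/-- The sliding rule with `x` shifted to position `p`. -/
theorem HasAr.slide_shift {x : M} {a b : ℕ} (hx : HasAr x a b) (y : M) (p : ℕ) {i j : ℕ} (k : ℕ)
    (hi : i = b + p + k) (hj : j = a + p + k) : x ↟ p * y ↟ i = y ↟ j * x ↟ p :=
  (hx.shift p).slide y k (by omega) (by omega)

/-! ### Soundness up to non-zero scalars -/

/-- Extend an assignment of finitely many values by zeros. -/
def extend {b : ℕ} (z : Fin b → ZMod 3) (i : ℕ) : ZMod 3 := if h : i < b then z ⟨i, h⟩ else 0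

/-- The entry of the interpretation at assignments of values to all natural numbers. -/
noncomputable def Diagram.amp {a b : ℕ} (D : Diagram a b) (y x : ℕ → ZMod 3) : ℂ :=
  D.interp (fun i => y i) (fun i => x i)

theorem restrict_extend {b : ℕ} (z : Fin b → ZMod 3) : (fun i : Fin b => extend z i) = z := by
  funext i; simp [extend]

theorem interp_eq_amp {a b : ℕ} (D : Diagram a b) (y : Fin b → ZMod 3) (x : Fin a → ZMod 3) :
    D.interp y x = D.amp (extend y) (extend x) := by
  simp only [Diagram.amp, restrict_extend]

theorem interp_ne_zero_iff {a b : ℕ} (D : Diagram a b) :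
    D.interp ≠ 0 ↔ ∃ y x, D.amp y x ≠ 0 := by
  constructor
  · intro h
    by_contra! hc
    exact h (by ext y x; rw [interp_eq_amp, hc]; rfl)
  · rintro ⟨y, x, h⟩ h0
    exact h (by simp [Diagram.amp, h0])

theorem amp_congr {a b : ℕ} (D : Diagram a b) {y y' x x' : ℕ → ZMod 3} (hy : ∀ i < b, y i = y' i)
    (hx : ∀ i < a, x i = x' i) : D.amp y x = D.amp y' x' := by
  unfold Diagram.amp
  congr 1 <;> funext i
  · exact hy i i.2
  · exact hx i i.2

theorem amp_seq {a b c : ℕ} (D : Diagram a b) (E : Diagram b c) (y x : ℕ → ZMod 3) :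
    (D ⨾ᵈ E).amp y x = ∑ z : Fin b → ZMod 3, E.amp y (extend z) * D.amp (extend z) x := by
  simp only [Diagram.amp, Diagram.interp, Matrix.mul_apply, restrict_extend]

theorem amp_par {a b c d : ℕ} (D : Diagram a b) (E : Diagram c d) (y x : ℕ → ZMod 3) :
    (D ⊗ᵈ E).amp y x = D.amp y x * E.amp (fun i => y (b + i)) (fun i => x (a + i)) := rfl

theorem amp_cast {a b a' b' : ℕ} (ha : a = a') (hb : b = b') (D : Diagram a b) :
    (D.cast ha hb).amp = D.amp := by
  subst ha; subst hb; rfl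

/-! ### Diagrams given by weighted functions on basis vectors -/

/-- `D` sends the basis vector `x` to a sum of multiples `w j x` of the basis vectors `g j x`. -/
def SumFun {J : Type} [Fintype J] {a b : ℕ} (D : Diagram a b) (w : J → (ℕ → ZMod 3) → ℂ)
    (g : J → (ℕ → ZMod 3) → ℕ → ZMod 3) : Prop :=
  ∀ y x, D.amp y x = ∑ j, if ∀ i < b, y i = g j x i then w j x else 0

/-- `D` sends the basis vector `x` to a multiple `w x` of the basis vector `g x`. -/
def IsFun {a b : ℕ} (D : Diagram a b) (w : (ℕ → ZMod 3) → ℂ)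
    (g : (ℕ → ZMod 3) → ℕ → ZMod 3) : Prop :=
  ∀ y x, D.amp y x = if ∀ i < b, y i = g x i then w x else 0

theorem sum_extend_ite {b : ℕ} (f : (ℕ → ZMod 3) → ℂ) (g : ℕ → ZMod 3)
    (hf : ∀ z z' : ℕ → ZMod 3, (∀ i < b, z i = z' i) → f z = f z') (w : ℂ) :
    ∑ z : Fin b → ZMod 3, f (extend z) * (if ∀ i < b, extend z i = g i then w else 0) =
      w * f g := by
  rw [Finset.sum_eq_single (fun i : Fin b => g i)]
  · rw [if_pos (fun i hi => by simp [extend, hi]), mul_comm]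
    congr 1
    exact hf _ _ fun i hi => by simp [extend, hi]
  · intro z _ hz
    rw [if_neg, mul_zero]
    intro h
    exact hz (by funext i; rw [← h i i.2]; simp [extend])
  · simp

theorem SumFun.amp_seq {J : Type} [Fintype J] {a b c : ℕ} {D : Diagram a b}
    {w : J → (ℕ → ZMod 3) → ℂ} {g : J → (ℕ → ZMod 3) → ℕ → ZMod 3} (h : SumFun D w g)
    (E : Diagram b c) (y x : ℕ → ZMod 3) :
    (D ⨾ᵈ E).amp y x = ∑ j, w j x * E.amp y (g j x) := by
  rw [QutritZX.amp_seq]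
  simp only [h _ x, Finset.mul_sum]
  rw [Finset.sum_comm]
  refine Finset.sum_congr rfl fun j _ => ?_
  exact sum_extend_ite (fun z => E.amp y z) _ (fun z z' hz => amp_congr E (fun _ _ => rfl) hz) _

theorem IsFun.amp_seq {a b c : ℕ} {D : Diagram a b} {w : (ℕ → ZMod 3) → ℂ}
    {g : (ℕ → ZMod 3) → ℕ → ZMod 3} (h : IsFun D w g) (E : Diagram b c) (y x : ℕ → ZMod 3) :
    (D ⨾ᵈ E).amp y x = w x * E.amp y (g x) := by
  rw [SumFun.amp_seq (J := Unit) (w := fun _ => w) (g := fun _ => g) (fun y x => by simp [h y x])]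
  simp

/-- Composition with a diagram whose adjoint sends basis vectors to sums of basis vectors. -/
theorem amp_seq_of_coSumFun {J : Type} [Fintype J] {a b c : ℕ} (D : Diagram a b) {E : Diagram b c}
    {w : J → (ℕ → ZMod 3) → ℂ} {g : J → (ℕ → ZMod 3) → ℕ → ZMod 3} (y x : ℕ → ZMod 3)
    (h : ∀ z, E.amp y z = ∑ j, if ∀ i < b, z i = g j y i then w j y else 0) :
    (D ⨾ᵈ E).amp y x = ∑ j, w j y * D.amp (g j y) x := by
  rw [QutritZX.amp_seq]
  simp only [h, Finset.sum_mul]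
  rw [Finset.sum_comm]
  refine Finset.sum_congr rfl fun j _ => ?_
  simp only [mul_comm _ (D.amp _ x)]
  rw [mul_comm (D.amp (g j y) x)]
  exact sum_extend_ite (fun z => D.amp z x) _ (fun z z' hz => amp_congr D hz (fun _ _ => rfl)) _

theorem IsFun.seq {a b c : ℕ} {D : Diagram a b} {E : Diagram b c} {w w' : (ℕ → ZMod 3) → ℂ}
    {g g' : (ℕ → ZMod 3) → ℕ → ZMod 3} (h : IsFun D w g) (h' : IsFun E w' g') :
    IsFun (D ⨾ᵈ E) (fun x => w x * w' (g x)) (fun x => g' (g x)) := fun y x => by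
  rw [h.amp_seq, h' y]
  simp

theorem forall_lt_add {P : ℕ → Prop} {m n : ℕ} :
    (∀ i < m + n, P i) ↔ (∀ i < m, P i) ∧ ∀ i < n, P (m + i) := by
  constructor
  · exact fun h => ⟨fun i hi => h i (by omega), fun i hi => h _ (by omega)⟩
  · rintro ⟨h, h'⟩ i hi
    by_cases him : i < m
    · exact h i him
    · simpa [Nat.add_sub_cancel' (not_lt.1 him)] using h' (i - m) (by omega)

/-- Place the sequence `u` from position `b` on. -/
def splice (b : ℕ) (v u : ℕ → ZMod 3) (i : ℕ) : ZMod 3 := if i < b then v i else u (i - b)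

theorem splice_lt {b i : ℕ} (v u : ℕ → ZMod 3) (h : i < b) : splice b v u i = v i := if_pos h

theorem splice_add (b i : ℕ) (v u : ℕ → ZMod 3) : splice b v u (b + i) = u i := by
  simp [splice]

theorem forall_eq_splice {b d : ℕ} {y v u : ℕ → ZMod 3} :
    (∀ i < b + d, y i = splice b v u i) ↔ (∀ i < b, y i = v i) ∧ ∀ i < d, y (b + i) = u i := by
  rw [forall_lt_add]
  simp only [splice_add]
  refine and_congr_left' (forall₂_congr fun i hi => ?_)
  rw [splice_lt _ _ hi]

theorem IsFun.par {a b c d : ℕ} {D : Diagram a b} {E : Diagram c d} {w w' : (ℕ → ZMod 3) → ℂ}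
    {g g' : (ℕ → ZMod 3) → ℕ → ZMod 3} (h : IsFun D w g) (h' : IsFun E w' g') :
    IsFun (D ⊗ᵈ E) (fun x => w x * w' fun i => x (a + i))
      (fun x => splice b (g x) (g' fun i => x (a + i))) := fun y x => by
  rw [amp_par, h y, h' _]
  simp only [forall_eq_splice]
  by_cases h1 : ∀ i < b, y i = g x i
  · by_cases h2 : ∀ i < d, y (b + i) = g' (fun i => x (a + i)) i
    · rw [if_pos h1, if_pos h2, if_pos ⟨h1, h2⟩]
    · rw [if_neg h2, mul_zero]
      exact (if_neg fun h => h2 h.2).symm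
  · rw [if_neg h1, zero_mul]
    exact (if_neg fun h => h1 h.1).symm

theorem IsFun.cast {a b a' b' : ℕ} {D : Diagram a b} {w : (ℕ → ZMod 3) → ℂ}
    {g : (ℕ → ZMod 3) → ℕ → ZMod 3} (h : IsFun D w g) (ha : a = a') (hb : b = b') :
    IsFun (D.cast ha hb) w g := by
  subst ha; subst hb; exact h

theorem IsFun.congr {a b : ℕ} {D : Diagram a b} {w w' : (ℕ → ZMod 3) → ℂ}
    {g g' : (ℕ → ZMod 3) → ℕ → ZMod 3} (h : IsFun D w g) (hw : ∀ x, w x = w' x)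
    (hg : ∀ x, ∀ i < b, g x i = g' x i) : IsFun D w' g' := fun y x => by
  rw [h y, hw]
  congr 1
  exact propext (forall₂_congr fun i hi => by rw [hg x i hi])

theorem isFun_empty : IsFun empty (fun _ => 1) (fun x => x) := fun y x => by
  rw [if_pos (by simp)]
  simp only [Diagram.amp, Diagram.interp, Matrix.one_apply]
  exact if_pos (Subsingleton.elim _ _)

theorem isFun_wire : IsFun wire (fun _ => 1) (fun x => x) := fun y x => by
  have : (∀ i < 1, y i = x i) ↔ (fun i : Fin 1 => y i) = fun i : Fin 1 => x i := by
    simp [funext_iff]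
  simp only [Diagram.amp, Diagram.interp, Matrix.one_apply, this]

theorem isFun_wires : (n : ℕ) → IsFun (wires n) (fun _ => 1) (fun x => x)
  | 0 => isFun_empty
  | n + 1 => ((isFun_wires n).par isFun_wire).congr (fun _ => by simp) fun x i _ => by
      simp only [splice]
      split_ifs with h
      · rfl
      · rw [Nat.add_sub_cancel' (not_lt.1 h)]

theorem forall_lt_two {P : ℕ → Prop} : (∀ i < 2, P i) ↔ P 0 ∧ P 1 := by
  constructor
  · exact fun h => ⟨h 0 (by omega), h 1 (by omega)⟩
  · rintro ⟨h, h'⟩ i hi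
    interval_cases i <;> assumption

theorem isFun_swap : IsFun swap (fun _ => 1) (fun x i => if i = 0 then x 1 else x 0) :=
  fun y x => by
  simp only [forall_lt_two]
  simp [Diagram.amp, Diagram.interp]

/-! ### Characters of ℤ/3 and the entries of the generators -/

/-- `ω ^ t`. -/
noncomputable def e (t : ZMod 3) : ℂ := omega ^ t.val

theorem omega_pow_three : omega ^ 3 = 1 := by
  rw [omega, ← Complex.exp_nat_mul]
  convert Complex.exp_two_pi_mul_I using 2
  push_cast; ring

theorem omega_ne_one : omega ≠ 1 := by
  have h : IsPrimitiveRoot omega 3 := by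
    have := Complex.isPrimitiveRoot_exp 3 (by norm_num)
    simpa [omega] using this
  exact h.ne_one (by norm_num)

theorem omega_sum : 1 + omega + omega ^ 2 = 0 := by
  have h : (omega - 1) * (1 + omega + omega ^ 2) = 0 := by
    linear_combination omega_pow_three
  exact (mul_eq_zero.1 h).resolve_left (sub_ne_zero.2 omega_ne_one)

theorem e_zero : e 0 = 1 := by simp [e]

theorem e_one : e 1 = omega := by simp [e, ZMod.val_one]

theorem e_two : e 2 = omega ^ 2 := by
  have : (2 : ZMod 3).val = 2 := rfl
  simp [e, this]

theorem e_natCast (k : ℕ) : e (k : ZMod 3) = omega ^ k := by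
  rw [e, ZMod.val_natCast]
  conv_rhs => rw [← Nat.div_add_mod k 3, pow_add, pow_mul, omega_pow_three, one_pow, one_mul]

theorem e_add (s t : ZMod 3) : e (s + t) = e s * e t := by
  rw [← ZMod.natCast_zmod_val s, ← ZMod.natCast_zmod_val t, ← Nat.cast_add]
  simp only [e_natCast, pow_add]

theorem sum_zmod3 {A : Type*} [AddCommMonoid A] (f : ZMod 3 → A) :
    ∑ j, f j = f 0 + f 1 + f 2 := Fin.sum_univ_three f

theorem zmod3_cases (t : ZMod 3) : t = 0 ∨ t = 1 ∨ t = 2 := by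
  revert t; decide

theorem sum_e_mul (t : ZMod 3) : ∑ j : ZMod 3, e (j * t) = if t = 0 then 3 else 0 := by
  rw [sum_zmod3]
  rcases zmod3_cases t with rfl | rfl | rfl
  · simp [e_zero]; norm_num
  · rw [if_neg (by decide), zero_mul, one_mul, mul_one, e_zero, e_one, e_two, omega_sum]
  · rw [if_neg (by decide), zero_mul, one_mul, show (2 * 2 : ZMod 3) = 1 by decide, e_zero, e_one,
      e_two]
    linear_combination omega_sum

theorem e_sum {n : ℕ} (f : ℕ → ZMod 3) :
    ∏ i : Fin n, e (f i) = e (∑ i ∈ Finset.range n, f i) := by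
  induction n with
  | zero => simp [e_zero]
  | succ n ih => rw [Fin.prod_univ_castSucc, Finset.sum_range_succ, e_add, ← ih]; rfl

theorem amp_Z (n m : ℕ) (α β : Real.Angle) (y x : ℕ → ZMod 3) :
    (Z n m α β).amp y x =
      ∑ j, if (∀ i < m, y i = j) ∧ (∀ i < n, x i = j) then phaseCoeff α β j else 0 := by
  simp only [Diagram.amp, Diagram.interp, Fin.forall_iff]

theorem amp_X (n m : ℕ) (α β : Real.Angle) (y x : ℕ → ZMod 3) :
    (X n m α β).amp y x = ∑ j, phaseCoeff α β j *
      e (j * (∑ i ∈ Finset.range m, y i - ∑ i ∈ Finset.range n, x i)) := by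
  simp only [Diagram.amp, Diagram.interp]
  refine Finset.sum_congr rfl fun j _ => ?_
  have h1 := e_sum (n := m) fun i => j * y i
  have h2 := e_sum (n := n) fun i => -(j * x i)
  simp only [e] at h1 h2
  rw [h1, h2, mul_assoc]
  change _ * (e _ * e _) = _
  rw [← e_add]
  simp only [sub_eq_add_neg, mul_add, mul_neg, Finset.mul_sum, Finset.sum_neg_distrib]

theorem amp_had (y x : ℕ → ZMod 3) : had.amp y x = e (y 0 * x 0) := rfl

theorem amp_hadDag (y x : ℕ → ZMod 3) : hadDag.amp y x = e (-(y 0 * x 0)) := rfl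

theorem amp_layer {n : ℕ} (U : Fin n → Diagram 1 1) (y x : ℕ → ZMod 3) :
    (layer U).amp y x = ∏ i : Fin n, (U i).amp (fun _ => y i) (fun _ => x i) := by
  induction n with
  | zero =>
    rw [Finset.univ_eq_empty, Finset.prod_empty]
    exact (isFun_empty y x).trans (if_pos (by simp))
  | succ n ih =>
    rw [Fin.prod_univ_castSucc, layer, amp_par, ih]
    congr 1
    exact amp_congr _ (fun i hi => by simp [Nat.lt_one_iff.1 hi])
      (fun i hi => by simp [Nat.lt_one_iff.1 hi])

theorem phaseCoeff_zero (j : ZMod 3) : phaseCoeff 0 0 j = 1 := by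
  simp [phaseCoeff]

theorem phaseCoeff_add (α β γ δ : Real.Angle) (j : ZMod 3) :
    phaseCoeff (α + γ) (β + δ) j = phaseCoeff α β j * phaseCoeff γ δ j := by
  unfold phaseCoeff
  split_ifs <;> simp [Real.Angle.toCircle_add]

theorem phaseCoeff_swap (α β : Real.Angle) (j : ZMod 3) :
    phaseCoeff β α j = phaseCoeff α β (-j) := by
  have h2 : (2 : ZMod 3) ≠ 0 ∧ (2 : ZMod 3) ≠ 1 ∧ (-2 : ZMod 3) = 1 ∧ (-1 : ZMod 3) = 2 := by decide
  rcases zmod3_cases j with rfl | rfl | rfl <;> simp [phaseCoeff, h2]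

theorem phaseCoeff_ne_zero (α β : Real.Angle) (j : ZMod 3) : phaseCoeff α β j ≠ 0 := by
  unfold phaseCoeff
  split_ifs <;> simp

theorem toCircle_ang_one : ((ang 1).toCircle : ℂ) = e 1 := by
  rw [ang, Real.Angle.toCircle_coe, Circle.coe_exp, e_one, omega]
  congr 1; push_cast; ring

theorem toCircle_ang_two : ((ang 2).toCircle : ℂ) = e 2 := by
  rw [ang, Real.Angle.toCircle_coe, Circle.coe_exp, e_two, omega, ← Complex.exp_nat_mul]
  congr 1; push_cast; ring

theorem phaseCoeff_one_two (j : ZMod 3) : phaseCoeff (ang 1) (ang 2) j = e j := by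
  rcases zmod3_cases j with rfl | rfl | rfl
  · simp [phaseCoeff, e_zero]
  · simp [phaseCoeff, toCircle_ang_one]
  · have h : (2 : ZMod 3) ≠ 0 ∧ (2 : ZMod 3) ≠ 1 := by decide
    simp [phaseCoeff, toCircle_ang_two, h]

theorem phaseCoeff_two_one (j : ZMod 3) : phaseCoeff (ang 2) (ang 1) j = e (-j) := by
  rw [phaseCoeff_swap, phaseCoeff_one_two]

theorem phaseCoeff_two_two (j : ZMod 3) : phaseCoeff (ang 2) (ang 2) j = e (-(j * j)) := by
  rcases zmod3_cases j with rfl | rfl | rfl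
  · simp [phaseCoeff, e_zero]
  · simp [phaseCoeff, toCircle_ang_two]; rfl
  · have h : (2 : ZMod 3) ≠ 0 ∧ (2 : ZMod 3) ≠ 1 := by decide
    simp [phaseCoeff, toCircle_ang_two, h]; rfl

theorem amp_X_zero (n m : ℕ) (y x : ℕ → ZMod 3) : (X n m 0 0).amp y x =
    if ∑ i ∈ Finset.range m, y i = ∑ i ∈ Finset.range n, x i then 3 else 0 := by
  simp only [amp_X, phaseCoeff_zero, one_mul, sum_e_mul, sub_eq_zero]

theorem forall_lt_one {P : ℕ → Prop} : (∀ i < 1, P i) ↔ P 0 := by simp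

theorem isFun_X_one (n : ℕ) : IsFun (X n 1 0 0) (fun _ => 3)
    (fun x _ => ∑ i ∈ Finset.range n, x i) := fun y x => by
  simp only [amp_X_zero, forall_lt_one, Finset.sum_range_one]

theorem isFun_X_one_two : IsFun (X 1 1 (ang 1) (ang 2)) (fun _ => 3) (fun x _ => x 0 - 1) :=
  fun y x => by
  simp only [amp_X, forall_lt_one, Finset.sum_range_one, phaseCoeff_one_two, ← e_add]
  have h : ∀ j : ZMod 3, j + j * (y 0 - x 0) = j * (y 0 - (x 0 - 1)) := fun j => by ring
  simp only [h, sum_e_mul, sub_eq_zero]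

theorem isFun_X_two_one : IsFun (X 1 1 (ang 2) (ang 1)) (fun _ => 3) (fun x _ => x 0 + 1) :=
  fun y x => by
  simp only [amp_X, forall_lt_one, Finset.sum_range_one, phaseCoeff_two_one, ← e_add]
  have h : ∀ j : ZMod 3, -j + j * (y 0 - x 0) = j * (y 0 - (x 0 + 1)) := fun j => by ring
  simp only [h, sum_e_mul, sub_eq_zero]

theorem isFun_Z_one (m : ℕ) (α β : Real.Angle) :
    IsFun (Z 1 m α β) (fun x => phaseCoeff α β (x 0)) (fun x _ => x 0) := fun y x => by
  simp only [amp_Z, forall_lt_one]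
  rw [Finset.sum_eq_single (x 0)]
  · simp
  · intro j _ hj
    rw [if_neg fun h => hj h.2.symm]
  · simp

theorem isFun_ltf (a : ℕ) : IsFun (lastToFront a) (fun _ => 1)
    (fun x i => if i = 0 then x a else x (i - 1)) := by
  induction a with
  | zero =>
    refine isFun_wire.congr (fun _ => rfl) fun x i hi => ?_
    rw [Nat.lt_one_iff.1 hi]; rfl
  | succ a ih =>
    refine (((isFun_wires a).par isFun_swap).cast rfl rfl |>.seq
      ((ih.par isFun_wire).cast rfl rfl)).congr (fun _ => by simp) fun x i hi => ?_
    dsimp only [splice]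
    rcases Nat.lt_or_ge i (a + 1) with h | h
    · rw [if_pos (by omega)]
      rcases Nat.eq_zero_or_pos i with rfl | h0
      · simp
      · rw [if_neg (by omega), if_pos (by omega), if_neg (by omega)]
    · obtain rfl : i = a + 1 := by omega
      simp [Nat.add_comm 1 a]

theorem isFun_braid (m n : ℕ) : IsFun (braid m n) (fun _ => 1)
    (fun x i => if i < n then x (m + i) else x (i - n)) := by
  induction n with
  | zero => exact ((isFun_wires m).cast rfl _).congr (fun _ => rfl) fun x i hi => by simp
  | succ n ih =>
    refine (((ih.par isFun_wire).cast rfl rfl).seq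
      (((isFun_wires n).par (isFun_ltf m)).cast rfl (by omega))).congr (fun _ => by simp)
      fun x i hi => ?_
    dsimp only [splice]
    rcases Nat.lt_or_ge i n with h | h
    · rw [if_pos h, if_pos (by omega), if_pos (by omega), if_pos (by omega)]
    · rw [if_neg (by omega)]
      rcases Nat.eq_or_lt_of_le h with rfl | h
      · simp [Nat.add_comm n m]
      · rw [if_neg (by omega), if_pos (by omega), if_neg (by omega), if_neg (by omega)]
        congr 1; omega

theorem amp_seq_braid {a m n : ℕ} (D : Diagram a (m + n)) (y x : ℕ → ZMod 3) :
    (D ⨾ᵈ braid m n).amp y x =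
      D.amp (fun i => if i < m then y (n + i) else y (i - m)) x := by
  rw [amp_seq_of_coSumFun (J := Unit) D (w := fun _ _ => 1)
    (g := fun _ y i => if i < m then y (n + i) else y (i - m))]
  · simp
  · intro z
    rw [isFun_braid]
    simp only [Finset.univ_unique, Finset.sum_singleton]
    congr 1
    refine propext ⟨fun h i hi => ?_, fun h i hi => ?_⟩
    · split_ifs with him
      · rw [h _ (by omega), if_neg (by omega)]; congr 1; omega
      · rw [h _ (by omega), if_pos (by omega)]; congr 1; omega
    · split_ifs with him
      · rw [h _ (by omega), if_neg (by omega)]; congr 1; omega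
      · rw [h _ (by omega), if_pos (by omega)]; congr 1; omega

/-! ### The rules preserve interpretations up to non-zero scalars -/

/-- Equality of interpretations up to a non-zero scalar. -/
def Sim {a b a' b' : ℕ} (D : Diagram a b) (E : Diagram a' b') : Prop :=
  a = a' ∧ b = b' ∧ ∃ c : ℂ, c ≠ 0 ∧ ∀ y x, D.amp y x = c * E.amp y x

theorem Sim.of_eq {a b a' b' : ℕ} {D : Diagram a b} {E : Diagram a' b'} (ha : a = a') (hb : b = b')
    (h : ∀ y x, D.amp y x = E.amp y x) : Sim D E :=
  ⟨ha, hb, 1, one_ne_zero, fun y x => by rw [h, one_mul]⟩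

theorem Sim.of_isFun {a b : ℕ} {D E : Diagram a b} {w w' : (ℕ → ZMod 3) → ℂ}
    {g g' : (ℕ → ZMod 3) → ℕ → ZMod 3} (h : IsFun D w g) (h' : IsFun E w' g') (c : ℂ) (hc : c ≠ 0)
    (hw : ∀ x, w x = c * w' x) (hg : ∀ x, ∀ i < b, g x i = g' x i) : Sim D E :=
  ⟨rfl, rfl, c, hc, fun y x => by
    rw [(h.congr hw hg) y, h' y]
    split_ifs <;> simp⟩

theorem Sim.symm {a b a' b' : ℕ} {D : Diagram a b} {E : Diagram a' b'} : Sim D E → Sim E D := by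
  rintro ⟨rfl, rfl, c, hc, h⟩
  exact ⟨rfl, rfl, c⁻¹, inv_ne_zero hc, fun y x => by rw [h, inv_mul_cancel_left₀ hc]⟩

theorem Sim.trans {a b a' b' a'' b'' : ℕ} {D : Diagram a b} {E : Diagram a' b'}
    {F : Diagram a'' b''} : Sim D E → Sim E F → Sim D F := by
  rintro ⟨rfl, rfl, c, hc, h⟩ ⟨rfl, rfl, c', hc', h'⟩
  exact ⟨rfl, rfl, c * c', mul_ne_zero hc hc', fun y x => by rw [h, h', mul_assoc]⟩

theorem Sim.seq {a b c a' b' c' : ℕ} {D : Diagram a b} {E : Diagram b c} {D' : Diagram a' b'}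
    {E' : Diagram b' c'} : Sim D D' → Sim E E' → Sim (D ⨾ᵈ E) (D' ⨾ᵈ E') := by
  rintro ⟨rfl, rfl, c, hc, h⟩ ⟨_, rfl, c', hc', h'⟩
  refine ⟨rfl, rfl, c * c', mul_ne_zero hc hc', fun y x => ?_⟩
  simp only [amp_seq, h, h', Finset.mul_sum]
  exact Finset.sum_congr rfl fun _ _ => by ring

theorem Sim.par {a b c d a' b' c' d' : ℕ} {D : Diagram a b} {E : Diagram c d} {D' : Diagram a' b'}
    {E' : Diagram c' d'} : Sim D D' → Sim E E' → Sim (D ⊗ᵈ E) (D' ⊗ᵈ E') := by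
  rintro ⟨rfl, rfl, c, hc, h⟩ ⟨rfl, rfl, c', hc', h'⟩
  refine ⟨rfl, rfl, c * c', mul_ne_zero hc hc', fun y x => ?_⟩
  simp only [amp_par, h, h']
  ring

theorem sim_interchange {a b c d e f : ℕ} (D : Diagram a b) (E : Diagram b c)
    (F : Diagram d e) (G : Diagram e f) :
    Sim ((D ⨾ᵈ E) ⊗ᵈ (F ⨾ᵈ G)) ((D ⊗ᵈ F) ⨾ᵈ (E ⊗ᵈ G)) := by
  refine .of_eq rfl rfl fun y x => ?_
  rw [amp_par, amp_seq, amp_seq, amp_seq, Finset.sum_mul_sum, ← Fintype.sum_prod_type',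
    ← (Fin.appendEquiv b e).sum_comp]
  refine Finset.sum_congr rfl fun z _ => ?_
  simp only [amp_par]
  have h1 : ∀ i < b, extend (Fin.appendEquiv (α := ZMod 3) b e z) i = extend z.1 i := fun i hi => by
    simp only [extend, Fin.appendEquiv, hi, Nat.lt_add_right e hi, dif_pos]
    exact Fin.append_left z.1 z.2 ⟨i, hi⟩
  have h2 : ∀ i < e, extend (Fin.appendEquiv (α := ZMod 3) b e z) (b + i) = extend z.2 i :=
    fun i hi => by
    simp only [extend, Fin.appendEquiv, hi, Nat.add_lt_add_left hi b, dif_pos]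
    exact Fin.append_right z.1 z.2 ⟨i, hi⟩
  rw [amp_congr E (fun _ _ => rfl) h1, amp_congr D h1 (fun _ _ => rfl),
    amp_congr G (fun _ _ => rfl) h2, amp_congr F h2 (fun _ _ => rfl)]
  ring

theorem sim_braid_natural {a b c d : ℕ} (D : Diagram a b) (E : Diagram c d) :
    Sim ((D ⊗ᵈ E) ⨾ᵈ braid b d) (braid a c ⨾ᵈ (E ⊗ᵈ D)) := by
  refine .of_eq rfl rfl fun y x => ?_
  rw [amp_seq_braid, (isFun_braid a c).amp_seq, amp_par, amp_par, one_mul, mul_comm]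
  congr 1
  · refine amp_congr E (fun i _ => ?_) fun i hi => ?_
    · rw [if_neg (by omega), Nat.add_sub_cancel_left]
    · rw [if_pos hi]
  · refine amp_congr D (fun i hi => ?_) fun i _ => ?_
    · rw [if_pos hi]
    · rw [if_neg (by omega), Nat.add_sub_cancel_left]

theorem sumFun_Z_par_wires (n m l : ℕ) (α β : Real.Angle) :
    SumFun (Z n m α β ⊗ᵈ wires l)
      (fun j x => if ∀ i < n, x i = j then phaseCoeff α β j else 0)
      (fun j x => splice m (fun _ => j) fun i => x (n + i)) := fun y x => by
  rw [amp_par, amp_Z, Finset.sum_mul]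
  refine Finset.sum_congr rfl fun j _ => ?_
  rw [isFun_wires]
  simp only [forall_eq_splice]
  by_cases h1 : ∀ i < m, y i = j
  · by_cases h2 : ∀ i < n, x i = j
    · by_cases h3 : ∀ i < l, y (m + i) = x (n + i)
      · rw [if_pos ⟨h1, h2⟩, if_pos h3, if_pos h2, if_pos ⟨h1, h3⟩, mul_one]
      · rw [if_neg h3, mul_zero]
        exact (if_neg fun h => h3 h.2).symm
    · rw [if_neg fun h : _ ∧ _ => h2 h.2, if_neg h2, zero_mul, ite_self]
  · rw [if_neg fun h : _ ∧ _ => h1 h.1, zero_mul]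
    exact (if_neg fun h => h1 h.1).symm

theorem ite_merge (p q r s : Prop) [Decidable p] [Decidable q] [Decidable r] [Decidable s]
    (A B : ℂ) : ((if p then A else 0) * ((if r then 1 else 0) * if s ∧ q then B else 0)) =
      if (r ∧ s) ∧ p ∧ q then A * B else 0 := by
  by_cases hp : p <;> by_cases hq : q <;> by_cases hr : r <;> by_cases hs : s <;>
    simp [hp, hq, hr, hs]

theorem sim_s1 (n m k l p : ℕ) (hk : 0 < k) (α β γ δ : Real.Angle) :
    Sim ((Z n (m + k) α β ⊗ᵈ wires l) ⨾ᵈ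
          (wires m ⊗ᵈ Z (k + l) p γ δ).cast (Nat.add_assoc m k l).symm rfl)
        (Z (n + l) (m + p) (α + γ) (β + δ)) := by
  refine .of_eq rfl rfl fun y x => ?_
  rw [(sumFun_Z_par_wires n (m + k) l α β).amp_seq, amp_Z]
  refine Finset.sum_congr rfl fun j _ => ?_
  rw [amp_cast, amp_par, isFun_wires, amp_Z]
  have hw : (∀ i < m, y i = splice (m + k) (fun _ => j) (fun i => x (n + i)) i) ↔
      ∀ i < m, y i = j :=
    forall₂_congr fun i hi => by rw [splice_lt _ _ (by omega)]
  have hz : ∀ j', (∀ i < k + l, splice (m + k) (fun _ => j) (fun i => x (n + i)) (m + i) = j') ↔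
      j = j' ∧ ∀ i < l, x (n + i) = j' := fun j' => by
    rw [forall_lt_add]
    simp only [← Nat.add_assoc, splice_add]
    refine and_congr_left' ⟨fun h => ?_, fun h i hi => ?_⟩
    · rw [← h 0 hk, splice_lt _ _ (by omega)]
    · rw [splice_lt _ _ (by omega), h]
  simp only [hw, hz]
  rw [Finset.sum_eq_single j, phaseCoeff_add]
  · simp only [forall_lt_add, true_and]
    exact ite_merge _ _ _ _ _ _
  · intro j' _ hj
    rw [if_neg fun h => hj h.2.1.symm]
  · simp

theorem isFun_wires_swap_wires (a b : ℕ) : IsFun (wires a ⊗ᵈ swap ⊗ᵈ wires b) (fun _ => 1)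
    (fun x i => x (if i = a then a + 1 else if i = a + 1 then a else i)) := by
  refine (((isFun_wires a).par isFun_swap).par (isFun_wires b)).congr (fun _ => by simp)
    fun x i hi => ?_
  dsimp only [splice]
  rcases Nat.lt_trichotomy i a with h | rfl | h
  · rw [if_pos (by omega), if_pos h, if_neg (by omega), if_neg (by omega)]
  · simp
  · rcases Nat.eq_or_lt_of_le h with rfl | h
    · simp
    · rw [if_neg (by omega), if_neg (by omega), if_neg (by omega)]
      congr 1; omega

theorem forall_lt_swap_iff {a b : ℕ} {y : ℕ → ZMod 3} {j : ZMod 3} :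
    (∀ i < a + 2 + b, y (if i = a then a + 1 else if i = a + 1 then a else i) = j) ↔
      ∀ i < a + 2 + b, y i = j := by
  refine ⟨fun h i hi => ?_, fun h i hi => ?_⟩
  · have := h (if i = a then a + 1 else if i = a + 1 then a else i)
      (by split_ifs <;> omega)
    convert this using 2
    split_ifs <;> omega
  · exact h _ (by split_ifs <;> omega)

theorem sim_s3_out (n a b : ℕ) (α β : Real.Angle) :
    Sim (Z n (a + 2 + b) α β ⨾ᵈ (wires a ⊗ᵈ swap ⊗ᵈ wires b)) (Z n (a + 2 + b) α β) := by
  refine .of_eq rfl rfl fun y x => ?_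
  rw [amp_seq_of_coSumFun (J := Unit) _ (w := fun _ _ => 1)
    (g := fun _ y i => y (if i = a then a + 1 else if i = a + 1 then a else i))]
  · simp only [amp_Z, forall_lt_swap_iff, Finset.univ_unique, Finset.sum_singleton, one_mul]
  · intro z
    rw [isFun_wires_swap_wires]
    simp only [Finset.univ_unique, Finset.sum_singleton]
    congr 1
    refine propext ⟨fun h i hi => ?_, fun h i hi => ?_⟩
    · rw [h _ (by split_ifs <;> omega)]
      congr 1; split_ifs <;> omega
    · rw [h _ (by split_ifs <;> omega)]
      congr 1; split_ifs <;> omega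

theorem sim_s3_in (m a b : ℕ) (α β : Real.Angle) :
    Sim ((wires a ⊗ᵈ swap ⊗ᵈ wires b) ⨾ᵈ Z (a + 2 + b) m α β) (Z (a + 2 + b) m α β) := by
  refine .of_eq rfl rfl fun y x => ?_
  rw [(isFun_wires_swap_wires a b).amp_seq]
  simp only [amp_Z, forall_lt_swap_iff, one_mul]

theorem sim_b1 : Sim (X 0 1 0 0 ⨾ᵈ Z 1 2 0 0) (X 0 1 0 0 ⊗ᵈ X 0 1 0 0) :=
  .of_isFun ((isFun_X_one 0).seq (isFun_Z_one 2 0 0)) ((isFun_X_one 0).par (isFun_X_one 0))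
    (1 / 3) (by norm_num) (fun x => by simp [phaseCoeff_zero])
    fun x i hi => by simp [splice]

theorem sim_b2 : Sim ((Z 1 2 0 0 ⊗ᵈ Z 1 2 0 0) ⨾ᵈ
    (wire ⊗ᵈ swap ⊗ᵈ wire).cast (a' := 2 + 2) (b' := 2 + 2) rfl rfl ⨾ᵈ
    (X 2 1 0 0 ⊗ᵈ X 2 1 0 0)) (X 2 1 0 0 ⨾ᵈ Z 1 2 0 0) :=
  .of_isFun (((((isFun_Z_one 2 0 0).par (isFun_Z_one 2 0 0)).seq
      (((isFun_wire.par isFun_swap).par isFun_wire).cast rfl rfl))).seq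
      ((isFun_X_one 2).par (isFun_X_one 2)))
    ((isFun_X_one 2).seq (isFun_Z_one 2 0 0)) 3 (by norm_num)
    (fun x => by simp [phaseCoeff_zero]) fun x i hi => by
      have : i = 0 ∨ i = 1 := by omega
      rcases this with rfl | rfl <;> simp [splice, Finset.sum_range_succ]

theorem amp_layer_isFun {U : Diagram 1 1} {w : (ℕ → ZMod 3) → ℂ} {g : ZMod 3 → ZMod 3} {c : ℂ}
    (h : IsFun U (fun _ => c) (fun x _ => g (x 0))) : (n : ℕ) →
    IsFun (layer fun _ : Fin n => U) (fun _ => c ^ n) (fun x i => g (x i))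
  | 0 => isFun_empty.congr (fun _ => by simp) fun x i hi => by omega
  | n + 1 => ((amp_layer_isFun (w := w) h n).par h).congr (fun _ => by rw [pow_succ])
      fun x i hi => by
        dsimp only [splice]
        split_ifs with hin
        · rfl
        · rw [show n + 0 = i by omega]

theorem sim_k1 {U : Diagram 1 1} {g : ZMod 3 → ZMod 3}
    (h : IsFun U (fun _ => 3) (fun x _ => g (x 0))) (n : ℕ) :
    Sim (U ⨾ᵈ Z 1 n 0 0) (Z 1 n 0 0 ⨾ᵈ layer fun _ : Fin n => U) :=
  .of_isFun (h.seq (isFun_Z_one n 0 0))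
    ((isFun_Z_one n 0 0).seq (amp_layer_isFun (w := fun _ => 0) h n)) (3 / 3 ^ n)
    (div_ne_zero (by norm_num) (pow_ne_zero _ (by norm_num)))
    (fun x => by
      have : (3 : ℂ) ^ n ≠ 0 := pow_ne_zero _ (by norm_num)
      field_simp
      simp only [phaseCoeff_zero]) fun x i _ => rfl

theorem sim_k2_12 (α β : Real.Angle) : Sim (Z 1 1 α β ⨾ᵈ X 1 1 (ang 1) (ang 2))
    (X 1 1 (ang 1) (ang 2) ⨾ᵈ Z 1 1 (β - α) (-α)) :=
  .of_isFun ((isFun_Z_one 1 α β).seq isFun_X_one_two)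
    (isFun_X_one_two.seq (isFun_Z_one 1 _ _)) (phaseCoeff α β 1) (phaseCoeff_ne_zero _ _ _)
    (fun x => by
      have hα := Circle.coe_ne_zero α.toCircle
      have hβ := Circle.coe_ne_zero β.toCircle
      have h2 : (2 : ZMod 3) ≠ 0 ∧ (2 : ZMod 3) ≠ 1 ∧ (0 - 1 : ZMod 3) = 2 ∧
        (2 - 1 : ZMod 3) = 1 := by decide
      rcases zmod3_cases (x 0) with h | h | h <;>
        simp [h, phaseCoeff, h2, sub_eq_add_neg, Real.Angle.toCircle_add] <;> field_simp)
    fun x i _ => rfl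

theorem sim_k2_21 (α β : Real.Angle) : Sim (Z 1 1 α β ⨾ᵈ X 1 1 (ang 2) (ang 1))
    (X 1 1 (ang 2) (ang 1) ⨾ᵈ Z 1 1 (-β) (α - β)) :=
  .of_isFun ((isFun_Z_one 1 α β).seq isFun_X_two_one)
    (isFun_X_two_one.seq (isFun_Z_one 1 _ _)) (phaseCoeff α β 2) (phaseCoeff_ne_zero _ _ _)
    (fun x => by
      have hα := Circle.coe_ne_zero α.toCircle
      have hβ := Circle.coe_ne_zero β.toCircle
      have h2 : (2 : ZMod 3) ≠ 0 ∧ (2 : ZMod 3) ≠ 1 ∧ (1 + 1 : ZMod 3) = 2 ∧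
        (2 + 1 : ZMod 3) = 0 := by decide
      rcases zmod3_cases (x 0) with h | h | h <;>
        simp [h, phaseCoeff, h2, sub_eq_add_neg, Real.Angle.toCircle_add] <;> field_simp)
    fun x i _ => rfl

theorem amp_seq_one {a c : ℕ} (D : Diagram a 1) (E : Diagram 1 c) {y x : ℕ → ZMod 3}
    {g : ZMod 3 → ℂ} (h : ∀ z : ℕ → ZMod 3, E.amp y z * D.amp z x = g (z 0)) :
    (D ⨾ᵈ E).amp y x = ∑ j, g j := by
  rw [amp_seq, ← (Equiv.funUnique (Fin 1) (ZMod 3)).symm.sum_comp]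
  refine Finset.sum_congr rfl fun j _ => ?_
  rw [h]
  rfl

theorem sim_h1 : Sim (had ⨾ᵈ hadDag) wire := by
  refine ⟨rfl, rfl, 3, by norm_num, fun y x => ?_⟩
  rw [amp_seq_one (g := fun j => e (j * (x 0 - y 0)))]
  · rw [sum_e_mul, isFun_wire]
    simp only [forall_lt_one, sub_eq_zero, eq_comm (a := x 0)]
    simp
  · intro z
    rw [amp_had, amp_hadDag, ← e_add]
    congr 1; ring

theorem sim_h1' : Sim (hadDag ⨾ᵈ had) wire := by
  refine ⟨rfl, rfl, 3, by norm_num, fun y x => ?_⟩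
  rw [amp_seq_one (g := fun j => e (j * (y 0 - x 0)))]
  · rw [sum_e_mul, isFun_wire]
    simp only [forall_lt_one, sub_eq_zero]
    simp
  · intro z
    rw [amp_had, amp_hadDag, ← e_add]
    congr 1; ring

theorem amp_had_had (y x : ℕ → ZMod 3) :
    (had ⨾ᵈ had).amp y x = if y 0 + x 0 = 0 then 3 else 0 := by
  rw [amp_seq_one (g := fun j => e (j * (y 0 + x 0)))]
  · rw [sum_e_mul]
  · intro z
    rw [amp_had, amp_had, ← e_add]
    congr 1; ring

theorem sim_p1_had : Sim (had ⨾ᵈ had) (hadDag ⨾ᵈ hadDag) := by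
  refine .of_eq rfl rfl fun y x => ?_
  rw [amp_had_had, amp_seq_one (g := fun j => e (j * -(y 0 + x 0)))]
  · rw [sum_e_mul]
    simp only [neg_eq_zero]
  · intro z
    rw [amp_hadDag, amp_hadDag, ← e_add]
    congr 1; ring

theorem amp_seq_Z (a : ℕ) (D : Diagram a 1) (α β : Real.Angle) (y x : ℕ → ZMod 3) :
    (D ⨾ᵈ Z 1 1 α β).amp y x = phaseCoeff α β (y 0) * D.amp y x := by
  rw [amp_seq_of_coSumFun (J := Unit) D (w := fun _ y => phaseCoeff α β (y 0))
    (g := fun _ y => y)]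
  · simp
  · intro z
    rw [isFun_Z_one]
    simp only [forall_lt_one, Finset.univ_unique, Finset.sum_singleton, eq_comm (a := z 0)]
    split_ifs with h
    · rw [h]
    · rfl

/-- Completing the square modulo three: `-j² + jd = d² - (j + d)²`. The factor in front is `∑
ω^(-j²)`. -/
theorem gauss_sum (d : ZMod 3) :
    ∑ j : ZMod 3, e (-(j * j)) * e (j * d) = (1 + 2 * e 2) * e (d * d) := by
  have h : (-1 : ZMod 3) = 2 ∧ (2 * 2 : ZMod 3) = 1 := by decide
  have h3 := omega_pow_three
  rw [sum_zmod3]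
  rcases zmod3_cases d with rfl | rfl | rfl <;>
    simp only [h, mul_zero, zero_mul, neg_zero, mul_one, one_mul, e_zero, e_one, e_two]
  · ring
  · linear_combination (omega - 1) * h3
  · linear_combination (omega - 1) * h3

/-- The exponent of `H` is a combination of squares, `yx = -y² - x² + (y - x)²` modulo three. The
middle square is what the red spider gives through `gauss_sum`. -/
theorem sim_eu :
    Sim had (Z 1 1 (ang 2) (ang 2) ⨾ᵈ X 1 1 (ang 2) (ang 2) ⨾ᵈ Z 1 1 (ang 2) (ang 2)) := by
  refine Sim.symm ⟨rfl, rfl, 1 + 2 * e 2, ?_, fun y x => ?_⟩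
  · intro h
    rw [e_two] at h
    -- The Gauss sum `1 + 2ω²` times its conjugate `1 + 2ω` is three.
    have : (3 : ℂ) = 0 := by linear_combination (1 + 2 * omega) * h - 2 * omega_sum -
      4 * omega_pow_three
    norm_num at this
  · rw [amp_seq_Z, (isFun_Z_one 1 _ _).amp_seq, amp_X, amp_had]
    simp only [phaseCoeff_two_two, Finset.sum_range_one]
    rw [gauss_sum, show y 0 * x 0 = -(y 0 * y 0) + -(x 0 * x 0) + (y 0 - x 0) * (y 0 - x 0) by
      generalize y 0 = s; generalize x 0 = t; revert s t; decide, e_add, e_add]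
    ring

theorem sim_h2_aux (n m : ℕ) (α β : Real.Angle) (y x : ℕ → ZMod 3) (U V : Diagram 1 1) :
    ((layer fun _ : Fin n => U) ⨾ᵈ Z n m α β ⨾ᵈ layer fun _ : Fin m => V).amp y x =
      ∑ j, phaseCoeff α β j * (∏ i : Fin m, V.amp (fun _ => y i) (fun _ => j)) *
        ∏ i : Fin n, U.amp (fun _ => j) (fun _ => x i) := by
  rw [SumFun.amp_seq (J := ZMod 3) (w := fun j x =>
    phaseCoeff α β j * (layer fun _ : Fin n => U).amp (fun _ => j) x) (g := fun j _ _ => j)]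
  · simp only [amp_layer]
    exact Finset.sum_congr rfl fun j _ => by ring
  · intro y x
    rw [amp_seq_of_coSumFun (J := ZMod 3) _
      (w := fun j y => if ∀ i < m, y i = j then phaseCoeff α β j else 0) (g := fun j _ _ => j)]
    · exact Finset.sum_congr rfl fun j _ => by rw [ite_mul, zero_mul]
    · intro z
      rw [amp_Z]
      refine Finset.sum_congr rfl fun j _ => ?_
      rw [← ite_and]
      simp only [and_comm]

theorem sim_h2 (n m : ℕ) (α β : Real.Angle) :
    Sim ((layer fun _ : Fin n => hadDag) ⨾ᵈ Z n m α β ⨾ᵈ layer fun _ : Fin m => had)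
      (X n m α β) := by
  refine .of_eq rfl rfl fun y x => ?_
  rw [sim_h2_aux, amp_X]
  refine Finset.sum_congr rfl fun j _ => ?_
  simp only [amp_had, amp_hadDag, e_sum (fun i => y i * j), e_sum (fun i => -(j * x i))]
  rw [mul_assoc, ← e_add, ← Finset.sum_mul, Finset.sum_neg_distrib, ← Finset.mul_sum]
  congr 2; ring

theorem sim_h2' (n m : ℕ) (α β : Real.Angle) :
    Sim ((layer fun _ : Fin n => had) ⨾ᵈ Z n m α β ⨾ᵈ layer fun _ : Fin m => hadDag)
      (X n m β α) := by
  refine .of_eq rfl rfl fun y x => ?_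
  rw [sim_h2_aux, amp_X, ← Equiv.sum_comp (Equiv.neg (ZMod 3)) fun j => phaseCoeff β α j *
    e (j * (∑ i ∈ Finset.range m, y i - ∑ i ∈ Finset.range n, x i))]
  refine Finset.sum_congr rfl fun j _ => ?_
  simp only [amp_had, amp_hadDag, e_sum (fun i => j * x i), e_sum (fun i => -(y i * j)),
    Equiv.neg_apply, phaseCoeff_swap α β, neg_neg]
  rw [mul_assoc, ← e_add, ← Finset.mul_sum, Finset.sum_neg_distrib, ← Finset.sum_mul]
  congr 2; ring

theorem sim_p1_cup : Sim (had ⨾ᵈ had)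
    ((wire ⊗ᵈ Z 0 2 0 0) ⨾ᵈ (X 2 0 0 0 ⊗ᵈ wire).cast (a' := 1 + 2) (b' := 1) rfl rfl) := by
  refine .of_eq rfl rfl fun y x => ?_
  rw [amp_had_had, SumFun.amp_seq (J := ZMod 3) (w := fun _ _ => 1)
    (g := fun j x i => if i = 0 then x 0 else j)]
  · simp only [amp_cast, amp_par, amp_X_zero, isFun_wire _ _, forall_lt_one, one_mul]
    rw [Finset.sum_eq_single (y 0)]
    · simp [Finset.sum_range_succ, add_comm, eq_comm]
    · intro j _ hj
      rw [if_neg (c := y 0 = _) (by simpa using fun h => hj h.symm), mul_zero]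
    · simp
  · intro y x
    rw [amp_par, isFun_wire, amp_Z, Finset.mul_sum]
    refine Finset.sum_congr rfl fun j _ => ?_
    simp only [forall_lt_one, forall_lt_two, phaseCoeff_zero, forall_lt_add (m := 1) (n := 2)]
    by_cases h : y 0 = x 0 <;> simp [h]

theorem sim_p1_cap : Sim (had ⨾ᵈ had)
    ((wire ⊗ᵈ X 0 2 0 0) ⨾ᵈ (Z 2 0 0 0 ⊗ᵈ wire).cast (a' := 1 + 2) (b' := 1) rfl rfl) := by
  refine ⟨rfl, rfl, 1 / 1, by norm_num, fun y x => ?_⟩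
  rw [amp_had_had, SumFun.amp_seq (J := ZMod 3) (w := fun _ _ => 3)
    (g := fun j x i => if i = 0 then x 0 else if i = 1 then j else -j)]
  · simp only [amp_cast, amp_par, amp_Z, isFun_wire _ _, forall_lt_one]
    rw [Finset.sum_eq_single (-y 0)]
    · simp only [forall_lt_two, phaseCoeff_zero]
      have h : y 0 + x 0 = 0 ↔ x 0 = -y 0 := by rw [add_comm, eq_neg_iff_add_eq_zero]
      by_cases h0 : x 0 = -y 0
      · simp [h0]
      · have h1 : ∀ j, ¬(x 0 = j ∧ -y 0 = j) := fun j hj => h0 (hj.1.trans hj.2.symm)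
        simp [h, h0, h1]
    · intro j _ hj
      rw [if_neg (c := y 0 = _) (by simpa using fun h => hj (by rw [h, neg_neg])), mul_zero,
        mul_zero]
    · simp
  · intro y x
    rw [amp_par, isFun_wire, amp_X_zero]
    simp only [forall_lt_one, forall_lt_two, forall_lt_add (m := 1) (n := 2)]
    rw [Finset.sum_eq_single (y 1)]
    · have h : y 1 + y 2 = 0 ↔ y 2 = -y 1 := by rw [add_comm, eq_neg_iff_add_eq_zero]
      by_cases h0 : y 0 = x 0 <;> simp [Finset.sum_range_succ, h, h0]
    · intro j _ hj
      rw [if_neg]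
      rintro ⟨_, h, _⟩
      exact hj (by simpa using h.symm)
    · simp

/-- Used to carry the assumption that the given state is non-zero through all rewriting:
non-vanishing of the interpretation becomes a property of classes. -/
theorem sound {a b a' b' : ℕ} {D : Diagram a b} {E : Diagram a' b'} (h : ZXEq D E) : Sim D E := by
  induction h with
  | refl D => exact .of_eq rfl rfl fun _ _ => rfl
  | symm _ h => exact h.symm
  | trans _ _ h h' => exact h.trans h'
  | seq_congr _ _ h h' => exact h.seq h'
  | par_congr _ _ h h' => exact h.par h'
  | seq_assoc D E F =>
    refine .of_eq rfl rfl fun y x => ?_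
    simp only [Diagram.amp, Diagram.interp, Matrix.mul_assoc]
  | wires_seq D =>
    refine .of_eq rfl rfl fun y x => ?_
    rw [(isFun_wires _).amp_seq, one_mul]
  | seq_wires D =>
    refine .of_eq rfl rfl fun y x => ?_
    rw [amp_seq_of_coSumFun (J := Unit) _ (w := fun _ _ => 1) (g := fun _ y => y)]
    · simp
    · intro z
      rw [isFun_wires]
      simp only [Finset.univ_unique, Finset.sum_singleton, eq_comm]
  | par_assoc D E F =>
    refine .of_eq (Nat.add_assoc _ _ _) (Nat.add_assoc _ _ _) fun y x => ?_
    simp only [amp_par, mul_assoc, Nat.add_assoc]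
  | empty_par D =>
    refine .of_eq (Nat.zero_add _) (Nat.zero_add _) fun y x => ?_
    rw [amp_par, isFun_empty]
    simp
  | par_empty D =>
    refine .of_eq rfl rfl fun y x => ?_
    rw [amp_par, isFun_empty]
    simp
  | interchange D E F G => exact sim_interchange D E F G
  | swap_swap =>
    exact .of_isFun (isFun_swap.seq isFun_swap) (isFun_wires 2) 1 one_ne_zero (fun _ => rfl)
      fun x i hi => by
        have : i = 0 ∨ i = 1 := by omega
        rcases this with rfl | rfl <;> simp
  | braid_natural D E => exact sim_braid_natural D E
  | scalar D hD =>
    obtain ⟨y, x, h⟩ := (interp_ne_zero_iff D).1 hD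
    refine ⟨rfl, rfl, D.amp y x, h, fun y' x' => ?_⟩
    rw [isFun_empty, if_pos (by simp), mul_one]
    exact amp_congr D (fun _ h => absurd h (by simp)) (fun _ h => absurd h (by simp))
  | s1 n m k l p hk α β γ δ => exact sim_s1 n m k l p hk α β γ δ
  | s2 =>
    exact .of_isFun (isFun_Z_one 1 0 0) isFun_wire 1 one_ne_zero
      (fun x => by simp [phaseCoeff_zero]) fun x i hi => by rw [Nat.lt_one_iff.1 hi]
  | s3_out n a b α β => exact sim_s3_out n a b α β
  | s3_in m a b α β => exact sim_s3_in m a b α β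
  | b1 => exact sim_b1
  | b2 => exact sim_b2
  | k1_12 n => exact sim_k1 (g := fun t => t - 1) isFun_X_one_two n
  | k1_21 n => exact sim_k1 (g := fun t => t + 1) isFun_X_two_one n
  | k2_12 α β => exact sim_k2_12 α β
  | k2_21 α β => exact sim_k2_21 α β
  | h1 => exact sim_h1
  | h1' => exact sim_h1'
  | eu => exact sim_eu
  | h2 n m α β => exact sim_h2 n m α β
  | h2' n m α β => exact sim_h2' n m α β
  | p1_had => exact sim_p1_had
  | p1_cup => exact sim_p1_cup
  | p1_cap => exact sim_p1_cap

/-! ### Non-zero elements of the monoid, faithfulness -/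

theorem interp_par_wires_ne_zero {a b : ℕ} (D : Diagram a b) (k : ℕ) :
    (D ⊗ᵈ wires k).interp ≠ 0 ↔ D.interp ≠ 0 := by
  simp only [interp_ne_zero_iff, amp_par, isFun_wires k _ _]
  constructor
  · rintro ⟨y, x, h⟩
    exact ⟨y, x, left_ne_zero_of_mul h⟩
  · rintro ⟨y, x, h⟩
    refine ⟨splice b y fun _ => 0, splice a x fun _ => 0, ?_⟩
    simp only [splice_add]
    rw [if_pos (fun _ _ => trivial), mul_one, amp_congr D (fun i hi => splice_lt _ _ hi)
      (fun i hi => splice_lt _ _ hi)]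
    exact h

theorem ZXEq.interp_ne_zero {a b a' b' : ℕ} {D : Diagram a b} {E : Diagram a' b'}
    (h : ZXEq D E) : D.interp ≠ 0 ↔ E.interp ≠ 0 := by
  obtain ⟨rfl, rfl, c, hc, h⟩ := sound h
  simp only [interp_ne_zero_iff, h, ne_eq, mul_eq_zero, hc, false_or]

/-- The interpretation is not zero. -/
def NZ (x : M) : Prop := Quotient.liftOn x (fun D => D.2.2.interp ≠ 0) (by
  rintro D E ⟨k, l, h⟩
  rw [← interp_par_wires_ne_zero D.2.2 k, ← interp_par_wires_ne_zero E.2.2 l]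
  exact propext h.interp_ne_zero)

theorem nz_ι {a b : ℕ} (D : Diagram a b) : NZ (ι D) ↔ D.interp ≠ 0 := Iff.rfl

theorem NZ.of_mul {x y : M} (h : NZ (x * y)) : NZ x ∧ NZ y := by
  induction x using Quotient.inductionOn with | h D => ?_
  induction y using Quotient.inductionOn with | h E => ?_
  obtain ⟨a, b, D⟩ := D
  obtain ⟨c, d, E⟩ := E
  change (Diagram.interp (_ ⨾ᵈ _)) ≠ 0 at h
  constructor
  · refine (interp_par_wires_ne_zero D c).1 fun h0 => h ?_
    have : ((D ⊗ᵈ wires c).cast rfl (Nat.add_comm b c)).interp = 0 := by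
      by_contra h1
      exact (ZXEq.cast rfl (Nat.add_comm b c) (D ⊗ᵈ wires c)).interp_ne_zero.1 h1 h0
    exact (congrArg (_ * ·) this).trans (Matrix.mul_zero _)
  · refine (interp_par_wires_ne_zero E b).1 fun h0 => h ?_
    exact (congrArg (· * _) h0).trans (Matrix.zero_mul _)

theorem NZ.of_shift {x : M} {i : ℕ} (h : NZ (x ↟ i)) : NZ x := by
  induction x using Quotient.inductionOn with | h D => ?_
  intro h0
  obtain ⟨y, x, h⟩ := (interp_ne_zero_iff _).1 h
  rw [amp_par] at h
  exact (interp_ne_zero_iff _).2 ⟨_, _, right_ne_zero_of_mul h⟩ h0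

theorem scalar_eq_one {D : Diagram 0 0} (h : NZ (ι D)) : ι D = 1 := ι_eq (.scalar D h)

theorem interp_Z_seq_Z (k : ℕ) : (Z 0 k 0 0 ⨾ᵈ Z k 0 0 0).interp ≠ 0 := by
  refine (interp_ne_zero_iff _).2 ⟨0, 0, ?_⟩
  rw [SumFun.amp_seq (J := ZMod 3) (w := fun _ _ => 1) (g := fun j _ _ => j)]
  · simp only [amp_Z, phaseCoeff_zero, Finset.sum_boole, one_mul, ← Nat.cast_sum]
    rw [Nat.cast_ne_zero]
    refine (Finset.sum_pos (fun j _ => Finset.card_pos.2 ⟨j, ?_⟩) Finset.univ_nonempty).ne'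
    simp
  · intro y x
    rw [amp_Z]
    simp [phaseCoeff_zero]

/-- A green state fed into the padding wires and a green effect on their ends turn the padding into
a closed diagram with non-zero value, which is a discarded scalar. -/
theorem zxEq_of_pad {a b k : ℕ} {D E : Diagram a b}
    (h : ZXEq (D ⊗ᵈ wires k) (E ⊗ᵈ wires k)) : ZXEq D E := by
  have key : ∀ D : Diagram a b,
      ZXEq ((wires a ⊗ᵈ Z 0 k 0 0) ⨾ᵈ (D ⊗ᵈ wires k) ⨾ᵈ (wires b ⊗ᵈ Z k 0 0 0)) D := fun D => by
    refine .trans (.seq_congr (.symm (.interchange _ _ _ _)) (.refl _)) ?_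
    refine .trans (.symm (.interchange _ _ _ _)) ?_
    refine .trans (.par_congr (.trans (.seq_wires _) (.wires_seq D)) ?_) (.par_empty D)
    exact .trans (.seq_congr (.seq_wires _) (.refl _)) (.scalar _ (interp_Z_seq_Z k))
  exact .trans (.symm (key D)) (.trans (.seq_congr (.seq_congr (.refl _) h) (.refl _)) (key E))

theorem zxEq_of_ι_eq {a b : ℕ} {D E : Diagram a b} (h : ι D = ι E) : ZXEq D E := by
  obtain ⟨k, l, h⟩ := Quotient.exact h
  obtain rfl : k = l := by simpa using h.src_eq
  exact zxEq_of_pad h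

/-! ### Sliding as a simplification procedure -/

/-- With the arities found by instance search and an arithmetic side condition, this and its
variants are simplification rules. They bring factors acting further to the right to the front,
which decides most interchange identities below. -/
theorem slide {x : M} {a b : ℕ} [hx : HasAr x a b] (y : M) (i : ℕ) (h : b ≤ i) :
    x * y ↟ i = y ↟ (i - b + a) * x := hx.slide y (i - b) (by omega) (by omega)

theorem slide_assoc {x : M} {a b : ℕ} [HasAr x a b] (y : M) (i : ℕ) (h : b ≤ i) (z : M) :
    x * (y ↟ i * z) = y ↟ (i - b + a) * (x * z) := by
  rw [← mul_assoc, slide y i h, mul_assoc]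

theorem slide_shift {x : M} {a b : ℕ} [hx : HasAr x a b] (y : M) (p i : ℕ) (h : b + p ≤ i) :
    x ↟ p * y ↟ i = y ↟ (i - b + a) * x ↟ p :=
  hx.slide_shift y p (i - (b + p)) (by omega) (by omega)

theorem slide_shift_assoc {x : M} {a b : ℕ} [HasAr x a b] (y : M) (p i : ℕ) (h : b + p ≤ i)
    (z : M) : x ↟ p * (y ↟ i * z) = y ↟ (i - b + a) * (x ↟ p * z) := by
  rw [← mul_assoc, slide_shift y p i h, mul_assoc]

/-! ### Generators -/

/-- The pair of angles of a spider. -/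
abbrev Ph : Type := Real.Angle × Real.Angle

/-- Green spiders. -/
def Zs (n m : ℕ) (p : Ph) : M := ι (Z n m p.1 p.2)

/-- Red spiders. -/
def Xs (n m : ℕ) (p : Ph) : M := ι (X n m p.1 p.2)

/-- The `H` node. -/
def Hd : M := ι had

/-- The `H†` node. -/
def Hi : M := ι hadDag

/-- The crossing. -/
def sw : M := ι swap

local notation "cp" => Zs 1 2 0
local notation "mg" => Zs 2 1 0
local notation "un" => Zs 0 1 0
local notation "ef" => Zs 1 0 0
local notation "cup" => Zs 0 2 0
local notation "cap" => Zs 2 0 0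
local notation "ph" => Zs 1 1

instance (n m : ℕ) (p : Ph) : HasAr (Zs n m p) n m := hasAr_ι _
instance (n m : ℕ) (p : Ph) : HasAr (Xs n m p) n m := hasAr_ι _
instance : HasAr Hd 1 1 := hasAr_ι _
instance : HasAr Hi 1 1 := hasAr_ι _
instance : HasAr sw 2 2 := hasAr_ι _

/-! ### Crossings -/

theorem ι_ltf_zero : ι (lastToFront 0) = 1 := ι_wire

theorem ι_ltf_succ (a : ℕ) : ι (lastToFront (a + 1)) = sw ↟ a * ι (lastToFront a) := by
  rw [lastToFront, ι_seq, ι_cast, ι_cast, ι_par, ι_wires, one_mul, ι_par, ι_wire, one_shift,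
    mul_one]
  rfl

theorem ι_braid_zero (m : ℕ) : ι (braid m 0) = 1 := by
  rw [braid, ι_cast]
  exact ι_wires m

theorem ι_braid_succ (m n : ℕ) :
    ι (braid m (n + 1)) = ι (braid m n) * ι (lastToFront m) ↟ n := by
  rw [braid, ι_seq, ι_cast, ι_cast, ι_par, ι_par, ι_wire, one_shift, mul_one, ι_wires, one_mul]

theorem ι_braid_natural {a b c d : ℕ} (D : Diagram a b) (E : Diagram c d) :
    ι D * ι E ↟ b * ι (braid b d) = ι (braid a c) * (ι E * ι D ↟ d) := by
  rw [← ι_par, ← ι_seq, ← ι_par, ← ι_seq]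
  exact ι_eq (.braid_natural D E)

/-- Moving a wire from the left to the right across the outputs of a diagram. -/
theorem ltf_natural {a b : ℕ} (D : Diagram a b) :
    ι D * ι (lastToFront b) = ι (lastToFront a) * ι D ↟ 1 := by
  have h := ι_braid_natural D wire
  rwa [ι_wire, one_shift, mul_one, one_mul, ι_braid_succ, ι_braid_succ, ι_braid_zero, ι_braid_zero,
    one_mul, one_mul, shift_zero, shift_zero] at h

theorem braid_one_natural {c d : ℕ} (E : Diagram c d) :
    ι E ↟ 1 * ι (braid 1 d) = ι (braid 1 c) * ι E := by
  have h := ι_braid_natural wire E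
  rwa [ι_wire, one_shift, mul_one, one_mul] at h

theorem ι_ltf_one : ι (lastToFront 1) = sw := by
  rw [ι_ltf_succ, ι_ltf_zero, mul_one, shift_zero]

theorem ι_ltf_two : ι (lastToFront 2) = sw ↟ 1 * sw := by
  rw [ι_ltf_succ, ι_ltf_one]

theorem ι_braid_one_succ (n : ℕ) : ι (braid 1 (n + 1)) = ι (braid 1 n) * sw ↟ n := by
  rw [ι_braid_succ, ι_ltf_one]

theorem ι_braid_one_one : ι (braid 1 1) = sw := by
  rw [ι_braid_one_succ, ι_braid_zero, one_mul, shift_zero]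

theorem ι_braid_one_two : ι (braid 1 2) = sw * sw ↟ 1 := by
  rw [ι_braid_one_succ, ι_braid_one_one]

theorem sw_sw : sw * sw = 1 := by
  rw [sw, ← ι_seq, ι_eq .swap_swap, ι_wires]

theorem sw_sw_assoc (x : M) : sw * (sw * x) = x := by rw [← mul_assoc, sw_sw, one_mul]

/-- Naturality of crossings in small arities. In the unprimed lemmas a wire passes from the right of
the box to its left, in the primed ones from its left to its right. -/
theorem nat11 (x : M) [h : HasAr x 1 1] : x * sw = sw * x ↟ 1 := by
  obtain ⟨D, rfl⟩ := h
  have := ltf_natural D; rwa [ι_ltf_one] at this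

theorem nat11' (x : M) [h : HasAr x 1 1] : x ↟ 1 * sw = sw * x := by
  obtain ⟨D, rfl⟩ := h
  have := braid_one_natural D; rwa [ι_braid_one_one] at this

theorem nat01 (x : M) [h : HasAr x 0 1] : x * sw = x ↟ 1 := by
  obtain ⟨D, rfl⟩ := h
  have := ltf_natural D; rwa [ι_ltf_one, ι_ltf_zero, one_mul] at this

theorem nat01' (x : M) [h : HasAr x 0 1] : x ↟ 1 * sw = x := by
  obtain ⟨D, rfl⟩ := h
  have := braid_one_natural D; rwa [ι_braid_one_one, ι_braid_zero, one_mul] at this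

theorem nat10 (x : M) [h : HasAr x 1 0] : sw * x ↟ 1 = x := by
  obtain ⟨D, rfl⟩ := h
  have := ltf_natural D; rwa [ι_ltf_one, ι_ltf_zero, mul_one, eq_comm] at this

theorem nat10' (x : M) [h : HasAr x 1 0] : sw * x = x ↟ 1 := by
  obtain ⟨D, rfl⟩ := h
  have := braid_one_natural D; rwa [ι_braid_one_one, ι_braid_zero, mul_one, eq_comm] at this

theorem nat12 (x : M) [h : HasAr x 1 2] : x * (sw ↟ 1 * sw) = sw * x ↟ 1 := by
  obtain ⟨D, rfl⟩ := h
  have := ltf_natural D; rwa [ι_ltf_one, ι_ltf_two] at this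

theorem nat12' (x : M) [h : HasAr x 1 2] : x ↟ 1 * (sw * sw ↟ 1) = sw * x := by
  obtain ⟨D, rfl⟩ := h
  have := braid_one_natural D; rwa [ι_braid_one_one, ι_braid_one_two] at this

theorem nat21 (x : M) [h : HasAr x 2 1] : x * sw = sw ↟ 1 * (sw * x ↟ 1) := by
  obtain ⟨D, rfl⟩ := h
  have := ltf_natural D; rwa [ι_ltf_one, ι_ltf_two, mul_assoc] at this

theorem nat21' (x : M) [h : HasAr x 2 1] : x ↟ 1 * sw = sw * (sw ↟ 1 * x) := by
  obtain ⟨D, rfl⟩ := h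
  have := braid_one_natural D; rwa [ι_braid_one_one, ι_braid_one_two, mul_assoc] at this

theorem nat22 (x : M) [h : HasAr x 2 2] : x * (sw ↟ 1 * sw) = sw ↟ 1 * (sw * x ↟ 1) := by
  obtain ⟨D, rfl⟩ := h
  have := ltf_natural D; rwa [ι_ltf_two, mul_assoc] at this

theorem nat22' (x : M) [h : HasAr x 2 2] : x ↟ 1 * (sw * sw ↟ 1) = sw * (sw ↟ 1 * x) := by
  obtain ⟨D, rfl⟩ := h
  have := braid_one_natural D; rwa [ι_braid_one_two, mul_assoc] at this

theorem nat20' (x : M) [h : HasAr x 2 0] : sw * (sw ↟ 1 * x) = x ↟ 1 := by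
  obtain ⟨D, rfl⟩ := h
  have := braid_one_natural D; rwa [ι_braid_one_two, ι_braid_zero, mul_one, eq_comm, mul_assoc] at this

/-! ### Green spiders -/

theorem Zs_fuse (n m k l r : ℕ) (hk : 0 < k) (p q : Ph) :
    Zs n (m + k) p * Zs (k + l) r q ↟ m = Zs (n + l) (m + r) (p + q) := by
  have h := ι_eq (.s1 n m k l r hk p.1 p.2 q.1 q.2)
  rw [ι_seq, ι_cast, ι_par, ι_par, ι_wires, one_shift, mul_one, ι_wires, one_mul] at h
  exact h

theorem ph_zero : ph 0 = 1 := (ι_eq .s2).trans ι_wire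

theorem Zs_sw_out (n : ℕ) (p : Ph) : Zs n 2 p * sw = Zs n 2 p := by
  have h := ι_eq (.s3_out n 0 0 p.1 p.2)
  rw [ι_seq, ι_par, ι_par, ι_wires, one_mul, one_shift, mul_one, shift_zero] at h
  exact h

theorem Zs_sw_in (n : ℕ) (p : Ph) : sw * Zs 2 n p = Zs 2 n p := by
  have h := ι_eq (.s3_in n 0 0 p.1 p.2)
  rw [ι_seq, ι_par, ι_par, ι_wires, one_mul, one_shift, mul_one, shift_zero] at h
  exact h

theorem Zs_sw_three (n : ℕ) (p : Ph) : sw * Zs 3 n p = Zs 3 n p := by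
  have h := ι_eq (.s3_in n 0 1 p.1 p.2)
  rw [ι_seq, ι_par, ι_par, ι_wires, one_mul, ι_wires, one_shift, mul_one, shift_zero] at h
  exact h

theorem Zs_sw_three' (n : ℕ) (p : Ph) : sw ↟ 1 * Zs 3 n p = Zs 3 n p := by
  have h := ι_eq (.s3_in n 1 0 p.1 p.2)
  rw [ι_seq, ι_par, ι_par, ι_wires, one_mul, ι_wires, one_shift, mul_one] at h
  exact h

theorem ph_mul (p q : Ph) : ph p * ph q = ph (p + q) := by
  have := Zs_fuse 1 0 1 0 1 one_pos p q
  rwa [shift_zero] at this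

theorem ph_mul_Zs (m : ℕ) (p q : Ph) : ph p * Zs 1 m q = Zs 1 m (p + q) := by
  have := Zs_fuse 1 0 1 0 m one_pos p q
  rwa [shift_zero, Nat.zero_add m] at this

theorem Zs_mul_ph (n : ℕ) (p q : Ph) : Zs n 1 p * ph q = Zs n 1 (p + q) := by
  have := Zs_fuse n 0 1 0 1 one_pos p q
  rwa [shift_zero] at this

theorem ph_comm_cp (p : Ph) : cp * ph p ↟ 1 = ph p * cp := by
  rw [Zs_fuse 1 1 1 0 1 one_pos, ph_mul_Zs, add_comm p]

attribute [local simp] mul_assoc slide slide_assoc slide_shift slide_shift_assoc shift_shift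
  mul_shift one_shift shift_zero sw_sw sw_sw_assoc

theorem ph_comm_cp' (p : Ph) : cp * ph p = ph p * cp :=
  calc cp * ph p = cp * sw * ph p := by rw [Zs_sw_out]
    _ = cp * (sw * ph p) := by simp
    _ = (cp * ph p ↟ 1) * sw := by rw [← nat11' (ph p), mul_assoc]
    _ = ph p * (cp * sw) := by rw [ph_comm_cp, mul_assoc]
    _ = ph p * cp := by rw [Zs_sw_out]

theorem ph_comm_mg (p : Ph) : ph p * mg = mg * ph p := by
  rw [Zs_mul_ph]
  have := Zs_fuse 1 0 1 1 1 one_pos p 0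
  rw [shift_zero, add_comm p] at this
  exact this

theorem ph_comm_mg' (p : Ph) : ph p ↟ 1 * mg = mg * ph p :=
  calc ph p ↟ 1 * mg = ph p ↟ 1 * (sw * mg) := by rw [Zs_sw_in]
    _ = (ph p ↟ 1 * sw) * mg := by simp
    _ = sw * (ph p * mg) := by rw [nat11' (ph p), mul_assoc]
    _ = (sw * mg) * ph p := by rw [ph_comm_mg, mul_assoc]
    _ = mg * ph p := by rw [Zs_sw_in]

theorem sw_sw_shift (i : ℕ) : sw ↟ i * sw ↟ i = 1 := by rw [← mul_shift, sw_sw, one_shift]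

theorem sw_sw_shift_assoc (i : ℕ) (x : M) : sw ↟ i * (sw ↟ i * x) = x := by
  rw [← mul_assoc, sw_sw_shift, one_mul]

attribute [local simp] sw_sw_shift sw_sw_shift_assoc

theorem mg_cp : mg * cp = cp * mg ↟ 1 := by
  rw [Zs_fuse 1 1 1 1 1 one_pos]
  have := Zs_fuse 2 0 1 0 2 one_pos 0 0
  rw [shift_zero] at this
  exact this

theorem sw_mg_shift : sw * mg ↟ 1 = sw ↟ 1 * (mg * sw) := by
  rw [nat21 mg]; simp

/-- The other half of the Frobenius law, the mirror image of `mg_cp`: cross both inputs and both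
outputs. -/
theorem mg_cp' : mg * cp = cp ↟ 1 * mg := by
  have h : sw * (cp * mg ↟ 1) = cp ↟ 1 * mg * sw :=
    calc sw * (cp * mg ↟ 1) = (sw * cp) * mg ↟ 1 := by simp
      _ = cp ↟ 1 * (sw * (sw * mg) ↟ 1) := by rw [← nat12' cp]; simp
      _ = (cp * sw) ↟ 1 * (mg * sw) := by rw [Zs_sw_in, sw_mg_shift]; simp
      _ = cp ↟ 1 * mg * sw := by rw [Zs_sw_out]; simp
  calc mg * cp = (sw * mg) * (cp * sw) := by rw [Zs_sw_in, Zs_sw_out]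
    _ = sw * (mg * cp) * sw := by simp
    _ = cp ↟ 1 * mg := by rw [mg_cp, h]; simp

theorem cp_ef : cp * ef ↟ 1 = 1 := by
  rw [Zs_fuse 1 1 1 0 0 one_pos, add_zero (0 : Ph)]; exact ph_zero

theorem cp_ef' : cp * ef = 1 := by
  rw [← Zs_sw_out, mul_assoc, nat10', cp_ef]

theorem un_mg : un * mg = 1 := by
  have := Zs_fuse 0 0 1 1 1 one_pos 0 0
  rw [shift_zero, add_zero (0 : Ph)] at this
  exact this.trans ph_zero

theorem un_mg' : un ↟ 1 * mg = 1 := by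
  rw [← Zs_sw_in, ← mul_assoc, nat01', un_mg]

theorem Zs_sw_out_three (n : ℕ) (p : Ph) : Zs n 3 p * sw = Zs n 3 p := by
  have h := ι_eq (.s3_out n 0 1 p.1 p.2)
  rw [ι_seq, ι_par, ι_par, ι_wires, one_mul, ι_wires, one_shift, mul_one, shift_zero] at h
  exact h

theorem Zs_sw_out_three' (n : ℕ) (p : Ph) : Zs n 3 p * sw ↟ 1 = Zs n 3 p := by
  have h := ι_eq (.s3_out n 1 0 p.1 p.2)
  rw [ι_seq, ι_par, ι_par, ι_wires, one_mul, ι_wires, one_shift, mul_one] at h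
  exact h

/-- Fusion attaches the second spider to the last outputs of the first one only; crossing legs moves
it to the first output. -/
theorem cp_cp : cp * cp = cp * cp ↟ 1 :=
  calc cp * cp = cp * (sw * cp) := by rw [← mul_assoc, Zs_sw_out]
    _ = cp * cp ↟ 1 * sw * sw ↟ 1 := by rw [← nat12' cp]; simp
    _ = cp * cp ↟ 1 := by
      rw [Zs_fuse 1 1 1 0 2 one_pos, Zs_sw_out_three, Zs_sw_out_three']

theorem mg_mg_eq : mg * mg = Zs 3 1 0 := by
  have := Zs_fuse 2 0 1 1 1 one_pos 0 0
  rw [shift_zero, add_zero (0 : Ph)] at this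
  exact this

theorem mg_mg : mg ↟ 1 * mg = mg * mg :=
  calc mg ↟ 1 * mg = mg ↟ 1 * sw * mg := by rw [mul_assoc, Zs_sw_in]
    _ = sw * (sw ↟ 1 * (mg * mg)) := by rw [nat21' mg]; simp
    _ = mg * mg := by rw [mg_mg_eq, Zs_sw_three', Zs_sw_three]

theorem cup_cap : cup * cap ↟ 1 = 1 := by
  rw [Zs_fuse 0 1 1 1 0 one_pos, add_zero (0 : Ph)]; exact ph_zero

theorem mg_cap : cp * cap ↟ 1 = mg := by
  rw [Zs_fuse 1 1 1 1 0 one_pos, add_zero (0 : Ph)]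

theorem mg_cap' : cp ↟ 1 * cap = mg :=
  calc cp ↟ 1 * cap = cp ↟ 1 * (sw * sw ↟ 1) * (sw ↟ 1 * (sw * cap)) := by simp
    _ = sw * cp * (sw * (sw * (sw ↟ 1 * cap))) := by rw [nat12' cp, Zs_sw_in]; simp
    _ = sw * (cp * sw * cap ↟ 1) := by rw [nat20' cap]; simp
    _ = mg := by rw [Zs_sw_out, mg_cap, Zs_sw_in]

theorem un_cap (p : Ph) : Zs 0 1 p * cap = Zs 1 0 p := by
  have := Zs_fuse 0 0 1 1 0 one_pos p 0
  rw [shift_zero, add_zero p] at this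
  exact this

theorem un_cap' (p : Ph) : Zs 0 1 p ↟ 1 * cap = Zs 1 0 p := by
  rw [← Zs_sw_in, ← mul_assoc, nat01', un_cap]

/-- Both sides are the green effect with three legs. Used to bend a merge into a copy and so to
transpose the copy rule. -/
theorem mg_cap_cap : mg * cap = cp ↟ 2 * (cap ↟ 1 * cap) := by
  have h1 : mg * cap = Zs 3 0 0 := by
    have := Zs_fuse 2 0 1 1 0 one_pos 0 0
    rw [shift_zero, add_zero (0 : Ph)] at this
    exact this
  calc mg * cap = sw * (sw ↟ 1 * (mg * cap)) := by rw [h1, Zs_sw_three', Zs_sw_three]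
    _ = mg ↟ 1 * (sw * cap) := by rw [← mul_assoc, ← mul_assoc, mul_assoc sw, ← nat21', mul_assoc]
    _ = (cp ↟ 1 * cap) ↟ 1 * cap := by rw [mg_cap', Zs_sw_in]
    _ = cp ↟ 2 * (cap ↟ 1 * cap) := by simp

/-! ### The `H` node -/

theorem Hd_Hi : Hd * Hi = 1 := by
  rw [Hd, Hi, ← ι_seq, ι_eq .h1, ι_wire]

theorem Hi_Hd : Hi * Hd = 1 := by
  rw [Hd, Hi, ← ι_seq, ι_eq .h1', ι_wire]

theorem Hi_Hi : Hi * Hi = Hd * Hd := by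
  rw [Hd, Hi, ← ι_seq, ← ι_seq, ι_eq .p1_had]

theorem Hd_Hi_shift (i : ℕ) : Hd ↟ i * Hi ↟ i = 1 := by rw [← mul_shift, Hd_Hi, one_shift]
theorem Hi_Hd_shift (i : ℕ) : Hi ↟ i * Hd ↟ i = 1 := by rw [← mul_shift, Hi_Hd, one_shift]

theorem Hd_Hi_assoc (x : M) : Hd * (Hi * x) = x := by rw [← mul_assoc, Hd_Hi, one_mul]
theorem Hi_Hd_assoc (x : M) : Hi * (Hd * x) = x := by rw [← mul_assoc, Hi_Hd, one_mul]

theorem Hi_Hi_assoc (x : M) : Hi * (Hi * x) = Hd * (Hd * x) := by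
  rw [← mul_assoc, Hi_Hi, mul_assoc]

theorem Hd_Hi_shift_assoc (i : ℕ) (x : M) : Hd ↟ i * (Hi ↟ i * x) = x := by
  rw [← mul_assoc, Hd_Hi_shift, one_mul]

theorem Hi_Hd_shift_assoc (i : ℕ) (x : M) : Hi ↟ i * (Hd ↟ i * x) = x := by
  rw [← mul_assoc, Hi_Hd_shift, one_mul]

theorem Hd_Hd_Hd : Hd * (Hd * Hd) = Hi := by rw [← Hi_Hi, Hd_Hi_assoc]

theorem Hd_Hd_Hd_assoc (x : M) : Hd * (Hd * (Hd * x)) = Hi * x := by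
  rw [← Hi_Hi_assoc, Hi_Hd_assoc]

attribute [local simp] Hd_Hi Hi_Hd Hi_Hi Hd_Hi_shift Hi_Hd_shift Hd_Hi_assoc Hi_Hd_assoc
  Hi_Hi_assoc Hd_Hi_shift_assoc Hi_Hd_shift_assoc Hd_Hd_Hd Hd_Hd_Hd_assoc

/-- `x` on each of `n` wires. -/
noncomputable def lay (x : M) : ℕ → M
  | 0 => 1
  | n + 1 => lay x n * x ↟ n

theorem ι_layer_const (U : Diagram 1 1) (n : ℕ) : ι (layer fun _ : Fin n => U) = lay (ι U) n := by
  induction n with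
  | zero => rfl
  | succ n ih => rw [layer, ι_par, ih, lay]

theorem lay_one (x : M) : lay x 1 = x := by rw [lay, lay, one_mul, shift_zero]

theorem lay_two (x : M) : lay x 2 = x * x ↟ 1 := by rw [lay, lay_one]

theorem Xs_eq (n m : ℕ) (p : Ph) : Xs n m p = lay Hi n * Zs n m p * lay Hd m := by
  rw [Hi, Hd, ← ι_layer_const, ← ι_layer_const, Zs, ← ι_seq, ← ι_seq]
  exact ι_eq (.symm (.h2 n m p.1 p.2))

theorem Xs_eq' (n m : ℕ) (p : Ph) : Xs n m p.swap = lay Hd n * Zs n m p * lay Hi m := by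
  rw [Hi, Hd, ← ι_layer_const, ← ι_layer_const, Zs, ← ι_seq, ← ι_seq]
  exact ι_eq (.symm (.h2' n m p.1 p.2))

/-- (H2) and (H2′) describe the same red spider when there are no phases. -/
theorem Hi_ef : Hi * ef = Hd * ef := by
  have h := Xs_eq' 1 0 0
  rw [Prod.swap_zero, Xs_eq, lay_one, lay_one, lay, lay, mul_one, mul_one] at h
  exact h

theorem un_Hi : un * Hi = un * Hd := by
  have h := Xs_eq' 0 1 0
  rw [Prod.swap_zero, Xs_eq, lay_one, lay_one, lay, lay, one_mul] at h
  exact h.symm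

/-- The comparison of (H2) with (H2′) in the presence of phases: `H²` negates basis labels and
thereby exchanges the two angles. -/
theorem ph_dual (p : Ph) : ph p * (Hd * Hd) = Hd * Hd * ph p.swap := by
  have h : Hi * ph p * Hd = Hd * ph p.swap * Hi := by
    have h := Xs_eq' 1 1 p.swap
    rwa [Prod.swap_swap, Xs_eq, lay_one, lay_one] at h
  calc ph p * (Hd * Hd) = Hd * (Hi * ph p * Hd) * Hd := by simp
    _ = Hd * Hd * ph p.swap := by rw [h]; simp

/-- (P1), with its red effect rewritten by colour change, says that bending `H†` around by green
cups and caps gives `H†` again. This symmetry is what makes edges undirected. -/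
theorem cup_Hi_cap : cup ↟ 1 * Hi ↟ 1 * cap = Hi := by
  have h : Hd * Hd = Hi * (cup ↟ 1 * Hi ↟ 1 * cap) := by
    have := ι_eq .p1_cup
    rw [ι_seq, ι_seq, ι_cast, ι_par, ι_par, ι_wire, one_shift, one_mul, mul_one] at this
    change Hd * Hd = cup ↟ 1 * Xs 2 0 0 at this
    rw [this, Xs_eq, lay_two, lay]
    simp
  calc cup ↟ 1 * Hi ↟ 1 * cap = Hd * (Hi * (cup ↟ 1 * Hi ↟ 1 * cap)) := by rw [Hd_Hi_assoc]
    _ = Hi := by rw [← h]; simp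

theorem Hi_slide_cap : Hi ↟ 1 * cap = Hi * cap :=
  calc Hi ↟ 1 * cap = (cup ↟ 1 * cap ↟ 2) * Hi ↟ 1 * cap := by
        rw [show cup ↟ 1 * cap ↟ 2 = (cup * cap ↟ 1) ↟ 1 by simp, cup_cap]; simp
    _ = cup ↟ 1 * (cap ↟ 2 * (Hi ↟ 1 * cap)) := by simp
    _ = cup ↟ 1 * (Hi ↟ 1 * (cap ↟ 2 * cap)) := by simp
    _ = cup ↟ 1 * Hi ↟ 1 * cap * cap := by
      rw [← HasAr.comm (x := cap) inferInstance cap, shift_zero]; simp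
    _ = Hi * cap := by rw [cup_Hi_cap]

theorem Hd_slide_cap : Hd ↟ 1 * cap = Hd * cap :=
  calc Hd ↟ 1 * cap = Hd ↟ 1 * (Hd * (Hi * cap)) := by simp
    _ = Hd * cap := by rw [← Hi_slide_cap]; simp

/-- The edge of weight `g`. -/
noncomputable def E (g : ZMod 3) : M := if g = 0 then ef * un else if g = 1 then Hd else Hi

theorem E_zero : E 0 = ef * un := rfl
theorem E_one : E 1 = Hd := rfl
theorem E_two : E 2 = Hi := rfl

instance (g : ZMod 3) : HasAr (E g) 1 1 := by
  unfold E
  split_ifs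
  · exact HasAr.mul (b := 0) (inferInstanceAs (HasAr ef 1 0)) (inferInstanceAs (HasAr un 0 1))
  · infer_instance
  · infer_instance

theorem E_slide_cap (g : ZMod 3) : E g ↟ 1 * cap = E g * cap := by
  rcases zmod3_cases g with rfl | rfl | rfl
  · rw [E_zero, mul_shift, mul_assoc, mul_assoc, un_cap', un_cap,
      ← HasAr.comm (x := ef) inferInstance ef, shift_zero]
  · exact Hd_slide_cap
  · exact Hi_slide_cap

/-! ### Copying red units -/

theorem Xs_zero_one : Xs 0 1 0 = un * Hd := by rw [Xs_eq, lay_one, lay, one_mul]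

theorem copy_red : un * (Hd * cp) = un * (Hd * (un ↟ 1 * Hd ↟ 1)) := by
  have h := ι_eq .b1
  rw [ι_seq, ι_par] at h
  change Xs 0 1 0 * cp = Xs 0 1 0 * Xs 0 1 0 ↟ 1 at h
  simpa only [Xs_zero_one, mul_assoc, mul_shift] using h

/-- The red unit is a multiple of `|0⟩`, on which every green effect has the entry one. -/
theorem red_Zs (p : Ph) : un * (Hd * Zs 1 0 p) = 1 := by
  have h : ι (X 0 1 0 0 ⨾ᵈ Z 1 0 p.1 p.2) = 1 := by
    refine scalar_eq_one ((nz_ι _).2 ((interp_ne_zero_iff _).2 ⟨0, 0, ?_⟩))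
    rw [(isFun_X_one 0).amp_seq, amp_Z, sum_zmod3]
    have h2 : (0 : ZMod 3) ≠ 1 ∧ (0 : ZMod 3) ≠ 2 := by decide
    simp [phaseCoeff, h2]
  rw [ι_seq] at h
  change Xs 0 1 0 * Zs 1 0 p = 1 at h
  rwa [Xs_zero_one, mul_assoc] at h

/-- The phase is hung on a deleted copy of the wire; the red unit is copied by (B1), and the leg
with the phase becomes a non-zero scalar. -/
theorem red_ph (p : Ph) : un * (Hd * ph p) = un * Hd :=
  calc un * (Hd * ph p) = un * (Hd * (ph p * (cp * ef))) := by rw [cp_ef', mul_one]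
    _ = (un * (Hd * cp)) * (ph p * ef) := by rw [← mul_assoc (ph p), ← ph_comm_cp']; simp
    _ = un * (Hd * (un ↟ 1 * Hd ↟ 1)) * Zs 1 0 p := by rw [copy_red, ph_mul_Zs, add_zero p]
    _ = un * Hd * ((un * Hd) ↟ 1 * Zs 1 0 p) := by simp only [mul_assoc, mul_shift]
    _ = un * (Hd * Zs 1 0 p) * (un * Hd) := by
      rw [← shift_zero (un * Hd), shift_shift, ← HasAr.comm (x := Zs 1 0 p) inferInstance]; simp
    _ = un * Hd := by rw [red_Zs, one_mul]

theorem red_cap : un ↟ 1 * (Hd ↟ 1 * cap) = Hd * ef := by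
  rw [Hd_slide_cap, ← un_cap' 0]; simp

theorem ph_cap (p : Ph) : ph p ↟ 1 * cap = ph p * cap := by
  have h1 : ph p * cap = Zs 2 0 p := by
    have := Zs_fuse 1 0 1 1 0 one_pos p 0
    rw [shift_zero, add_zero p] at this
    exact this
  have h2 : sw * Zs 2 0 p = Zs 2 0 p := Zs_sw_in 0 p
  calc ph p ↟ 1 * cap = ph p ↟ 1 * (sw * cap) := by rw [Zs_sw_in]
    _ = ph p ↟ 1 * sw * cap := by simp
    _ = ph p * cap := by rw [nat11', mul_assoc, h1, h2]

theorem ph_red (p : Ph) : ph p * (Hd * ef) = Hd * ef :=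
  calc ph p * (Hd * ef) = un ↟ 1 * (Hd ↟ 1 * (ph p * cap)) := by rw [← red_cap]; simp
    _ = (un * (Hd * ph p)) ↟ 1 * cap := by rw [← ph_cap]; simp
    _ = Hd * ef := by rw [red_ph, ← red_cap]; simp

/-- The transpose of the copy rule `copy_red`; by `red_cap` red effects are bent red units. -/
theorem mg_red : mg * (Hd * ef) = Hd ↟ 1 * (ef ↟ 1 * (Hd * ef)) :=
  calc mg * (Hd * ef) = un ↟ 2 * (Hd ↟ 2 * (mg * cap)) := by rw [← red_cap]; simp
    _ = (un * (Hd * cp)) ↟ 2 * (cap ↟ 1 * cap) := by rw [mg_cap_cap]; simp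
    _ = (un ↟ 1 * (Hd ↟ 1 * cap)) ↟ 1 * (un ↟ 1 * (Hd ↟ 1 * cap)) := by rw [copy_red]; simp
    _ = Hd ↟ 1 * (ef ↟ 1 * (Hd * ef)) := by rw [red_cap]; simp

/-! ### Stabilizer phases -/

theorem ang_add (k l : ℤ) : ang (k + l) = ang k + ang l := by
  rw [ang, ang, ang, ← Real.Angle.coe_add]; congr 1; push_cast; ring

theorem ang_three : ang 3 = 0 := by
  rw [ang, ← Real.Angle.coe_two_pi]; congr 1; push_cast; ring

theorem ang_zero : ang 0 = 0 := by simp [ang]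

/-- The angle `a · 2π/3` of a class modulo three. -/
noncomputable def angZ : ZMod 3 →+ Real.Angle :=
  ZMod.lift 3 ⟨⟨⟨ang, ang_zero⟩, ang_add⟩, ang_three⟩

theorem angZ_intCast (k : ℤ) : angZ (k : ZMod 3) = ang k := ZMod.lift_coe 3 _ k

/-- The phases of `ω ^ (a x + b x ^ 2)`. -/
noncomputable def pq (a b : ZMod 3) : Ph := (angZ (a + b), angZ (2 * a + b))

theorem pq_add (a b a' b' : ZMod 3) : pq a b + pq a' b' = pq (a + a') (b + b') := by
  simp only [pq, Prod.mk_add_mk, ← map_add]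
  congr 2 <;> ring

theorem pq_zero : pq 0 0 = 0 := by simp [pq]

theorem pq_swap (a b : ZMod 3) : (pq a b).swap = pq (-a) b := by
  simp only [pq, Prod.swap_prod_mk]
  congr 2
  · rw [show (2 : ZMod 3) = -1 by decide]; ring
  · rw [show (2 : ZMod 3) = -1 by decide]; ring

theorem exists_pq {α β : Real.Angle} (hα : IsStabAngle α) (hβ : IsStabAngle β) :
    ∃ a b, (α, β) = pq a b := by
  obtain ⟨k, rfl⟩ := hα
  obtain ⟨l, rfl⟩ := hβ
  refine ⟨l - k, 2 * k - l, ?_⟩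
  rw [← angZ_intCast, ← angZ_intCast, pq]
  congr 2 <;> ring

theorem isStabAngle_angZ (a : ZMod 3) : IsStabAngle (angZ a) := by
  obtain ⟨k, rfl⟩ := ZMod.intCast_surjective a
  exact ⟨k, angZ_intCast k⟩

theorem ang_one : ang 1 = angZ 1 := by rw [← angZ_intCast]; simp
theorem ang_two : ang 2 = angZ 2 := by rw [← angZ_intCast]; simp

theorem ph_pq_mul (a b a' b' : ZMod 3) :
    ph (pq a b) * ph (pq a' b') = ph (pq (a + a') (b + b')) := by
  rw [ph_mul, pq_add]

theorem ph_pq_zero : ph (pq 0 0) = 1 := by rw [pq_zero, ph_zero]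

theorem ph_cancel (a b : ZMod 3) : ph (pq a b) * ph (pq (-a) (-b)) = 1 := by
  rw [ph_pq_mul, add_neg_cancel, add_neg_cancel, ph_pq_zero]

theorem ph_cancel' (a b : ZMod 3) : ph (pq (-a) (-b)) * ph (pq a b) = 1 := by
  rw [ph_pq_mul, neg_add_cancel, neg_add_cancel, ph_pq_zero]

theorem ph_dual_pq (a b : ZMod 3) :
    ph (pq a b) * (Hd * Hd) = Hd * (Hd * ph (pq (-a) b)) := by
  rw [ph_dual, pq_swap, mul_assoc]

/-! ### Euler decompositions -/

theorem ph12 : ph (pq 0 1) * ph (pq 0 2) = 1 := ph_cancel 0 1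
theorem ph21 : ph (pq 0 2) * ph (pq 0 1) = 1 := ph_cancel 0 2
theorem ph12_assoc (x : M) : ph (pq 0 1) * (ph (pq 0 2) * x) = x := by
  rw [← mul_assoc, ph12, one_mul]
theorem dual_ph (b : ZMod 3) : ph (pq 0 b) * (Hd * Hd) = Hd * (Hd * ph (pq 0 b)) := by
  rw [ph_dual_pq, neg_zero]

theorem dual_ph_assoc (b : ZMod 3) (x : M) :
    ph (pq 0 b) * (Hd * (Hd * x)) = Hd * (Hd * (ph (pq 0 b) * x)) := by
  have := congrArg (· * x) (dual_ph b)
  simpa using this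

attribute [local simp] ph12 ph21 ph12_assoc dual_ph dual_ph_assoc

theorem Hd_euler : Hd = ph (pq 0 2) * (Hi * (ph (pq 0 2) * (Hd * ph (pq 0 2)))) := by
  have h := ι_eq .eu
  rw [ι_seq, ι_seq] at h
  change Hd = ph (ang 2, ang 2) * Xs 1 1 (ang 2, ang 2) * ph (ang 2, ang 2) at h
  have h2 : (ang 2, ang 2) = pq 0 2 := by rw [ang_two]; simp [pq]
  rw [Xs_eq, lay_one, lay_one, h2] at h
  simpa using h

theorem Hi_ph_Hd : Hi * (ph (pq 0 2) * Hd) = ph (pq 0 1) * (Hd * ph (pq 0 1)) := by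
  calc Hi * (ph (pq 0 2) * Hd) = ph (pq 0 1) * ((ph (pq 0 2) * (Hi * (ph (pq 0 2) * (Hd *
        ph (pq 0 2))))) * ph (pq 0 1)) := by simp
    _ = _ := by rw [← Hd_euler]

theorem Hd_one_Hd : Hd * (ph (pq 0 1) * Hd) = ph (pq 0 2) * (Hd * ph (pq 0 2)) :=
  calc Hd * (ph (pq 0 1) * Hd) = Hd * (ph (pq 0 1) * (Hd * ph (pq 0 1))) * ph (pq 0 2) := by simp
    _ = _ := by rw [← Hi_ph_Hd]; simp

theorem Hd_two_Hd : Hd * (ph (pq 0 2) * Hd) = ph (pq 0 1) * (Hi * ph (pq 0 1)) :=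
  calc Hd * (ph (pq 0 2) * Hd) = Hd * (Hd * (Hi * (ph (pq 0 2) * Hd))) := by simp
    _ = _ := by rw [Hi_ph_Hd, ← Hd_Hd_Hd_assoc (ph (pq 0 1)), dual_ph_assoc]

theorem Hi_one_Hd : Hi * (ph (pq 0 1) * Hd) = ph (pq 0 2) * (Hi * ph (pq 0 2)) :=
  calc Hi * (ph (pq 0 1) * Hd) = Hd * (Hd * (Hd * (ph (pq 0 1) * Hd))) := by simp
    _ = _ := by rw [Hd_one_Hd, ← Hd_Hd_Hd_assoc (ph (pq 0 2)), dual_ph_assoc]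

theorem Hd_two_Hi : Hd * (ph (pq 0 2) * Hi) = ph (pq 0 1) * (Hd * ph (pq 0 1)) := by
  rw [← Hi_ph_Hd, ← Hd_Hd_Hd, dual_ph_assoc]; simp only [mul_assoc]

theorem Hd_one_Hi : Hd * (ph (pq 0 1) * Hi) = ph (pq 0 2) * (Hi * ph (pq 0 2)) := by
  rw [← Hi_one_Hd, ← Hd_Hd_Hd, dual_ph_assoc]; simp only [mul_assoc]

/-- All four cases are forms of the single rule (EU). They differ by factors `H²`, which commute
with quadratic phases because squares are even. -/
theorem E_ph_Hd {b : ZMod 3} (hb : b ≠ 0) (t : ZMod 3) (ht : t ≠ 0) :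
    E t * (ph (pq 0 (2 * b)) * Hd) =
      ph (pq 0 (b * t ^ 2)) * (E (2 * b * t) * ph (pq 0 b)) := by
  rcases zmod3_cases b with rfl | rfl | rfl
  · exact absurd rfl hb
  · rcases zmod3_cases t with rfl | rfl | rfl
    · exact absurd rfl ht
    · exact Hd_two_Hd
    · exact Hi_ph_Hd
  · rcases zmod3_cases t with rfl | rfl | rfl
    · exact absurd rfl ht
    · exact Hd_one_Hd
    · exact Hi_one_Hd

/-- The Fourier transform of a quadratic phase is a quadratic phase with the opposite coefficient:
Euler decomposition, after which the red effect absorbs the last phase. -/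
theorem Hi_two_ef : Hi * (ph (pq 0 2) * ef) = ph (pq 0 1) * ef :=
  calc Hi * (ph (pq 0 2) * ef) = (Hi * (ph (pq 0 2) * Hd)) * (Hi * ef) := by simp
    _ = ph (pq 0 1) * (Hd * (ph (pq 0 1) * (Hd * ef))) := by rw [Hi_ph_Hd, Hi_ef]; simp
    _ = ph (pq 0 1) * (Hd * (Hi * ef)) := by rw [ph_red, Hi_ef]
    _ = _ := by simp

theorem dual_ef : Hd * (Hd * ef) = ef := by rw [← Hi_ef]; simp

theorem Hd_two_ef : Hd * (ph (pq 0 2) * ef) = ph (pq 0 1) * ef :=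
  calc Hd * (ph (pq 0 2) * ef) = Hd * (Hd * (Hi * (ph (pq 0 2) * ef))) := by simp
    _ = _ := by rw [Hi_two_ef, ← dual_ph_assoc, dual_ef]

theorem Hd_one_ef : Hd * (ph (pq 0 1) * ef) = ph (pq 0 2) * ef := by
  rw [← Hi_two_ef]; simp

theorem Hi_one_ef : Hi * (ph (pq 0 1) * ef) = ph (pq 0 2) * ef := by
  rw [← Hd_two_ef]; simp

theorem un_two_Hi : un * (ph (pq 0 2) * Hi) = un * ph (pq 0 1) :=
  calc un * (ph (pq 0 2) * Hi) = un * Hi * (Hd * (ph (pq 0 2) * Hi)) := by simp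
    _ = un * (Hd * ph (pq 0 1)) * (Hd * ph (pq 0 1)) := by rw [un_Hi, Hd_two_Hi]; simp
    _ = un * Hi * (Hd * ph (pq 0 1)) := by rw [red_ph, un_Hi]
    _ = un * ph (pq 0 1) := by simp

theorem un_one_Hi : un * (ph (pq 0 1) * Hi) = un * ph (pq 0 2) :=
  calc un * (ph (pq 0 1) * Hi) = un * Hi * (Hd * (ph (pq 0 1) * Hi)) := by simp
    _ = un * (Hd * ph (pq 0 2)) * (Hi * ph (pq 0 2)) := by rw [un_Hi, Hd_one_Hi]; simp
    _ = un * ph (pq 0 2) := by rw [red_ph]; simp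

/-! ### Shift operators -/

/-- The operator sending the basis vector `y` to `y + a`. -/
noncomputable def Px (a : ZMod 3) : M := Hd * (ph (pq a 0) * Hi)

theorem Xs_one_one (a : ZMod 3) : Xs 1 1 (pq (-a) 0) = Px a := by
  rw [← pq_swap, Xs_eq', lay_one, lay_one, mul_assoc, Px]

theorem Px_eq (a : ZMod 3) : Px a = Hi * (ph (pq (-a) 0) * Hd) := by
  rw [← Xs_one_one, Xs_eq, lay_one, lay_one, mul_assoc]

instance (a : ZMod 3) : HasAr (Px a) 1 1 := by rw [← Xs_one_one]; infer_instance

theorem Px_mul (a b : ZMod 3) : Px a * Px b = Px (a + b) := by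
  have := ph_pq_mul a 0 b 0
  rw [add_zero] at this
  simp only [Px, mul_assoc, Hi_Hd_assoc, ← this]

theorem Px_zero : Px 0 = 1 := by rw [Px, ph_pq_zero]; simp

theorem Px_cp (a : ZMod 3) : Px a * cp = cp * (Px a * Px a ↟ 1) := by
  have key : ∀ α β : Real.Angle, ∀ h : ZXEq (X 1 1 α β ⨾ᵈ Z 1 2 0 0)
      (Z 1 2 0 0 ⨾ᵈ layer fun _ : Fin 2 => X 1 1 α β),
      Xs 1 1 (α, β) * cp = cp * (Xs 1 1 (α, β) * Xs 1 1 (α, β) ↟ 1) := by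
    intro α β h
    have := ι_eq h
    rwa [ι_seq, ι_seq, ι_layer_const, lay_two] at this
  have h1 : pq 1 0 = (ang 1, ang 2) := by rw [ang_one, ang_two]; simp [pq]
  have h2 : pq 2 0 = (ang 2, ang 1) := by
    rw [ang_one, ang_two, pq]; congr 2
  rcases zmod3_cases a with rfl | rfl | rfl
  · simp [Px_zero]
  · rw [← Xs_one_one, show (-1 : ZMod 3) = 2 by decide, h2]
    exact key _ _ (.k1_21 2)
  · rw [← Xs_one_one, show (-2 : ZMod 3) = 1 by decide, h1]
    exact key _ _ (.k1_12 2)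

theorem Px_cap (a : ZMod 3) : Px a ↟ 1 * cap = Px (-a) * cap :=
  calc Px a ↟ 1 * cap = Hd ↟ 1 * (ph (pq a 0) ↟ 1 * (Hi ↟ 1 * cap)) := by simp [Px]
    _ = Hi * (Hd ↟ 1 * (ph (pq a 0) ↟ 1 * cap)) := by rw [Hi_slide_cap]; simp
    _ = Hi * (ph (pq a 0) * (Hd ↟ 1 * cap)) := by rw [ph_cap]; simp
    _ = Px (-a) * cap := by rw [Hd_slide_cap, Px_eq]; simp

/-- Merging forces the two labels to agree, so shifting one of them amounts to shifting the other
back and then the result forward. -/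
theorem Px_mg (a : ZMod 3) : Px a ↟ 1 * mg = Px (-a) * (mg * Px a) :=
  calc Px a ↟ 1 * mg = cp * (Px a ↟ 1 * cap) ↟ 1 := by rw [← mg_cap]; simp
    _ = cp * (Px (-a) * Px (-a) ↟ 1) * (Px a * cap ↟ 1) := by
      rw [Px_cap]
      simp [Px_mul, Px_zero]
    _ = Px (-a) * (mg * Px a) := by rw [← Px_cp, ← mg_cap]; simp

/-! ### Controlled phase gates -/

/-- The controlled phase gate of weight `g` on two wires. -/
noncomputable def CZ (g : ZMod 3) : M := cp * (E g * mg) ↟ 1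

instance (g : ZMod 3) : HasAr (CZ g) 2 2 :=
  HasAr.mul (HasAr.pad (inferInstance : HasAr cp 1 2) 1)
    (HasAr.shift (HasAr.mul (HasAr.pad (inferInstance : HasAr (E g) 1 1) 1)
      (inferInstance : HasAr mg 2 1)) 1)

/-- Couple two wires by an effect on a copy of each. -/
noncomputable def couple (f : M) : M := cp * (cp ↟ 2 * f ↟ 1)

theorem CZ_eq (g : ZMod 3) : CZ g = couple (E g * cap) := by
  rw [CZ, couple, ← mg_cap']; simp

theorem CZ_zero : CZ 0 = 1 := by
  rw [CZ, E_zero, mul_assoc, un_mg, mul_one, cp_ef]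

/-- Two effects on copies of two wires. -/
noncomputable def conv (f f' : M) : M := cp * (cp ↟ 2 * (sw ↟ 1 * (f * f')))

/-- Coassociativity collects the copies on each wire into one copy which is then split, so that
diagonal gates multiply as their effects do pointwise. -/
theorem couple_mul (f f' : M) [hf : HasAr f 2 0] [HasAr f' 2 0] :
    couple f * couple f' = couple (conv f f') :=
  calc couple f * couple f' = cp * (cp ↟ 2 * (f ↟ 1 * (cp * (cp ↟ 2 * f' ↟ 1)))) := by
        simp [couple]
    _ = cp * (cp * (cp ↟ 3 * (cp ↟ 4 * (f ↟ 2 * f' ↟ 1)))) := by simp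
    _ = (cp * cp) * ((cp * cp ↟ 1) ↟ 3 * (f ↟ 2 * f' ↟ 1)) := by simp
    _ = (cp * cp ↟ 1) * ((cp * cp) ↟ 3 * (f ↟ 2 * f' ↟ 1)) := by rw [← cp_cp]
    _ = (cp * (cp * sw) ↟ 1) * ((cp * cp) ↟ 3 * (f ↟ 2 * f' ↟ 1)) := by rw [Zs_sw_out]
    _ = cp * (cp ↟ 1 * (cp ↟ 3 * (cp ↟ 3 * (sw ↟ 1 * f ↟ 2 * f' ↟ 1)))) := by simp
    _ = couple (conv f f') := by
      have h : sw ↟ 1 * f ↟ 2 = sw ↟ 2 * f ↟ 1 := by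
        have := congrArg (sw * ·) (nat20' f)
        have := congrArg (· ↟ 1) this
        simpa using this.symm
      rw [h, couple, conv]
      simp

/-- The effect on two wires that applies `Zs 1 0 p` to their sum. -/
noncomputable def sumEf (p : Ph) : M := Hi * (Hi ↟ 1 * (mg * (Hd * Zs 1 0 p)))

theorem Xs_two_one : Xs 2 1 0 = Hi * (Hi ↟ 1 * (mg * Hd)) := by
  rw [Xs_eq, lay_two, lay_one]; simp only [mul_assoc]

theorem Xs_two_one' : Xs 2 1 0 = Hd * (Hd ↟ 1 * (mg * Hi)) := by
  have := Xs_eq' 2 1 0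
  rw [lay_two, lay_one, Prod.swap_zero] at this
  simpa only [mul_assoc] using this

theorem sumEf_eq (p : Ph) : sumEf p = Xs 2 1 0 * Zs 1 0 p := by
  rw [Xs_two_one]; simp only [mul_assoc, sumEf]

instance (p : Ph) : HasAr (sumEf p) 2 0 := by
  rw [sumEf_eq]
  exact HasAr.mul (inferInstance : HasAr (Xs 2 1 0) 2 1) (inferInstance : HasAr (Zs 1 0 p) 1 0)

theorem bialgebra :
    cp * (cp ↟ 2 * (sw ↟ 1 * (Xs 2 1 0 * Xs 2 1 0 ↟ 1))) = Xs 2 1 0 * cp := by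
  have h := ι_eq .b2
  rw [ι_seq, ι_seq, ι_seq, ι_cast, ι_par, ι_par, ι_par, ι_par, ι_wire, one_shift, one_mul,
    mul_one] at h
  simp only [mul_assoc] at h
  exact h

theorem cp_Zs_Zs (p q : Ph) : cp * (Zs 1 0 p * Zs 1 0 q) = Zs 1 0 (p + q) :=
  calc cp * (Zs 1 0 p * Zs 1 0 q) = cp * ((ph p * ef) * (ph q * ef)) := by
        rw [ph_mul_Zs, ph_mul_Zs, add_zero p, add_zero q]
    _ = (cp * ph p) * (ef * (ph q * ef)) := by simp
    _ = ph p * (cp * ef) * (ph q * ef) := by rw [ph_comm_cp']; simp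
    _ = Zs 1 0 (p + q) := by rw [cp_ef', ph_mul_Zs, mul_one, ph_mul_Zs, add_zero q]

/-- By the bialgebra rule two sums of copies are copies of one sum; on that single wire the two
green effects fuse. -/
theorem conv_sumEf (p q : Ph) : conv (sumEf p) (sumEf q) = sumEf (p + q) :=
  calc conv (sumEf p) (sumEf q)
    _ = cp * (cp ↟ 2 * (sw ↟ 1 * (Xs 2 1 0 * (Zs 1 0 p * Xs 2 1 0 ↟ 0 * Zs 1 0 q)))) := by
      simp [conv, sumEf_eq]
    _ = cp * (cp ↟ 2 * (sw ↟ 1 * (Xs 2 1 0 * Xs 2 1 0 ↟ 1))) * (Zs 1 0 p * Zs 1 0 q) := by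
      rw [HasAr.comm (x := Zs 1 0 p) inferInstance]; simp
    _ = sumEf (p + q) := by rw [bialgebra, mul_assoc, cp_Zs_Zs, sumEf_eq]

theorem Hi_two_Hi : Hi * (ph (pq 0 2) * Hi) = ph (pq 0 1) * (Hi * ph (pq 0 1)) := by
  rw [← Hd_two_Hd, ← Hd_Hd_Hd_assoc, Hd_two_Hi, Hd_two_Hd, ← Hd_Hd_Hd_assoc (ph (pq 0 1)),
    dual_ph_assoc]

theorem Hi_one_Hi : Hi * (ph (pq 0 1) * Hi) = ph (pq 0 2) * (Hd * ph (pq 0 2)) := by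
  rw [← Hd_Hd_Hd_assoc, Hd_one_Hi, ← dual_ph_assoc, Hd_Hi_assoc]

/-- The identity `b(x + y)² = bx² + by² + 2bxy`. It expresses an edge through `sumEf`, whose
composition law is known. For `b ≠ 0` it is the Euler decomposition, for `b = 0` the copy rule. -/
theorem E_two_cap (b : ZMod 3) :
    sumEf (pq 0 b) = ph (pq 0 b) * (ph (pq 0 b) ↟ 1 * (E (2 * b) * cap)) := by
  have hcap : ∀ p, mg * (ph p * ef) = ph p * cap := fun p => by
    rw [← mul_assoc, ← ph_comm_mg, mul_assoc]
    congr 1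
    have := Zs_fuse 2 0 1 0 0 one_pos 0 0
    rw [shift_zero, add_zero (0 : Ph)] at this
    exact this
  have hef : ∀ p, Zs 1 0 p = ph p * ef := fun p => by rw [ph_mul_Zs, add_zero p]
  rcases zmod3_cases b with rfl | rfl | rfl
  · rw [pq_zero, sumEf, mg_red, ph_zero, mul_zero, E_zero, mul_assoc ef un, un_cap]
    have := HasAr.comm (x := ef) inferInstance ef
    rw [shift_zero] at this
    simp [this]
  · calc sumEf (pq 0 1) = Hi * (ph (pq 0 2) * (Hi ↟ 1 * cap)) := by
          rw [sumEf, hef, Hd_one_ef, hcap]; simp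
      _ = (Hi * (ph (pq 0 2) * Hi)) * cap := by rw [Hi_slide_cap]; simp only [mul_assoc]
      _ = ph (pq 0 1) * (ph (pq 0 1) ↟ 1 * (Hi * cap)) := by
        rw [Hi_two_Hi, mul_assoc, mul_assoc, ← ph_cap]; simp
  · calc sumEf (pq 0 2) = Hi * (ph (pq 0 1) * (Hi ↟ 1 * cap)) := by
          rw [sumEf, hef, Hd_two_ef, hcap]; simp
      _ = (Hi * (ph (pq 0 1) * Hi)) * cap := by rw [Hi_slide_cap]; simp only [mul_assoc]
      _ = ph (pq 0 2) * (ph (pq 0 2) ↟ 1 * (Hd * cap)) := by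
        rw [Hi_one_Hi, mul_assoc, mul_assoc, ← ph_cap]; simp

theorem ph_CZ (p : Ph) (g : ZMod 3) : CZ g * ph p = ph p * CZ g := by
  have h := congrArg (· * (E g ↟ 1 * mg ↟ 1)) (ph_comm_cp' p)
  simpa [CZ] using h

theorem ph_CZ' (p : Ph) (g : ZMod 3) : CZ g * ph p ↟ 1 = ph p ↟ 1 * CZ g := by
  have h := congrArg (fun x => cp * (E g ↟ 1 * x ↟ 1)) (ph_comm_mg' p)
  simpa [CZ] using h.symm

theorem ph_CZ_assoc (p : Ph) (g : ZMod 3) (x : M) : CZ g * (ph p * x) = ph p * (CZ g * x) := by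
  rw [← mul_assoc, ph_CZ, mul_assoc]

theorem ph_CZ_assoc' (p : Ph) (g : ZMod 3) (x : M) :
    CZ g * (ph p ↟ 1 * x) = ph p ↟ 1 * (CZ g * x) := by
  rw [← mul_assoc, ph_CZ', mul_assoc]

theorem couple_sumEf (b : ZMod 3) :
    couple (sumEf (pq 0 b)) = ph (pq 0 b) * (ph (pq 0 b) ↟ 1 * CZ (2 * b)) :=
  calc couple (sumEf (pq 0 b))
    _ = (cp * ph (pq 0 b) ↟ 1) * ((cp * ph (pq 0 b)) ↟ 2 * (E (2 * b) * cap) ↟ 1) := by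
      rw [couple, E_two_cap]; simp
    _ = ph (pq 0 b) * (ph (pq 0 b) ↟ 1 * CZ (2 * b)) := by
      rw [ph_comm_cp, ph_comm_cp', CZ_eq, couple]; simp

/-- Up to local phases a gate of weight `2b` is the coupling by `ω^(b(x+y)²)`, and such couplings
add their coefficients by `conv_sumEf`; the local phases cancel. -/
theorem CZ_mul (g h : ZMod 3) : CZ g * CZ h = CZ (g + h) := by
  have key : ∀ b c : ZMod 3, CZ (2 * b) * CZ (2 * c) = CZ (2 * (b + c)) := fun b c => by
    have h := couple_mul (sumEf (pq 0 b)) (sumEf (pq 0 c))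
    rw [conv_sumEf, pq_add, add_zero, couple_sumEf, couple_sumEf, couple_sumEf] at h
    have h0 := ph_pq_mul 0 b 0 c
    rw [add_zero] at h0
    have hl : ∀ x y : M, ph (pq 0 (-(b + c))) * (ph (pq 0 (-(b + c))) ↟ 1 *
        (ph (pq 0 (b + c)) * (ph (pq 0 (b + c)) ↟ 1 * x))) = x := fun x _ => by
      have h1 := ph_cancel' 0 (b + c)
      rw [neg_zero] at h1
      calc _ = (ph (pq 0 (-(b + c))) * ph (pq 0 (b + c))) *
            ((ph (pq 0 (-(b + c))) * ph (pq 0 (b + c))) ↟ 1 * x) := by simp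
        _ = x := by rw [h1, one_shift, one_mul, one_mul]
    have h1 : ph (pq 0 (b + c)) * (ph (pq 0 (b + c)) ↟ 1 * (CZ (2 * b) * CZ (2 * c))) =
        ph (pq 0 (b + c)) * (ph (pq 0 (b + c)) ↟ 1 * CZ (2 * (b + c))) := by
      rw [← h, ← h0]
      simp [ph_CZ_assoc, ph_CZ_assoc']
    rw [← hl (CZ (2 * b) * CZ (2 * c)) 1, h1, hl _ 1]
  -- Every weight has the form `2b` with `b = 2g`, since four is one modulo three.
  have := key (2 * g) (2 * h)
  have h4 : ∀ g : ZMod 3, 2 * (2 * g) = g := by decide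
  rwa [← mul_add, h4, h4, h4] at this

theorem sw_braid : sw * (sw ↟ 1 * sw) = sw ↟ 1 * (sw * sw ↟ 1) := (nat22' sw).symm

theorem sw_couple (f : M) [HasAr f 2 0] (hf : sw * f = f) : sw * couple f = couple f * sw := by
  have h1 : sw ↟ 1 * f = sw * f ↟ 1 := by rw [← nat20' f, sw_sw_assoc]
  have h2 : sw ↟ 1 * f ↟ 1 = f ↟ 1 := by rw [← mul_shift, hf]
  have h3 : sw ↟ 2 * f ↟ 1 = sw ↟ 1 * f ↟ 2 := by
    have := congrArg (· ↟ 1) h1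
    simpa only [mul_shift, shift_shift] using this
  calc sw * couple f = (sw * cp) * (cp ↟ 2 * f ↟ 1) := by simp [couple]
    _ = cp ↟ 1 * (sw * ((sw * cp ↟ 1) ↟ 1 * f ↟ 1)) := by rw [← nat12']; simp
    _ = cp ↟ 1 * (sw * ((cp * (sw ↟ 1 * sw)) ↟ 1 * f ↟ 1)) := by rw [nat12]
    _ = cp ↟ 1 * ((sw * cp ↟ 1) * (sw ↟ 2 * (sw ↟ 1 * f ↟ 1))) := by simp
    _ = cp * (cp ↟ 2 * (sw ↟ 1 * (sw * (sw ↟ 1 * f ↟ 2)))) := by rw [← nat12 cp, h2, h3]; simp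
    _ = cp * (cp ↟ 2 * ((sw * (sw ↟ 1 * sw)) * f ↟ 2)) := by rw [sw_braid]; simp
    _ = cp * (cp ↟ 2 * (sw * ((sw ↟ 1 * f ↟ 2) * sw))) := by simp
    _ = (cp * sw) * ((cp * sw) ↟ 2 * (f ↟ 1 * sw)) := by rw [← h3]; simp
    _ = couple f * sw := by rw [Zs_sw_out, couple]; simp

theorem E_slide_cap_sw (g : ZMod 3) : sw * (E g * cap) = E g * cap :=
  calc sw * (E g * cap) = (E g ↟ 1 * sw) * cap := by rw [nat11' (E g), mul_assoc]
    _ = E g * cap := by rw [mul_assoc, Zs_sw_in, E_slide_cap]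

theorem sw_CZ (g : ZMod 3) : sw * CZ g = CZ g * sw := by
  have : HasAr (E g * cap) 2 0 :=
    HasAr.mul (HasAr.pad (inferInstance : HasAr (E g) 1 1) 1) (inferInstance : HasAr cap 2 0)
  rw [CZ_eq, sw_couple _ (E_slide_cap_sw g)]

/-- On the shared wire the gates meet as a merge followed by a copy, and the Frobenius law exchanges
the two. -/
theorem CZ_comm (g h : ZMod 3) : CZ g * CZ h ↟ 1 = CZ h ↟ 1 * CZ g :=
  calc CZ g * CZ h ↟ 1 = cp * (E g ↟ 1 * ((mg * cp) ↟ 1 * (E h ↟ 2 * mg ↟ 2))) := by simp [CZ]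
    _ = CZ h ↟ 1 * CZ g := by rw [mg_cp']; simp [CZ]

/-- The controlled phase gate between the first and the third of three wires. -/
noncomputable def CZ' (g : ZMod 3) : M := sw * (CZ g ↟ 1 * sw)

theorem CZ'_eq (g : ZMod 3) : CZ' g = cp * (sw ↟ 1 * (E g ↟ 2 * mg ↟ 2)) :=
  calc CZ' g = (sw * cp ↟ 1) * (sw * (E g ↟ 2 * mg ↟ 2)) := by simp [CZ', CZ]
    _ = _ := by rw [← nat12 cp]; simp

theorem CZ_CZ'_comm (g h : ZMod 3) : CZ g * CZ' h = CZ' h * CZ g :=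
  calc CZ g * CZ' h = (CZ g * sw) * (CZ h ↟ 1 * sw) := by simp [CZ']
    _ = sw * (CZ g * CZ h ↟ 1) * sw := by rw [← sw_CZ]; simp only [mul_assoc]
    _ = sw * CZ h ↟ 1 * (CZ g * sw) := by rw [CZ_comm]; simp only [mul_assoc]
    _ = CZ' h * CZ g := by rw [← sw_CZ, CZ']; simp only [mul_assoc]

theorem CZ'_eq' (g : ZMod 3) : CZ' g = sw ↟ 1 * (CZ g * sw ↟ 1) :=
  calc CZ' g = sw ↟ 1 * (sw ↟ 1 * (sw * CZ g ↟ 1)) * sw := by simp [CZ']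
    _ = sw ↟ 1 * (CZ g * sw ↟ 1) := by rw [← nat22]; simp

theorem CZ'_CZ_comm (g h : ZMod 3) : CZ' g * CZ h ↟ 1 = CZ h ↟ 1 * CZ' g :=
  calc CZ' g * CZ h ↟ 1 = sw ↟ 1 * (CZ g * (sw * CZ h) ↟ 1) := by simp [CZ'_eq']
    _ = sw ↟ 1 * ((CZ g * CZ h ↟ 1) * sw ↟ 1) := by rw [sw_CZ]; simp
    _ = (sw * CZ h) ↟ 1 * (CZ g * sw ↟ 1) := by rw [CZ_comm]; simp
    _ = _ := by rw [sw_CZ, CZ'_eq']; simp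

theorem CZ'_mul (g h : ZMod 3) : CZ' g * CZ' h = CZ' (g + h) := by
  simp [CZ', ← CZ_mul]

theorem CZ'_zero : CZ' 0 = 1 := by simp [CZ', CZ_zero]

/-- The controlled phase gate followed by a crossing. -/
noncomputable def T (g : ZMod 3) : M := CZ g * sw

instance (g : ZMod 3) : HasAr (T g) 2 2 :=
  HasAr.mul (inferInstance : HasAr (CZ g) 2 2) (inferInstance : HasAr sw 2 2)

theorem T_T_shift (g h : ZMod 3) : T g ↟ 1 * T h = CZ g ↟ 1 * (CZ' h * (sw ↟ 1 * sw)) :=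
  calc T g ↟ 1 * T h = CZ g ↟ 1 * (sw ↟ 1 * (CZ h * sw)) := by simp [T]
    _ = _ := by simp [CZ'_eq']

/-- Once the crossings are moved to the end, both sides are the same three commuting controlled
phase gates followed by the same permutation of three wires. -/
theorem T_yang_baxter (g h k : ZMod 3) :
    T g * (T h ↟ 1 * T k) = T k ↟ 1 * (T h * T g ↟ 1) :=
  calc T g * (T h ↟ 1 * T k) = CZ g * (sw * (CZ h ↟ 1 * (sw * (CZ k ↟ 1 * (sw * (sw ↟ 1 *
        sw)))))) := by
        rw [T_T_shift, T, CZ']; simp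
    _ = (CZ g * CZ' h) * (CZ k ↟ 1 * (sw * (sw ↟ 1 * sw))) := by simp [CZ']
    _ = CZ' h * (CZ g * CZ k ↟ 1) * (sw * (sw ↟ 1 * sw)) := by
      rw [CZ_CZ'_comm]; simp only [mul_assoc]
    _ = (CZ' h * CZ k ↟ 1) * (CZ g * (sw ↟ 1 * sw)) * sw ↟ 1 := by
      rw [CZ_comm, sw_braid]; simp only [mul_assoc]
    _ = CZ k ↟ 1 * (CZ' h * (sw ↟ 1 * sw)) * (CZ g ↟ 1 * sw ↟ 1) := by
      rw [CZ'_CZ_comm, nat22]; simp only [mul_assoc]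
    _ = T k ↟ 1 * (T h * T g ↟ 1) := by
      rw [mul_assoc, ← mul_assoc (T k ↟ 1), T_T_shift]; simp [T]

/-! ### Controlled shifts -/

/-- The gate sending `|y, z⟩` to `|y, z - t y⟩`. -/
noncomputable def V (t : ZMod 3) : M := Hi ↟ 1 * (CZ t * Hd ↟ 1)

instance (t : ZMod 3) : HasAr (V t) 2 2 :=
  have h : HasAr Hd 1 1 := inferInstance
  have h' : HasAr Hi 1 1 := inferInstance
  HasAr.mul (h'.shift 1) (HasAr.mul (inferInstance : HasAr (CZ t) 2 2) (h.shift 1))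

theorem V_zero : V 0 = 1 := by simp [V, CZ_zero]

theorem V_mul (s t : ZMod 3) : V s * V t = V (s + t) := by simp [V, ← CZ_mul]

theorem E_red (g : ZMod 3) : E g * (Hd * ef) = ef := by
  rcases zmod3_cases g with rfl | rfl | rfl
  · rw [E_zero, mul_assoc]
    have := red_Zs 0
    rw [this, mul_one]
  · exact dual_ef
  · exact Hi_Hd_assoc _

/-- The green effect sums over the second label and does not see its translation by a multiple of
the first. -/
theorem V_ef (t : ZMod 3) : V t * ef ↟ 1 = ef ↟ 1 :=
  calc V t * ef ↟ 1 = Hi ↟ 1 * (cp * (E t * (mg * (Hd * ef))) ↟ 1) := by simp [V, CZ]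
    _ = cp * (Hi ↟ 2 * (E t ↟ 1 * (Hd ↟ 2 * (ef ↟ 2 * (Hd ↟ 1 * ef ↟ 1))))) := by
      rw [mg_red]; simp
    _ = cp * (Hi ↟ 2 * (Hd ↟ 2 * (ef ↟ 2 * (E t * (Hd * ef)) ↟ 1))) := by simp
    _ = cp * ef ↟ 1 * ef ↟ 1 := by rw [E_red]; simp
    _ = ef ↟ 1 := by rw [cp_ef, one_mul]

theorem V_two : V 2 = cp * Xs 2 1 0 ↟ 1 := by
  rw [Xs_two_one]; simp [V, CZ, E_two]

/-- For `t = 2` the controlled shift is the red addition `z ↦ z + y`, and the claim is `ω^((z+y)w) =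
ω^(zw) ω^(yw)`. The bialgebra rule copies the sum, and colour change splits the copy that meets `w`
into two edges. -/
theorem V_CZ_core : V 2 * CZ 1 ↟ 1 = CZ 1 ↟ 1 * (CZ' 1 * V 2) := by
  have hX : Xs 2 1 0 * Hd = Hd * (Hd ↟ 1 * mg) := by rw [Xs_two_one']; simp
  have hmg : mg ↟ 3 * mg ↟ 2 = mg ↟ 2 * mg ↟ 2 := by
    have := congrArg (· ↟ 2) mg_mg
    simpa only [mul_shift, shift_shift] using this
  calc V 2 * CZ 1 ↟ 1
    _ = cp * ((Xs 2 1 0 * cp) ↟ 1 * (Hd ↟ 2 * mg ↟ 2)) := by rw [V_two, CZ, E_one]; simp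
    _ = cp * (cp ↟ 1 * (cp ↟ 3 * (sw ↟ 2 * (Xs 2 1 0 ↟ 1 * ((Xs 2 1 0 * Hd) ↟ 2 * mg ↟ 2))))) := by
      rw [← bialgebra]; simp
    _ = cp * (cp ↟ 1 * (cp ↟ 3 * (sw ↟ 2 * (Xs 2 1 0 ↟ 1 * (Hd ↟ 2 * (Hd ↟ 3 *
          (mg ↟ 3 * mg ↟ 2))))))) := by rw [hX, hmg]; simp
    _ = (cp * cp ↟ 1) * (cp ↟ 3 * (sw ↟ 2 * (Xs 2 1 0 ↟ 1 * ((Hd * mg) ↟ 3 * (Hd * mg) ↟ 2)))) := by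
      simp
    _ = cp * cp * (cp ↟ 3 * (sw ↟ 2 * (Xs 2 1 0 ↟ 1 * ((Hd * mg) ↟ 3 * (Hd * mg) ↟ 2)))) := by
      rw [cp_cp]
    _ = CZ 1 ↟ 1 * (CZ' 1 * V 2) := by rw [V_two, CZ'_eq, CZ, E_one]; simp

theorem V_CZ'_comm (t g : ZMod 3) : V t * CZ' g = CZ' g * V t := by
  have h1 : ∀ (x : M) [HasAr x 1 1], x ↟ 1 * CZ' g = CZ' g * x ↟ 1 := fun x _ =>
    calc x ↟ 1 * CZ' g = (x ↟ 1 * sw) * (CZ g ↟ 1 * sw) := by simp [CZ']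
      _ = sw * (CZ g ↟ 1 * (x * sw)) := by rw [nat11']; simp
      _ = CZ' g * x ↟ 1 := by rw [nat11, CZ']; simp
  calc V t * CZ' g = Hi ↟ 1 * (CZ t * (Hd ↟ 1 * CZ' g)) := by simp [V]
    _ = Hi ↟ 1 * ((CZ t * CZ' g) * Hd ↟ 1) := by rw [h1 Hd]; simp only [mul_assoc]
    _ = (Hi ↟ 1 * CZ' g) * (CZ t * Hd ↟ 1) := by rw [CZ_CZ'_comm]; simp only [mul_assoc]
    _ = CZ' g * V t := by rw [h1 Hi, V]; simp only [mul_assoc]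

/-- The relation persists under addition in `t` and in `g`, because shifts and gates compose
additively. Hence `V_CZ_core`, the case `t = 2`, `g = 1`, gives all others. -/
theorem V_CZ (t g : ZMod 3) : V t * CZ g ↟ 1 = CZ g ↟ 1 * (CZ' (-(t * g)) * V t) := by
  have zero : ∀ t, V t * CZ 0 ↟ 1 = CZ 0 ↟ 1 * (CZ' (-(t * 0)) * V t) := fun t => by
    simp [CZ_zero, CZ'_zero]
  have addg : ∀ t g h, V t * CZ g ↟ 1 = CZ g ↟ 1 * (CZ' (-(t * g)) * V t) →
      V t * CZ h ↟ 1 = CZ h ↟ 1 * (CZ' (-(t * h)) * V t) →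
      V t * CZ (g + h) ↟ 1 = CZ (g + h) ↟ 1 * (CZ' (-(t * (g + h))) * V t) := fun t g h hg hh =>
    calc V t * CZ (g + h) ↟ 1 = V t * CZ g ↟ 1 * CZ h ↟ 1 := by
          rw [← CZ_mul, mul_shift, mul_assoc]
      _ = CZ g ↟ 1 * (CZ' (-(t * g)) * CZ h ↟ 1) * (CZ' (-(t * h)) * V t) := by
        rw [hg, mul_assoc, mul_assoc, hh]; simp only [mul_assoc]
      _ = (CZ g * CZ h) ↟ 1 * ((CZ' (-(t * g)) * CZ' (-(t * h))) * V t) := by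
        rw [CZ'_CZ_comm, mul_shift]; simp only [mul_assoc]
      _ = _ := by rw [CZ_mul, CZ'_mul, mul_add, neg_add]
  have addt : ∀ s t g, V s * CZ g ↟ 1 = CZ g ↟ 1 * (CZ' (-(s * g)) * V s) →
      V t * CZ g ↟ 1 = CZ g ↟ 1 * (CZ' (-(t * g)) * V t) →
      V (s + t) * CZ g ↟ 1 = CZ g ↟ 1 * (CZ' (-((s + t) * g)) * V (s + t)) := fun s t g hs ht =>
    calc V (s + t) * CZ g ↟ 1 = V s * (V t * CZ g ↟ 1) := by rw [← V_mul, mul_assoc]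
      _ = V s * CZ g ↟ 1 * (CZ' (-(t * g)) * V t) := by rw [ht, mul_assoc]
      _ = CZ g ↟ 1 * (CZ' (-(s * g)) * ((V s * CZ' (-(t * g))) * V t)) := by
        rw [hs]; simp only [mul_assoc]
      _ = CZ g ↟ 1 * ((CZ' (-(s * g)) * CZ' (-(t * g))) * (V s * V t)) := by
        rw [V_CZ'_comm]; simp only [mul_assoc]
      _ = _ := by rw [V_mul, CZ'_mul, add_mul, neg_add]
  have h1 : V 2 * CZ 1 ↟ 1 = CZ 1 ↟ 1 * (CZ' (-(2 * 1)) * V 2) := V_CZ_core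
  have h2 : V 2 * CZ 2 ↟ 1 = CZ 2 ↟ 1 * (CZ' (-(2 * 2)) * V 2) := addg 2 1 1 h1 h1
  rcases zmod3_cases t with rfl | rfl | rfl
  · simp [V_zero, CZ'_zero]
  · rcases zmod3_cases g with rfl | rfl | rfl
    · exact zero _
    · exact addt 2 2 1 h1 h1
    · exact addt 2 2 2 h2 h2
  · rcases zmod3_cases g with rfl | rfl | rfl
    · exact zero _
    · exact h1
    · exact h2

/-- `V_CZ` in the form that `sweep` needs: a third wire crosses both wires of the shift and is
coupled to each of them. -/
theorem V_T_T (t g h : ZMod 3) :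
    V t * (T g ↟ 1 * T h) = T g ↟ 1 * (T (h - t * g) * V t ↟ 1) :=
  calc V t * (T g ↟ 1 * T h) = (V t * CZ g ↟ 1) * (CZ' h * (sw ↟ 1 * sw)) := by
        rw [T_T_shift]; simp only [mul_assoc]
    _ = CZ g ↟ 1 * (CZ' (-(t * g)) * ((V t * CZ' h) * (sw ↟ 1 * sw))) := by
      rw [V_CZ]; simp only [mul_assoc]
    _ = CZ g ↟ 1 * ((CZ' (-(t * g)) * CZ' h) * (V t * (sw ↟ 1 * sw))) := by
      rw [V_CZ'_comm]; simp only [mul_assoc]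
    _ = CZ g ↟ 1 * (CZ' (h - t * g) * (sw ↟ 1 * sw)) * V t ↟ 1 := by
      rw [CZ'_mul, nat22, neg_add_eq_sub]; simp only [mul_assoc]
    _ = _ := by rw [← T_T_shift]; simp only [mul_assoc]

theorem E_Px (t a : ZMod 3) (ht : t ≠ 0) :
    E t * Px (-a) = ph (pq (a * t) 0) * E t := by
  rcases zmod3_cases t with rfl | rfl | rfl
  · exact absurd rfl ht
  · rw [E_one, Px, mul_one]
    have := ph_dual_pq a 0
    calc Hd * (Hd * (ph (pq (-a) 0) * Hi)) = (Hd * (Hd * ph (pq (-a) 0))) * Hi := by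
          simp only [mul_assoc]
      _ = _ := by rw [← this]; simp
  · rw [E_two, Px, Hi_Hd_assoc, show a * 2 = -a by
      rw [show (2 : ZMod 3) = -1 by decide]; ring]

/-- Substituting `z + ty` in `az + bz²` gives `(aty + bt²y²) + 2btyz + (az + bz²)`. The linear part
of the phase is treated as a shift operator, the quadratic part by the Euler decomposition. -/
theorem V_node (a b t : ZMod 3) (hb : b ≠ 0) :
    E t * (Zs 0 1 (pq a b) ↟ 1 * (Hi ↟ 1 * (mg * Hd))) =
      ph (pq (a * t) (b * t ^ 2)) * (E (2 * b * t) * ph (pq a b)) := by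
  have hun : ∀ p, Zs 0 1 p = un * ph p := fun p => by
    rw [Zs_mul_ph, zero_add p]
  have hs : un * (ph (pq 0 b) * Hi) = un * ph (pq 0 (2 * b)) := by
    rcases zmod3_cases b with rfl | rfl | rfl
    · exact absurd rfl hb
    · exact un_one_Hi
    · exact un_two_Hi
  have hp : ∀ c, (Zs 0 1 (pq 0 c) ↟ 1) * mg = ph (pq 0 c) := fun c => by
    rw [hun, mul_shift, mul_assoc, ph_comm_mg', ← mul_assoc, un_mg', one_mul]
  by_cases ht : t = 0
  · subst ht
    calc E 0 * (Zs 0 1 (pq a b) ↟ 1 * (Hi ↟ 1 * (mg * Hd)))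
      _ = ef * ((un * (Zs 0 1 (pq a b) * Hi) ↟ 1) * (mg * Hd)) := by
        rw [E_zero]; simp only [mul_assoc, mul_shift]
      _ = ef * ((Zs 0 1 (pq a b) * Hi) * ((un * mg) * Hd)) := by
        rw [HasAr.comm (x := un) inferInstance, shift_zero]; simp only [mul_assoc]
      _ = E 0 * ph (pq a b) := by rw [un_mg, hun, E_zero]; simp
      _ = _ := by simp [ph_pq_zero]
  · calc E t * (Zs 0 1 (pq a b) ↟ 1 * (Hi ↟ 1 * (mg * Hd)))
      _ = E t * ((un * (ph (pq 0 b) * Hi)) ↟ 1 * ((Px a ↟ 1 * mg) * Hd)) := by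
        have := ph_pq_mul 0 b a 0
        rw [zero_add, add_zero] at this
        rw [hun, ← this, Px]; simp
      _ = E t * Px (-a) * ((Zs 0 1 (pq 0 (2 * b)) ↟ 1 * mg) * (Px a * Hd)) := by
        rw [hs, Px_mg, hun (pq 0 (2 * b))]; simp
      _ = ph (pq (a * t) 0) * (E t * (ph (pq 0 (2 * b)) * Hd)) * ph (pq a 0) := by
        rw [hp, E_Px t a ht, Px]; simp only [mul_assoc, Hi_Hd, mul_one]
      _ = (ph (pq (a * t) 0) * ph (pq 0 (b * t ^ 2))) *
          (E (2 * b * t) * (ph (pq 0 b) * ph (pq a 0))) := by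
        rw [E_ph_Hd hb t ht]; simp only [mul_assoc]
      _ = _ := by rw [ph_pq_mul, ph_pq_mul, zero_add, zero_add, add_zero, add_zero]

/-- A shift aimed at a fresh node with quadratic coefficient `b ≠ 0` can be exchanged for an edge of
weight `2bt` and a phase on the control. Read from right to left, this removes edges. -/
theorem Zs_Zs_V (a b t : ZMod 3) (p : Ph) (hb : b ≠ 0) :
    Zs 0 1 (pq a b) * (Zs 0 1 p * V t) =
      Zs 0 1 (pq a b) * (Zs 0 1 (p + pq (a * t) (b * t ^ 2)) * CZ (2 * b * t)) :=
  calc Zs 0 1 (pq a b) * (Zs 0 1 p * V t)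
    _ = Zs 0 1 p * (Zs 0 1 (pq a b) ↟ 1 * V t) := by simp
    _ = Zs 0 1 p * (cp * (E t * (Zs 0 1 (pq a b) ↟ 1 * (Hi ↟ 1 * (mg * Hd)))) ↟ 1) := by
      simp [V, CZ]
    _ = Zs 0 1 p * ((cp * ph (pq (a * t) (b * t ^ 2)) ↟ 1) *
          (E (2 * b * t) * ((Zs 0 1 (pq a b)) ↟ 1 * mg)) ↟ 1) := by
      rw [V_node a b t hb]
      have : Zs 0 1 (pq a b) ↟ 1 * mg = ph (pq a b) := by
        have h : un * ph (pq a b) = Zs 0 1 (pq a b) := by rw [Zs_mul_ph, zero_add (pq a b)]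
        rw [← h, mul_shift, mul_assoc, ph_comm_mg', ← mul_assoc, un_mg', one_mul]
      rw [this]; simp
    _ = Zs 0 1 (p + pq (a * t) (b * t ^ 2)) * (Zs 0 1 (pq a b) ↟ 1 * CZ (2 * b * t)) := by
      rw [ph_comm_cp, ← Zs_mul_ph 0 p]; simp [CZ]
    _ = _ := by simp

/-! ### Rows of controlled phase gates -/

theorem HasAr.far {x : M} {a b : ℕ} (hx : HasAr x a b) (y : M) {i j : ℕ} (h : b ≤ i)
    (hj : j + b = i + a) : x * y ↟ i = y ↟ j * x := hx.slide y (i - b) (by omega) (by omega)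

theorem HasAr.far_shift {x : M} {a b : ℕ} (hx : HasAr x a b) (y : M) (p : ℕ) {i j : ℕ}
    (h : b + p ≤ i) (hj : j + b = i + a) : x ↟ p * y ↟ i = y ↟ j * x ↟ p :=
  hx.slide_shift y p (i - (b + p)) (by omega) (by omega)

/-- The wire at position `0` is coupled to the following `k` wires with weights `g` and moved
across them. -/
noncomputable def row : ℕ → (ℕ → ZMod 3) → M
  | 0, _ => 1
  | k + 1, g => row k g * T (g k) ↟ k

theorem row_zero (g : ℕ → ZMod 3) : row 0 g = 1 := rfl

theorem row_succ (k : ℕ) (g : ℕ → ZMod 3) : row (k + 1) g = row k g * T (g k) ↟ k := rfl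

instance hasAr_row (k : ℕ) (g : ℕ → ZMod 3) : HasAr (row k g) (k + 1) (k + 1) := by
  induction k with
  | zero => exact hasAr_one 1
  | succ k ih =>
    have h : HasAr (T (g k)) 2 2 := inferInstance
    exact (ih.pad 1).mul (h.shift k)

theorem row_congr {k : ℕ} {g g' : ℕ → ZMod 3} (h : ∀ i < k, g i = g' i) : row k g = row k g' := by
  induction k with
  | zero => rfl
  | succ k ih => rw [row_succ, row_succ, ih fun i hi => h i (by omega), h k (by omega)]

/-- Two wires moved across `k` wires; a gate on the two wires is pulled through. -/
theorem sweep (U : M) {k : ℕ} {g h g' h' : ℕ → ZMod 3}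
    (H : ∀ i < k, U * (T (h i) ↟ 1 * T (g i)) = T (h' i) ↟ 1 * (T (g' i) * U ↟ 1)) :
    U * (row k h ↟ 1 * row k g) = row k h' ↟ 1 * (row k g' * U ↟ k) := by
  induction k with
  | zero => simp [row_zero]
  | succ k ih =>
    -- The last crossing of one wire does not touch the earlier crossings of the other, so the pair
    -- of rows is extended by a pair of crossings.
    have hs : ∀ g h : ℕ → ZMod 3, row (k + 1) h ↟ 1 * row (k + 1) g =
        row k h ↟ 1 * row k g * (T (h k) ↟ (k + 1) * T (g k) ↟ k) := fun g h => by
      have := (hasAr_row k g).far (T (h k)) (i := k + 1) (j := k + 1) le_rfl rfl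
      calc row (k + 1) h ↟ 1 * row (k + 1) g
          = row k h ↟ 1 * (T (h k) ↟ (k + 1) * row k g) * T (g k) ↟ k := by
            simp only [row_succ, mul_shift, shift_shift, mul_assoc]
        _ = _ := by rw [← this]; simp only [mul_assoc]
    have hk := congrArg (· ↟ k) (H k (by omega))
    simp only [mul_shift, shift_shift, Nat.add_comm 1 k] at hk
    rw [hs, ← mul_assoc U, ih fun i hi => H i (by omega), mul_assoc, mul_assoc, hk, row_succ,
      row_succ, mul_shift, shift_shift]
    have := (hasAr_row k g').far (T (h' k)) (i := k + 1) (j := k + 1) le_rfl rfl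
    rw [← mul_assoc (row k g'), this]
    simp only [mul_assoc]

theorem T_zero : T 0 = sw := by rw [T, CZ_zero, one_mul]

theorem sweep_sw (k : ℕ) (g h : ℕ → ZMod 3) :
    sw * (row k h ↟ 1 * row k g) = row k g ↟ 1 * (row k h * sw ↟ k) :=
  sweep sw fun i _ => by rw [← T_zero, T_yang_baxter]

theorem CZ_T_T (c g h : ZMod 3) : CZ c * (T h ↟ 1 * T g) = T h ↟ 1 * (T g * CZ c ↟ 1) := by
  have hT : T c * sw = CZ c := by rw [T, mul_assoc, sw_sw, mul_one]
  calc CZ c * (T h ↟ 1 * T g) = T c * (sw * (T h ↟ 1 * T g)) := by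
        rw [← hT, mul_assoc]
    _ = (T c * (T g ↟ 1 * T h)) * sw ↟ 1 := by
      rw [← T_zero, T_yang_baxter]; simp only [mul_assoc]
    _ = T h ↟ 1 * (T g * (T c * sw) ↟ 1) := by
      rw [T_yang_baxter]; simp only [mul_assoc, mul_shift]
    _ = _ := by rw [hT]

theorem sweep_CZ (c : ZMod 3) (k : ℕ) (g h : ℕ → ZMod 3) :
    CZ c * (row k h ↟ 1 * row k g) = row k h ↟ 1 * (row k g * CZ c ↟ k) :=
  sweep (CZ c) fun _ _ => CZ_T_T c _ _

theorem sweep_V (t : ZMod 3) (k : ℕ) (g h : ℕ → ZMod 3) :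
    V t * (row k h ↟ 1 * row k g) =
      row k h ↟ 1 * (row k (fun i => g i - t * h i) * V t ↟ k) :=
  sweep (V t) fun _ _ => V_T_T t _ _

/-- Exchanging two of the older wires exchanges their weights: the Yang–Baxter relation with one
weight zero. -/
theorem row_sw (i k : ℕ) (h : i + 2 ≤ k) (g : ℕ → ZMod 3) :
    row k g * sw ↟ i = sw ↟ (i + 1) * row k (g ∘ Equiv.swap i (i + 1)) := by
  induction k, h using Nat.le_induction with
  | base =>
    have hg : row i (g ∘ Equiv.swap i (i + 1)) = row i g := row_congr fun j hj => by
      rw [Function.comp, Equiv.swap_apply_of_ne_of_ne (by omega) (by omega)]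
    have hy := congrArg (· ↟ i) (T_yang_baxter (g i) (g (i + 1)) 0)
    simp only [T_zero, mul_shift, shift_shift, Nat.add_comm 1 i] at hy
    have hc := (hasAr_row i g).far sw (i := i + 1) (j := i + 1) le_rfl rfl
    rw [row_succ, row_succ, row_succ, row_succ, hg]
    simp only [Function.comp, Equiv.swap_apply_left, Equiv.swap_apply_right]
    rw [mul_assoc, mul_assoc, hy, ← mul_assoc, hc]
    simp only [mul_assoc]
  | succ k hk ih =>
    have hT : HasAr (T (g k)) 2 2 := inferInstance
    have hsw : HasAr sw 2 2 := inferInstance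
    have hc := hsw.far_shift (T (g k)) i (i := k) (j := k) (by omega) rfl
    rw [row_succ, row_succ, mul_assoc, ← hc, ← mul_assoc, ih, mul_assoc, Function.comp,
      Equiv.swap_apply_of_ne_of_ne (by omega) (by omega)]

/-- The two newest vertices are interchanged. Their common edge `g k` belongs to the row of the
later vertex, so it passes from one row to the other. -/
theorem row_sw_row (k : ℕ) (g h : ℕ → ZMod 3) (p q : Ph) :
    Zs 0 1 q * (row k h * (Zs 0 1 p * (row (k + 1) g * sw ↟ k))) =
      Zs 0 1 p * (row k g * (Zs 0 1 q * row (k + 1) (Function.update h k (g k)))) := by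
  have hp : HasAr (Zs 0 1 p) 0 1 := inferInstance
  have hq : HasAr (Zs 0 1 q) 0 1 := inferInstance
  have h1 : Zs 0 1 q * Zs 0 1 p = Zs 0 1 p * (Zs 0 1 q * sw) := by
    rw [nat01, hp.comm, shift_zero]
  have h2 : sw * (T (g k) * sw) = T (g k) := by
    rw [T, mul_assoc, sw_sw, mul_one, sw_CZ]
  have h3 := congrArg (· ↟ k) h2
  simp only [mul_shift] at h3
  have h4 := hp.comm (row k h)
  have h5 := hq.comm (row k g)
  rw [shift_zero] at h4 h5
  calc Zs 0 1 q * (row k h * (Zs 0 1 p * (row (k + 1) g * sw ↟ k)))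
    _ = Zs 0 1 q * ((Zs 0 1 p * row k h ↟ 1) * (row k g * (T (g k) ↟ k * sw ↟ k))) := by
      rw [h4, row_succ]; simp only [mul_assoc]
    _ = (Zs 0 1 q * Zs 0 1 p) * (row k h ↟ 1 * row k g) * (T (g k) ↟ k * sw ↟ k) := by
      simp only [mul_assoc]
    _ = Zs 0 1 p * (Zs 0 1 q * ((sw * (row k h ↟ 1 * row k g)) * (T (g k) ↟ k * sw ↟ k))) := by
      rw [h1]; simp only [mul_assoc]
    _ = Zs 0 1 p * ((Zs 0 1 q * row k g ↟ 1) * (row k h * (sw ↟ k * (T (g k) ↟ k * sw ↟ k)))) := by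
      rw [sweep_sw]; simp only [mul_assoc]
    _ = _ := by
      rw [h3, h5, row_succ, Function.update_self,
        row_congr (g := Function.update h k (g k)) (g' := h) fun i hi =>
          Function.update_of_ne (by omega) _ _]
      simp only [mul_assoc]

/-! ### Graphs with stabilizer phases -/

/-- Graph state diagrams followed by stabilizer phases. -/
inductive Gr : ℕ → M → Prop
  | zero : Gr 0 1
  | succ {k : ℕ} {S : M} (a b : ZMod 3) (g : ℕ → ZMod 3) (hS : Gr k S) :
      Gr (k + 1) (S * (Zs 0 1 (pq a b) * row k g))

theorem Gr.inv {k : ℕ} {S : M} (h : Gr (k + 1) S) : ∃ S' a b g, Gr k S' ∧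
    S = S' * (Zs 0 1 (pq a b) * row k g) := by
  cases h with
  | succ a b g hS => exact ⟨_, a, b, g, hS, rfl⟩

theorem Gr.sw {k : ℕ} {S : M} (hS : Gr k S) (i : ℕ) (hi : i + 2 ≤ k) : Gr k (S * sw ↟ i) := by
  induction hS with
  | zero => omega
  | @succ k S a b g hS ih =>
    have hp : HasAr (Zs 0 1 (pq a b)) 0 1 := inferInstance
    rcases Nat.lt_or_ge (i + 1) k with h | h
    · have h1 : Zs 0 1 (pq a b) * QutritZX.sw ↟ (i + 1) = QutritZX.sw ↟ i * Zs 0 1 (pq a b) :=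
        hp.far _ (by omega) (by omega)
      have := Gr.succ a b (g ∘ Equiv.swap i (i + 1)) (ih (by omega))
      rwa [mul_assoc S, ← mul_assoc (QutritZX.sw ↟ i), ← h1, mul_assoc, ← row_sw i k (by omega),
        ← mul_assoc (Zs 0 1 (pq a b)), ← mul_assoc S] at this
    · obtain rfl : k = i + 1 := by omega
      obtain ⟨S', a', b', g', hS', rfl⟩ := hS.inv
      have := Gr.succ a' b' (Function.update g' i (g i)) (Gr.succ a b g hS')
      simp only [mul_assoc] at this ⊢
      rwa [row_sw_row]

theorem row_ph (k : ℕ) (g : ℕ → ZMod 3) (p : Ph) : row k g * ph p ↟ k = ph p * row k g := by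
  induction k with
  | zero => rw [row_zero, one_mul, mul_one, shift_zero]
  | succ k ih =>
    have h1 : T (g k) * ph p ↟ 1 = ph p * T (g k) := by
      rw [T, mul_assoc, ← nat11, ← mul_assoc, ph_CZ, mul_assoc]
    have h2 := congrArg (· ↟ k) h1
    simp only [mul_shift, shift_shift, Nat.add_comm 1 k] at h2
    rw [row_succ, mul_assoc, h2, ← mul_assoc, ih, mul_assoc]

theorem row_ph' (i k : ℕ) (hi : i < k) (g : ℕ → ZMod 3) (p : Ph) :
    row k g * ph p ↟ i = ph p ↟ (i + 1) * row k g := by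
  induction k, hi using Nat.le_induction with
  | base =>
    have h1 : T (g i) * ph p = ph p ↟ 1 * T (g i) := by
      rw [T, mul_assoc, ← nat11', ← mul_assoc, ph_CZ', mul_assoc]
    have h2 := congrArg (· ↟ i) h1
    simp only [mul_shift, shift_shift, Nat.add_comm 1 i] at h2
    rw [row_succ, mul_assoc, h2, ← mul_assoc, (hasAr_row i g).far (ph p) le_rfl rfl, mul_assoc]
  | succ k hk ih =>
    have hph : HasAr (ph p) 1 1 := inferInstance
    rw [row_succ, mul_assoc, ← hph.far_shift (T (g k)) i (i := k) (j := k) (by omega) rfl,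
      ← mul_assoc, ih, mul_assoc]

theorem Gr.ph {k : ℕ} {S : M} (hS : Gr k S) (i : ℕ) (hi : i < k) (a b : ZMod 3) :
    Gr k (S * Zs 1 1 (pq a b) ↟ i) := by
  induction hS with
  | zero => omega
  | @succ k S a' b' g hS ih =>
    have hp : HasAr (Zs 0 1 (pq a' b')) 0 1 := inferInstance
    rcases Nat.lt_or_ge i k with h | h
    · have h1 : Zs 0 1 (pq a' b') * Zs 1 1 (pq a b) ↟ (i + 1) =
          Zs 1 1 (pq a b) ↟ i * Zs 0 1 (pq a' b') := hp.far _ (by omega) (by omega)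
      have := Gr.succ a' b' g (ih h)
      rwa [mul_assoc S, ← mul_assoc (Zs 1 1 (pq a b) ↟ i), ← h1, mul_assoc, ← row_ph' i k h,
        ← mul_assoc (Zs 0 1 (pq a' b')), ← mul_assoc S] at this
    · obtain rfl : i = k := by omega
      have := Gr.succ (a' + a) (b' + b) g hS
      rwa [← pq_add, ← Zs_mul_ph, mul_assoc, ← row_ph, ← mul_assoc (Zs 0 1 (pq a' b')),
        ← mul_assoc S] at this

theorem Gr.CZ {k : ℕ} {S : M} (hS : Gr (k + 2) S) (c : ZMod 3) : Gr (k + 2) (S * CZ c ↟ k) := by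
  obtain ⟨S, a, b, g, hS', rfl⟩ := hS.inv
  have := Gr.succ a b (Function.update g k (g k + c)) hS'
  have h1 : row (k + 1) (Function.update g k (g k + c)) = row (k + 1) g * QutritZX.CZ c ↟ k := by
    rw [row_succ, Function.update_self, row_congr (g' := g) fun i hi =>
          Function.update_of_ne (by omega) _ _, row_succ, mul_assoc, ← mul_shift, T, T, mul_assoc,
          sw_CZ, ← mul_assoc, CZ_mul]
  rwa [h1, ← mul_assoc (Zs 0 1 (pq a b)), ← mul_assoc S] at this

theorem Zs_row (p : Ph) (k : ℕ) : Zs 0 1 p * row k 0 = Zs 0 1 p ↟ k := by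
  induction k with
  | zero => rw [row_zero, mul_one, shift_zero]
  | succ k ih =>
    rw [row_succ, ← mul_assoc, ih, Pi.zero_apply, T_zero, ← mul_shift, nat01, shift_shift,
      Nat.add_comm]

theorem Gr.un {k : ℕ} {S : M} (hS : Gr k S) : Gr (k + 1) (S * un ↟ k) := by
  have := Gr.succ 0 0 0 hS
  rwa [pq_zero, Zs_row] at this

/-! ### Every stabilizer state diagram is a graph with some vertices projected out -/

/-- A graph with stabilizer phases, some of its vertices being closed by green effects. -/
def FA (n : ℕ) (x : M) : Prop := ∃ m S, Gr (m + n) S ∧ x = S * ef ^ m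

theorem hasAr_ef_pow (m : ℕ) : HasAr (ef ^ m) m 0 := by
  induction m with
  | zero => exact hasAr_one 0
  | succ m ih =>
    rw [pow_succ]
    exact ((ih.pad 1).congr rfl (Nat.zero_add 1)).mul inferInstance

theorem ef_pow_shift (m : ℕ) (y : M) (c : ℕ) : ef ^ m * y ↟ c = y ↟ (c + m) * ef ^ m :=
  (hasAr_ef_pow m).far y (Nat.zero_le c) rfl

/-- The `m` closed wires stand in front; an operation after the closings is moved before them and
then acts `m` places further to the right. -/
theorem FA.map {n n' c : ℕ} {x y : M} (hx : FA n x)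
    (h : ∀ m S, Gr (m + n) S → Gr (m + n') (S * y ↟ (c + m))) : FA n' (x * y ↟ c) := by
  obtain ⟨m, S, hS, rfl⟩ := hx
  exact ⟨m, _, h m S hS, by rw [mul_assoc, ef_pow_shift, mul_assoc]⟩

theorem FA.sw {n : ℕ} {x : M} (hx : FA n x) (i : ℕ) (hi : i + 2 ≤ n) : FA n (x * sw ↟ i) :=
  hx.map fun _ _ hS => hS.sw _ (by omega)

theorem FA.ph {n : ℕ} {x : M} (hx : FA n x) (i : ℕ) (hi : i < n) (a b : ZMod 3) :
    FA n (x * Zs 1 1 (pq a b) ↟ i) :=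
  hx.map fun _ _ hS => hS.ph _ (by omega) a b

theorem FA.CZ {n : ℕ} {x : M} (hx : FA (n + 2) x) (c : ZMod 3) : FA (n + 2) (x * CZ c ↟ n) :=
  hx.map fun m S hS => by rw [Nat.add_comm n m]; exact Gr.CZ (k := m + n) hS c

theorem FA.un {n : ℕ} {x : M} (hx : FA n x) : FA (n + 1) (x * un ↟ n) :=
  hx.map fun m S hS => by rw [Nat.add_comm n m]; exact Gr.un (k := m + n) hS

theorem ef_shift_succ (i : ℕ) : ef ↟ (i + 1) = sw ↟ i * ef ↟ i := by
  rw [← mul_shift, nat10', shift_shift, Nat.add_comm]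

theorem Gr.ef {k : ℕ} (i : ℕ) {S : M} (hS : Gr (k + 1) S) (hi : i ≤ k) :
    ∃ S', Gr (k + 1) S' ∧ S * ef ↟ i = S' * ef := by
  induction i generalizing S with
  | zero => exact ⟨S, hS, by rw [shift_zero]⟩
  | succ i ih =>
    obtain ⟨S', h, h'⟩ := ih (hS.sw i (by omega)) (by omega)
    exact ⟨S', h, by rw [ef_shift_succ, ← mul_assoc, h']⟩

theorem FA.ef {n : ℕ} {x : M} (hx : FA (n + 1) x) : FA n (x * ef ↟ n) := by
  obtain ⟨m, S, hS, rfl⟩ := hx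
  obtain ⟨S', h, h'⟩ := Gr.ef (k := m + n) (n + m) hS (by omega)
  refine ⟨m + 1, S', ?_, ?_⟩
  · rwa [show m + 1 + n = m + n + 1 by omega]
  · rw [mul_assoc, ef_pow_shift, ← mul_assoc, h', pow_succ', mul_assoc]

/-- Postcomposition with `x` on the last `a` wires preserves graphs with closed vertices. -/
def Pr (x : M) (a b : ℕ) : Prop := ∀ c S, FA (c + a) S → FA (c + b) (S * x ↟ c)

theorem Pr.one (n : ℕ) : Pr 1 n n := fun c S h => by rwa [one_shift, mul_one]

theorem Pr.mul {x y : M} {a b c : ℕ} (hx : Pr x a b) (hy : Pr y b c) : Pr (x * y) a c :=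
  fun d S h => by
    rw [mul_shift, ← mul_assoc]
    exact hy d _ (hx d S h)

theorem Pr.shift {x : M} {a b : ℕ} (hx : Pr x a b) (i : ℕ) : Pr (x ↟ i) (i + a) (i + b) :=
  fun c S h => by
    rw [shift_shift, Nat.add_comm i c, ← Nat.add_assoc]
    exact hx (c + i) S (by rwa [Nat.add_assoc])

theorem FA.sw_iff {n : ℕ} {x : M} (i : ℕ) (hi : i + 2 ≤ n) : FA n (x * QutritZX.sw ↟ i) ↔ FA n x :=
  ⟨fun h => by simpa using h.sw i hi, fun h => h.sw i hi⟩

theorem FA.ltf_iff {n : ℕ} {x : M} (b c : ℕ) (h : c + b + 1 ≤ n) :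
    FA n (x * ι (lastToFront b) ↟ c) ↔ FA n x := by
  induction b generalizing x with
  | zero => rw [ι_ltf_zero, one_shift, mul_one]
  | succ b ih =>
    rw [ι_ltf_succ, mul_shift, ← mul_assoc, ih (by omega), shift_shift, FA.sw_iff _ (by omega)]

/-- A wire to the right of the box is carried to its left, where any number of wires is allowed, and
carried back afterwards. -/
theorem Pr.pad {x : M} {a b : ℕ} (hx : Pr x a b) (h : HasAr x a b) (d : ℕ) :
    Pr x (a + d) (b + d) := by
  induction d with
  | zero => exact hx
  | succ d ih =>
    intro c S hS
    obtain ⟨D, rfl⟩ := h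
    rw [← FA.ltf_iff b c (by omega), mul_assoc, ← mul_shift, ltf_natural D, mul_shift, ← mul_assoc,
      shift_shift, Nat.add_comm 1 c]
    have := ih (c + 1) _ ((FA.ltf_iff (x := S) a c (n := c + 1 + (a + d)) (by omega)).2
      (by rwa [show c + 1 + (a + d) = c + (a + (d + 1)) by omega]))
    rwa [show c + 1 + (b + d) = c + (b + (d + 1)) by omega] at this

theorem Pr.sw : Pr sw 2 2 := fun c _ h => h.sw c le_rfl

theorem Pr.ph (a b : ZMod 3) : Pr (Zs 1 1 (pq a b)) 1 1 := fun c _ h => h.ph c (by omega) a b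

theorem Pr.CZ (g : ZMod 3) : Pr (CZ g) 2 2 := fun _ _ h => h.CZ g

theorem Pr.un : Pr un 0 1 := fun _ _ h => h.un

theorem Pr.ef : Pr ef 1 0 := fun _ _ h => h.ef

/-- Gate teleportation: a new vertex is joined to the old one by an edge of weight one, and the old
one is closed. `Hi_eq`, `cp_eq` and `mg_eq` are obtained in the same spirit. -/
theorem Hd_eq : Hd = un ↟ 1 * (CZ 1 * ef) :=
  calc Hd = (cp * ef) * (Hd * (un ↟ 1 * mg)) := by rw [cp_ef', un_mg', mul_one, one_mul]
    _ = cp * ((Hd * (un ↟ 1 * mg)) ↟ 1 * ef) := by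
      rw [← HasAr.comm (x := ef) inferInstance, shift_zero, mul_assoc]
    _ = un ↟ 1 * (CZ 1 * ef) := by simp [CZ, E_one]

theorem Hi_eq : Hi = un ↟ 1 * (CZ 2 * ef) :=
  calc Hi = (cp * ef) * (Hi * (un ↟ 1 * mg)) := by rw [cp_ef', un_mg', mul_one, one_mul]
    _ = cp * ((Hi * (un ↟ 1 * mg)) ↟ 1 * ef) := by
      rw [← HasAr.comm (x := ef) inferInstance, shift_zero, mul_assoc]
    _ = un ↟ 1 * (CZ 2 * ef) := by simp [CZ, E_two]

theorem cp_eq : cp = un ↟ 1 * (CZ 1 * Hi ↟ 1) :=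
  calc cp = cp * (Hd * (un ↟ 1 * mg) * Hi) ↟ 1 := by rw [un_mg']; simp
    _ = un ↟ 1 * (CZ 1 * Hi ↟ 1) := by simp [CZ, E_one]

theorem mg_eq : mg = Hi ↟ 1 * (CZ 1 * ef ↟ 1) := by
  have h : mg * ef = cap := by
    have := Zs_fuse 2 0 1 0 0 one_pos 0 0
    rw [shift_zero, add_zero (0 : Ph)] at this
    exact this
  calc mg = cp * (Hd * (Hi * cap)) ↟ 1 := by rw [Hd_Hi_assoc, mg_cap]
    _ = cp * (Hd * (Hi ↟ 1 * (mg * ef))) ↟ 1 := by rw [h, Hi_slide_cap]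
    _ = Hi ↟ 1 * (CZ 1 * ef ↟ 1) := by simp [CZ, E_one]

theorem Pr.Hd : Pr Hd 1 1 := by
  rw [Hd_eq]
  exact (Pr.un.shift 1).mul ((Pr.CZ 1).mul (Pr.ef.pad inferInstance 1))

theorem Pr.Hi : Pr Hi 1 1 := by
  rw [Hi_eq]
  exact (Pr.un.shift 1).mul ((Pr.CZ 2).mul (Pr.ef.pad inferInstance 1))

theorem Pr.cp : Pr cp 1 2 := by
  rw [cp_eq]
  exact (Pr.un.shift 1).mul ((Pr.CZ 1).mul (Pr.Hi.shift 1))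

theorem Pr.mg : Pr mg 2 1 := by
  rw [mg_eq]
  exact (Pr.Hi.shift 1).mul ((Pr.CZ 1).mul (Pr.ef.shift 1))

theorem Pr.Zs_one (m : ℕ) (a b : ZMod 3) : Pr (Zs 1 m (pq a b)) 1 m := by
  match m with
  | 0 =>
    have h : Zs 1 1 (pq a b) * Zs 1 0 0 = Zs 1 0 (pq a b) := by rw [ph_mul_Zs, add_zero (pq a b)]
    rw [← h]
    exact (Pr.ph a b).mul Pr.ef
  | 1 => exact Pr.ph a b
  | m + 2 =>
    have h : Zs 1 (m + 1) (pq a b) * Zs 1 2 0 ↟ m = Zs 1 (m + 2) (pq a b) := by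
      have := Zs_fuse 1 m 1 0 2 one_pos (pq a b) 0
      rwa [add_zero (pq a b)] at this
    rw [← h]
    exact (Pr.Zs_one (m + 1) a b).mul (Pr.cp.shift m)

theorem Pr.Zs (n m : ℕ) (a b : ZMod 3) : Pr (Zs n m (pq a b)) n m := by
  match n with
  | 0 =>
    have h : QutritZX.Zs 0 1 0 * QutritZX.Zs 1 m (pq a b) = QutritZX.Zs 0 m (pq a b) := by
      have := Zs_fuse 0 0 1 0 m one_pos 0 (pq a b)
      rwa [shift_zero, zero_add (pq a b), Nat.zero_add m] at this
    rw [← h]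
    exact Pr.un.mul (Pr.Zs_one m a b)
  | 1 => exact Pr.Zs_one m a b
  | n + 2 =>
    have h : QutritZX.Zs 2 1 0 * QutritZX.Zs (n + 1) m (pq a b) =
        QutritZX.Zs (n + 2) m (pq a b) := by
      have := Zs_fuse 2 0 1 n m one_pos 0 (pq a b)
      rwa [shift_zero, zero_add (pq a b), Nat.zero_add m, Nat.add_comm 1 n,
        Nat.add_comm 2 n] at this
    rw [← h]
    refine Pr.mul ?_ (Pr.Zs (n + 1) m a b)
    have := Pr.mg.pad inferInstance n
    rwa [Nat.add_comm 2 n, Nat.add_comm 1 n] at this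

theorem Pr.lay {x : M} (hx : Pr x 1 1) (h : HasAr x 1 1) (n : ℕ) : Pr (lay x n) n n := by
  induction n with
  | zero => exact Pr.one 0
  | succ n ih =>
    refine Pr.mul (b := n + 1) (ih.pad ?_ 1) (hx.shift n)
    clear ih
    induction n with
    | zero => exact hasAr_one 0
    | succ n ih => exact (ih.pad 1).mul (h.shift n)

theorem Pr.ι {a b : ℕ} (D : Diagram a b) (hD : D.IsStabilizer) : Pr (ι D) a b := by
  induction D with
  | Z n m α β =>
    obtain ⟨a, b, h⟩ := exists_pq hD.1 hD.2
    have := Pr.Zs n m a b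
    rwa [← h] at this
  | X n m α β =>
    obtain ⟨a, b, h⟩ := exists_pq hD.1 hD.2
    have := ((Pr.Hi.lay inferInstance n).mul (Pr.Zs n m a b)).mul (Pr.Hd.lay inferInstance m)
    rwa [← h, ← Xs_eq] at this
  | had => exact Pr.Hd
  | hadDag => exact Pr.Hi
  | swap => exact Pr.sw
  | wire => rw [ι_wire]; exact Pr.one 1
  | empty => exact Pr.one 0
  | seq D E hD' hE' => rw [ι_seq]; exact (hD' hD.1).mul (hE' hD.2)
  | par D E hD' hE' =>
    rw [ι_par]
    exact ((hD' hD.1).pad (hasAr_ι D) _).mul ((hE' hD.2).shift _)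

theorem FA.ι {n : ℕ} (D : Diagram 0 n) (hD : D.IsStabilizer) : FA n (ι D) := by
  have := Pr.ι D hD 0 1 ⟨0, 1, .zero, by rw [pow_zero, mul_one]⟩
  rwa [Nat.zero_add, one_mul, shift_zero] at this

/-! ### Eliminating closed vertices -/

theorem toCircle_angZ (a : ZMod 3) : ((angZ a).toCircle : ℂ) = e a := by
  rcases zmod3_cases a with rfl | rfl | rfl
  · simp [e_zero]
  · rw [← ang_one, toCircle_ang_one]
  · rw [← ang_two, toCircle_ang_two]

/-- The possible values are `1 + 2ω`, `1 + 2ω²`, `2 + ω` and `2 + ω²`, all of absolute value `√3`.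
-/
theorem gauss_sum_ne_zero (a b : ZMod 3) (hb : b ≠ 0) : 1 + e (a + b) + e (2 * a + b) ≠ 0 := by
  have h1 : 1 + omega + omega ≠ 0 := fun h => by
    have : (3 : ℂ) = 0 := by linear_combination 4 * omega_sum - (1 + 2 * omega) * h
    norm_num at this
  have h2 : 1 + omega ^ 2 + omega ^ 2 ≠ 0 := fun h => h1 (by
    linear_combination 2 * omega_sum - h)
  have h3 : 1 + 1 + omega ≠ 0 := fun h => omega_ne_one (by
    linear_combination omega * (h - omega_sum) + omega_pow_three)
  have h4 : 1 + 1 + omega ^ 2 ≠ 0 := fun h => omega_ne_one (by linear_combination omega_sum - h)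
  have d1 : (1 : ZMod 3) + 1 = 2 := by decide
  have d2 : (2 : ZMod 3) * 1 = 2 := by decide
  have d3 : (2 : ZMod 3) + 1 = 0 := by decide
  have d4 : (1 : ZMod 3) + 2 = 0 := by decide
  have d5 : (2 : ZMod 3) * 2 = 1 := by decide
  have d6 : (2 : ZMod 3) + 2 = 1 := by decide
  have h3' : 1 + omega + 1 ≠ 0 := by rwa [add_right_comm]
  have h4' : 1 + omega ^ 2 + 1 ≠ 0 := by rwa [add_right_comm]
  rcases zmod3_cases a with rfl | rfl | rfl <;> rcases zmod3_cases b with rfl | rfl | rfl <;>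
    simp only [ne_eq, not_true_eq_false, zero_add, mul_zero, d1, d2, d3, d4, d5, d6, e_zero, e_one,
      e_two] at hb ⊢ <;> assumption

theorem Zs_ef (a b : ZMod 3) (hb : b ≠ 0) : Zs 0 1 (pq a b) * ef = 1 := by
  have h : NZ (ι (Z 0 0 (pq a b).1 (pq a b).2)) := by
    refine (nz_ι _).2 ((interp_ne_zero_iff _).2 ⟨0, 0, ?_⟩)
    rw [amp_Z, sum_zmod3]
    have h2 : (2 : ZMod 3) ≠ 0 ∧ (2 : ZMod 3) ≠ 1 := by decide
    have := gauss_sum_ne_zero a b hb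
    simpa [phaseCoeff, h2, pq, toCircle_angZ, e_add] using this
  have := Zs_fuse 0 0 1 0 0 one_pos (pq a b) 0
  rw [shift_zero, add_zero (pq a b)] at this
  exact this.trans (scalar_eq_one h)

/-- Closing the last vertex removes its edge to the previous vertex. -/
theorem row_row_ef (k : ℕ) (gx gy : ℕ → ZMod 3) (a b ay by' : ZMod 3) (hb : b ≠ 0) (t : ZMod 3)
    (ht : t = 2 * b * gx k) :
    Zs 0 1 (pq ay by') * (row k gy * (Zs 0 1 (pq a b) * (row (k + 1) gx * ef ↟ (k + 1)))) =
      Zs 0 1 (pq a b) * (row k gx * (ef ↟ k *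
        (Zs 0 1 (pq (ay - a * t) (by' - b * t ^ 2)) * row k fun i => gy i - t * gx i))) := by
  -- A non-zero `2b` is its own inverse modulo three, so this `t` is the shift whose edge weight
  -- `2bt` equals that of the edge to be removed.
  have htb : 2 * b * t = gx k := by
    rw [ht]
    have : ∀ b c : ZMod 3, b ≠ 0 → 2 * b * (2 * b * c) = c := by decide
    exact this _ _ hb
  generalize hc : gx k = c at htb
  generalize hq : pq (ay - a * t) (by' - b * t ^ 2) = q
  have hq' : q + pq (a * t) (b * t ^ 2) = pq ay by' := by
    rw [← hq, pq_add, sub_add_cancel, sub_add_cancel]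
  have hX : HasAr (Zs 0 1 (pq a b)) 0 1 := inferInstance
  have hY : HasAr (Zs 0 1 (pq ay by')) 0 1 := inferInstance
  have hQ : HasAr (Zs 0 1 q) 0 1 := inferInstance
  have h1 : Zs 0 1 (pq ay by') * Zs 0 1 (pq a b) =
      Zs 0 1 (pq a b) * (Zs 0 1 (pq ay by') * sw) := by
    rw [nat01, hX.comm, shift_zero]
  have h2 := hX.comm (row k gy)
  have h3 := hQ.comm (row k gx * ef ↟ k)
  rw [shift_zero] at h2 h3
  have h4 : T c ↟ k * ef ↟ (k + 1) = CZ c ↟ k * ef ↟ k := by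
    have : T c * ef ↟ 1 = CZ c * ef := by rw [T, mul_assoc, nat10]
    have := congrArg (· ↟ k) this
    simpa only [mul_shift, shift_shift, Nat.add_comm 1 k] using this
  have h5 : sw ↟ k * (CZ c ↟ k * ef ↟ k) = CZ c ↟ k * ef ↟ (k + 1) := by
    have : sw * (CZ c * ef) = CZ c * ef ↟ 1 := by rw [← mul_assoc, sw_CZ, mul_assoc, nat10']
    have := congrArg (· ↟ k) this
    simpa only [mul_shift, shift_shift, Nat.add_comm 1 k] using this
  have h6 : V t ↟ k * ef ↟ (k + 1) = ef ↟ (k + 1) := by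
    have := congrArg (· ↟ k) (V_ef t)
    simpa only [mul_shift, shift_shift, Nat.add_comm 1 k] using this
  have h7 := fun g => (hasAr_row k g).far ef (i := k + 1) (j := k + 1) le_rfl rfl
  calc Zs 0 1 (pq ay by') * (row k gy * (Zs 0 1 (pq a b) * (row (k + 1) gx * ef ↟ (k + 1))))
    _ = Zs 0 1 (pq ay by') * ((Zs 0 1 (pq a b) * row k gy ↟ 1) *
          (row k gx * (T c ↟ k * ef ↟ (k + 1)))) := by
      rw [h2, row_succ, hc]; simp only [mul_assoc]
    _ = (Zs 0 1 (pq ay by') * Zs 0 1 (pq a b)) * (row k gy ↟ 1 * row k gx) *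
          (CZ c ↟ k * ef ↟ k) := by rw [h4]; simp only [mul_assoc]
    _ = Zs 0 1 (pq a b) * (Zs 0 1 (pq ay by') * ((sw * (row k gy ↟ 1 * row k gx)) *
          (CZ c ↟ k * ef ↟ k))) := by rw [h1]; simp only [mul_assoc]
    _ = Zs 0 1 (pq a b) * (Zs 0 1 (pq ay by') * (row k gx ↟ 1 * (row k gy *
          (sw ↟ k * (CZ c ↟ k * ef ↟ k))))) := by rw [sweep_sw]; simp only [mul_assoc]
    _ = Zs 0 1 (pq a b) * (Zs 0 1 (pq ay by') * ((row k gx ↟ 1 * (row k gy * CZ c ↟ k)) *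
          ef ↟ (k + 1))) := by rw [h5]; simp only [mul_assoc]
    _ = (Zs 0 1 (pq a b) * (Zs 0 1 (q + pq (a * t) (b * t ^ 2)) * CZ (2 * b * t))) *
          ((row k gx ↟ 1 * row k gy) * ef ↟ (k + 1)) := by
      rw [← sweep_CZ, hq', htb]; simp only [mul_assoc]
    -- The edge between the two vertices, brought directly behind their nodes, is exchanged for a
    -- controlled shift.
    _ = Zs 0 1 (pq a b) * (Zs 0 1 q * ((V t * (row k gx ↟ 1 * row k gy)) * ef ↟ (k + 1))) := by
      rw [← Zs_Zs_V a b t q hb]; simp only [mul_assoc]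
    -- The shift is pulled through both rows, changes the weights of the surviving vertex and is
    -- absorbed by the effect that closes the other.
    _ = Zs 0 1 (pq a b) * (Zs 0 1 q * (row k gx ↟ 1 * ((row k fun i => gy i - t * gx i) *
          ef ↟ (k + 1)))) := by rw [sweep_V]; simp only [mul_assoc, h6]
    _ = Zs 0 1 (pq a b) * ((Zs 0 1 q * (row k gx * ef ↟ k) ↟ 1) *
          row k fun i => gy i - t * gx i) := by
      rw [h7]; simp only [mul_assoc, mul_shift, shift_shift]
    _ = _ := by rw [h3]; simp only [mul_assoc]

/-- The edges of the closed vertex are removed one at a time, beginning with the newest neighbour.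
Its own coefficient `b` never changes, and at the end it is isolated with a non-zero Gauss sum as
value. -/
theorem Gr.close {k : ℕ} {S : M} (hS : Gr k S) (a b : ZMod 3) (hb : b ≠ 0) (g : ℕ → ZMod 3) :
    Gr k (S * (Zs 0 1 (pq a b) * (row k g * ef ↟ k))) := by
  induction hS generalizing a b with
  | zero =>
    rw [row_zero, one_mul, one_mul, shift_zero, Zs_ef a b hb]
    exact .zero
  | @succ k S a' b' g' hS ih =>
    have := Gr.succ (a' - a * (2 * b * g k)) (b' - b * (2 * b * g k) ^ 2)
      (fun i => g' i - 2 * b * g k * g i) (ih a b hb)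
    simp only [mul_assoc] at this ⊢
    rw [row_row_ef k g g' a b a' b' hb _ rfl]
    simpa only [mul_assoc] using this

/-- Writing `H` as a new vertex joined to the neighbour and closing the neighbour leaves two closed
vertices. The neighbour has non-zero quadratic coefficient and can be removed first; its removal
gives the other vertex, which had none, a non-zero coefficient, so that this one can be removed too.
The new vertex takes the neighbour's place among the outputs. -/
theorem Gr.pivot_core {k : ℕ} {S : M} (hS : Gr k S) (a b az bz : ZMod 3) (g h : ℕ → ZMod 3)
    (hb : b = 0) (hz : bz ≠ 0) (hg : g k ≠ 0) :
    Gr (k + 1) (S * (Zs 0 1 (pq az bz) * (row k h * (Zs 0 1 (pq a b) * (row (k + 1) g *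
      (ef ↟ (k + 1) * Hd ↟ k)))))) := by
  have hsw : HasAr QutritZX.sw 2 2 := inferInstance
  have hef : HasAr ef 1 0 := inferInstance
  have hZ : HasAr (Zs 0 1 (pq az bz)) 0 1 := inferInstance
  -- `H` is teleported onto a new vertex at position `k + 2`.
  have e1 : ef ↟ k * Hd ↟ k = un ↟ (k + 2) * (QutritZX.CZ 1 ↟ (k + 1) * (ef ↟ (k + 1) * ef ↟ k)) := by
    rw [hef.far_shift Hd k (i := k) (j := k + 1) (by omega) rfl, Hd_eq]
    simp only [mul_shift, shift_shift, Nat.add_comm 1 (k + 1), mul_assoc, Nat.add_assoc]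
  have e2 : QutritZX.CZ 1 ↟ (k + 1) * ef ↟ (k + 1) = T 1 ↟ (k + 1) * ef ↟ (k + 2) := by
    have : T 1 * ef ↟ 1 = QutritZX.CZ 1 * ef := by rw [T, mul_assoc, nat10]
    have := congrArg (· ↟ (k + 1)) this
    simpa only [mul_shift, shift_shift, Nat.add_comm 1 (k + 1), Nat.add_assoc] using this.symm
  have e3 : QutritZX.sw ↟ k * (ef ↟ (k + 2) * ef ↟ k) = ef ↟ (k + 2) * ef ↟ (k + 1) := by
    rw [← mul_assoc, hsw.far_shift ef k (i := k + 2) (j := k + 2) (by omega) rfl, mul_assoc,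
      ← ef_shift_succ]
  -- The weights of the neighbour in three stages: with its edge to the closed vertex, then also
  -- with the edge of weight one to the new vertex, then with these two vertices exchanged.
  set h' := Function.update h k (g k) with hh'
  set h'' := Function.update h' (k + 1) 1 with hh''
  set h3 := h'' ∘ Equiv.swap k (k + 1) with hh3
  have e4 : row (k + 1) h' * T 1 ↟ (k + 1) = row (k + 2) h'' := by
    rw [row_succ (k + 1) h'', hh'', Function.update_self, row_congr (g := Function.update h' (k + 1) 1)
      (g' := h') fun i hi => Function.update_of_ne (by omega) _ _]
  have e5 : QutritZX.sw ↟ (k + 1) * row (k + 2) h'' = row (k + 2) h3 * QutritZX.sw ↟ k := by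
    rw [row_sw k (k + 2) le_rfl, hh3]
    congr 2
    funext i
    simp
  have e6 := (hasAr_row (k + 1) h').far un (i := k + 2) (j := k + 2) le_rfl rfl
  have e7 := hZ.far un (i := k + 2) (j := k + 1) (by omega) rfl
  have e8 := hZ.far QutritZX.sw (i := k + 1) (j := k) (by omega) rfl
  have key : Zs 0 1 (pq az bz) * (row k h * (Zs 0 1 (pq a b) * (row (k + 1) g *
      (ef ↟ (k + 1) * Hd ↟ k)))) =
      un * (row k 0 * (Zs 0 1 (pq a b) * (row (k + 1) (Function.update g k 0) *
        (Zs 0 1 (pq az bz) * (row (k + 2) h3 * (ef ↟ (k + 2) * ef ↟ (k + 1))))))) :=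
    calc Zs 0 1 (pq az bz) * (row k h * (Zs 0 1 (pq a b) * (row (k + 1) g *
          (ef ↟ (k + 1) * Hd ↟ k))))
      _ = (Zs 0 1 (pq az bz) * (row k h * (Zs 0 1 (pq a b) * (row (k + 1) g *
            QutritZX.sw ↟ k)))) * (ef ↟ k * Hd ↟ k) := by
        rw [ef_shift_succ]; simp only [mul_assoc]
      _ = Zs 0 1 (pq a b) * (row k g * (Zs 0 1 (pq az bz) * ((row (k + 1) h' * un ↟ (k + 2)) *
            ((QutritZX.CZ 1 ↟ (k + 1) * ef ↟ (k + 1)) * ef ↟ k)))) := by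
        rw [row_sw_row, ← hh', e1]; simp only [mul_assoc]
      _ = Zs 0 1 (pq a b) * (row k g * ((Zs 0 1 (pq az bz) * un ↟ (k + 2)) *
            ((row (k + 1) h' * T 1 ↟ (k + 1)) * (ef ↟ (k + 2) * ef ↟ k)))) := by
        rw [e2, e6]; simp only [mul_assoc]
      _ = Zs 0 1 (pq a b) * (row k g * (un ↟ (k + 1) * (Zs 0 1 (pq az bz) *
            (row (k + 2) h'' * (ef ↟ (k + 2) * ef ↟ k))))) := by
        rw [e4, e7]; simp only [mul_assoc]
      _ = (Zs 0 1 (pq a b) * (row k g * (un * (row (k + 1) 0 * QutritZX.sw ↟ k)))) *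
            (QutritZX.sw ↟ k * (Zs 0 1 (pq az bz) *
            (row (k + 2) h'' * (ef ↟ (k + 2) * ef ↟ k)))) := by
        rw [← Zs_row]; simp only [mul_assoc, sw_sw_shift_assoc]
      _ = un * (row k 0 * (Zs 0 1 (pq a b) * (row (k + 1) (Function.update g k 0) *
            ((QutritZX.sw ↟ k * Zs 0 1 (pq az bz)) *
            (row (k + 2) h'' * (ef ↟ (k + 2) * ef ↟ k)))))) := by
        rw [row_sw_row]; simp only [mul_assoc, Pi.zero_apply]
      _ = un * (row k 0 * (Zs 0 1 (pq a b) * (row (k + 1) (Function.update g k 0) *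
            (Zs 0 1 (pq az bz) * ((QutritZX.sw ↟ (k + 1) * row (k + 2) h'') *
            (ef ↟ (k + 2) * ef ↟ k)))))) := by
        rw [← e8]; simp only [mul_assoc]
      _ = _ := by rw [e5, mul_assoc (row (k + 2) h3), e3]
  have hc : h3 (k + 1) = g k := by
    rw [hh3, Function.comp, Equiv.swap_apply_right, hh'', Function.update_of_ne (by omega), hh',
      Function.update_self]
  -- The coefficient that the second closed vertex has after the neighbour is removed.
  have hb' : b - bz * (2 * bz * h3 (k + 1)) ^ 2 ≠ 0 := by
    rw [hc, hb]
    have : ∀ b c : ZMod 3, b ≠ 0 → c ≠ 0 → 0 - b * (2 * b * c) ^ 2 ≠ 0 := by decide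
    exact this _ _ hz hg
  have h0 := Gr.succ 0 0 0 hS
  have h1 := h0.close az bz hz h3
  have h2 := h1.close (a - az * (2 * bz * h3 (k + 1))) _ hb'
    fun i => Function.update g k 0 i - 2 * bz * h3 (k + 1) * h3 i
  have e9 := row_row_ef (k + 1) h3 (Function.update g k 0) az bz a b hz _ rfl
  have e10 := congrArg (fun x => S * (un * (row k 0 * (x * ef ↟ (k + 1))))) e9
  simp only [mul_assoc] at e10
  rw [key, e10]
  simpa only [mul_assoc, pq_zero] using h2

theorem Gr.pivot {k : ℕ} {S : M} (hS : Gr k S) (a az bz : ZMod 3) (g h : ℕ → ZMod 3)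
    (hg : g k ≠ 0) :
    ∃ S' c, Gr (k + 1) S' ∧ c ≠ 0 ∧
      S * (Zs 0 1 (pq az bz) * (row k h * (Zs 0 1 (pq a 0) * (row (k + 1) g * ef ↟ (k + 1))))) =
        S' * (Hi * Zs 1 1 (pq 0 c)) ↟ k := by
  -- The neighbour's coefficient is split into two non-zero parts. The part `s` makes
  -- `Gr.pivot_core` applicable; the rest is moved to the output, where it must be non-zero for the
  -- operator to act as a phase in front of a green effect.
  obtain ⟨s, hs, hc⟩ : ∃ s : ZMod 3, s ≠ 0 ∧ bz - s ≠ 0 := by revert bz; decide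
  refine ⟨_, bz - s, hS.pivot_core a 0 az s g h rfl hs hg, hc, ?_⟩
  have hZ : HasAr (Zs 0 1 (pq a 0)) 0 1 := inferInstance
  have hp : HasAr (Zs 1 1 (pq 0 (bz - s))) 1 1 := inferInstance
  have h1 : Zs 0 1 (pq az bz) = Zs 0 1 (pq az s) * Zs 1 1 (pq 0 (bz - s)) := by
    rw [Zs_mul_ph, pq_add, add_zero, add_sub_cancel]
  have h2 := hZ.far (Zs 1 1 (pq 0 (bz - s))) (i := k + 1) (j := k) (by omega) rfl
  have h3 := hp.far_shift ef k (i := k + 1) (j := k + 1) (by omega) rfl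
  calc S * (Zs 0 1 (pq az bz) * (row k h * (Zs 0 1 (pq a 0) * (row (k + 1) g * ef ↟ (k + 1)))))
    _ = S * (Zs 0 1 (pq az s) * ((Zs 1 1 (pq 0 (bz - s)) * row k h) * (Zs 0 1 (pq a 0) *
          (row (k + 1) g * ef ↟ (k + 1))))) := by rw [h1]; simp only [mul_assoc]
    _ = S * (Zs 0 1 (pq az s) * (row k h * ((Zs 1 1 (pq 0 (bz - s)) ↟ k * Zs 0 1 (pq a 0)) *
          (row (k + 1) g * ef ↟ (k + 1))))) := by rw [← row_ph]; simp only [mul_assoc]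
    _ = S * (Zs 0 1 (pq az s) * (row k h * (Zs 0 1 (pq a 0) * ((Zs 1 1 (pq 0 (bz - s)) ↟ (k + 1) *
          row (k + 1) g) * ef ↟ (k + 1))))) := by rw [← h2]; simp only [mul_assoc]
    _ = S * (Zs 0 1 (pq az s) * (row k h * (Zs 0 1 (pq a 0) * (row (k + 1) g *
          (ef ↟ (k + 1) * Zs 1 1 (pq 0 (bz - s)) ↟ k))))) := by
      rw [← row_ph' k (k + 1) (by omega), ← h3]; simp only [mul_assoc]
    _ = _ := by simp only [mul_assoc, mul_shift, Hd_Hi_shift_assoc]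

/-- The neighbour is carried next to the closed vertex by adjacent transpositions; `d` counts the
vertices between the two. -/
theorem Gr.pivot_any (d i : ℕ) {S : M} (hS : Gr (i + d + 1) S) (a : ZMod 3) (g : ℕ → ZMod 3)
    (hg : g i ≠ 0) :
    ∃ S' c, Gr (i + d + 1) S' ∧ c ≠ 0 ∧
      S * (Zs 0 1 (pq a 0) * (row (i + d + 1) g * ef ↟ (i + d + 1))) =
        S' * (Hi * Zs 1 1 (pq 0 c)) ↟ i := by
  induction d generalizing i S g with
  | zero =>
    obtain ⟨S, az, bz, h, hS', rfl⟩ := hS.inv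
    simpa only [mul_assoc, Nat.add_zero] using hS'.pivot a az bz g h hg
  | succ d ih =>
    have hsw : HasAr QutritZX.sw 2 2 := inferInstance
    have hZ : HasAr (Zs 0 1 (pq a 0)) 0 1 := inferInstance
    have hk : i + (d + 1) + 1 = i + 1 + d + 1 := by omega
    rw [hk] at hS ⊢
    generalize hK : i + 1 + d + 1 = K at hS ih ⊢
    obtain ⟨S', c, hS', hc, h⟩ := ih (i + 1) (by rw [hK]; exact hS.sw i (by omega))
      (g ∘ Equiv.swap i (i + 1)) (by rwa [Function.comp, Equiv.swap_apply_right])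
    rw [hK] at h hS'
    refine ⟨_, c, hS'.sw i (by omega), hc, ?_⟩
    have h1 := hZ.far QutritZX.sw (i := i + 1) (j := i) (by omega) rfl
    have h2 := hsw.far_shift ef i (i := K) (j := K) (by omega) rfl
    have h3 : ∀ (x : M), HasAr x 1 1 → x ↟ (i + 1) * QutritZX.sw ↟ i = QutritZX.sw ↟ i * x ↟ i :=
      fun x _ => by
        have := congrArg (· ↟ i) (nat11' x)
        simpa only [mul_shift, shift_shift, Nat.add_comm 1 i] using this
    have h4 := h3 (Hi * Zs 1 1 (pq 0 c)) (HasAr.mul (b := 1) inferInstance inferInstance)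
    calc S * (Zs 0 1 (pq a 0) * (row K g * ef ↟ K))
      _ = S * (Zs 0 1 (pq a 0) * (row K g * (QutritZX.sw ↟ i * ef ↟ K * QutritZX.sw ↟ i))) := by
        rw [h2, mul_assoc (ef ↟ K), sw_sw_shift, mul_one]
      _ = S * (Zs 0 1 (pq a 0) * ((row K g * QutritZX.sw ↟ i) * (ef ↟ K * QutritZX.sw ↟ i))) := by
        simp only [mul_assoc]
      _ = S * ((Zs 0 1 (pq a 0) * QutritZX.sw ↟ (i + 1)) * (row K (g ∘ Equiv.swap i (i + 1)) *
            (ef ↟ K * QutritZX.sw ↟ i))) := by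
        rw [row_sw i K (by omega)]; simp only [mul_assoc]
      _ = S * QutritZX.sw ↟ i * (Zs 0 1 (pq a 0) * (row K (g ∘ Equiv.swap i (i + 1)) * ef ↟ K)) *
            QutritZX.sw ↟ i := by rw [h1]; simp only [mul_assoc]
      _ = _ := by rw [h, mul_assoc, h4]; simp only [mul_assoc]

/-! ### Induction on the number of closed vertices -/

/-- Layers of single-qutrit Clifford operators. -/
inductive LC (n : ℕ) : M → Prop
  | one : LC n 1
  | cons {i : ℕ} (hi : i < n) {D : Diagram 1 1} (hD : IsClifford D) {U : M} (hU : LC n U) :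
      LC n (U * ι D ↟ i)

theorem ef_shift_pow {x y : M} (h : x * ef = y * ef) {i m : ℕ} (hi : i < m) :
    x ↟ i * ef ^ m = y ↟ i * ef ^ m := by
  induction m, hi using Nat.le_induction with
  | base =>
    have := fun x => ef_pow_shift i x 0
    simp only [shift_zero, Nat.zero_add] at this
    rw [pow_succ, ← mul_assoc, ← this, mul_assoc, h, ← mul_assoc, this, mul_assoc]
  | succ m hm ih => rw [pow_succ, ← mul_assoc, ih, mul_assoc]

theorem Gr.ef_last {k : ℕ} (i : ℕ) {S : M} (hS : Gr (k + 1) S) (hi : i ≤ k) :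
    ∃ S', Gr (k + 1) S' ∧ S * ef = S' * ef ↟ i := by
  induction i with
  | zero => exact ⟨S, hS, by rw [shift_zero]⟩
  | succ i ih =>
    obtain ⟨S', h, h'⟩ := ih (by omega)
    exact ⟨_, h.sw i (by omega), by rw [h', ef_shift_succ, mul_assoc, sw_sw_shift_assoc]⟩

theorem isClifford_ph (a b : ZMod 3) : IsClifford (Z 1 1 (pq a b).1 (pq a b).2) :=
  .green _ _ (isStabAngle_angZ _) (isStabAngle_angZ _)

/-- One closed vertex is renumbered to be the last. Its quadratic coefficient and its edges then
decide how it disappears. -/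
theorem Gr.eliminate (m : ℕ) {n : ℕ} {S : M} (hS : Gr (m + n) S) (h : NZ (S * ef ^ m)) :
    ∃ S' U, Gr n S' ∧ LC n U ∧ S * ef ^ m = S' * U := by
  induction m generalizing S with
  | zero => exact ⟨S, 1, by rwa [Nat.zero_add] at hS, .one, by rw [pow_zero]⟩
  | succ m ih =>
    rw [show m + 1 + n = m + n + 1 by omega] at hS
    obtain ⟨S₁, hS₁, e⟩ := hS.ef_last (m + n) le_rfl
    obtain ⟨S₂, a, b, g, hS₂, rfl⟩ := hS₁.inv
    rw [pow_succ', ← mul_assoc, e] at h ⊢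
    rw [mul_assoc S₂, mul_assoc (Zs 0 1 (pq a b))] at h ⊢
    by_cases hb : b = 0
    · subst hb
      by_cases hg : ∀ i < m + n, g i = 0
      · have e1 : Zs 0 1 (pq a 0) * (row (m + n) g * ef ↟ (m + n)) =
            (Zs 0 1 (pq a 0) * ef) ↟ (m + n) := by
          rw [row_congr (g' := 0) hg, ← mul_assoc, Zs_row, mul_shift]
        -- An isolated closed vertex with a linear phase may have value zero; this is excluded
        -- because the whole diagram is non-zero.
        have e2 : Zs 0 1 (pq a 0) * ef = 1 := by
          rw [e1] at h
          have h1 := h.of_mul.1.of_mul.2.of_shift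
          have e3 : Zs 0 1 (pq a 0) * ef =
              ι (Z 0 1 (pq a 0).1 (pq a 0).2 ⨾ᵈ Z 1 0 0 0) := (ι_seq _ _).symm
          rw [e3] at h1 ⊢
          exact scalar_eq_one h1
        rw [e1, e2, one_shift, mul_one] at h ⊢
        exact ih hS₂ h
      · push Not at hg
        obtain ⟨i, hi, hg⟩ := hg
        obtain ⟨d, hd⟩ : ∃ d, m + n = i + d + 1 := ⟨m + n - i - 1, by omega⟩
        rw [hd] at hS₂ h ⊢
        obtain ⟨S', c, hS', hc, e⟩ := hS₂.pivot_any d i a g hg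
        rw [← hd] at hS'
        rw [e] at h ⊢
        rw [mul_assoc] at h ⊢
        rcases Nat.lt_or_ge i m with him | him
        · have e1 : Hi * Zs 1 1 (pq 0 c) * ef = Zs 1 1 (pq 0 (2 * c)) * ef := by
            rw [mul_assoc]
            rcases zmod3_cases c with rfl | rfl | rfl
            · exact absurd rfl hc
            · exact Hi_one_ef
            · exact Hi_two_ef
          rw [ef_shift_pow e1 him, ← mul_assoc] at h ⊢
          exact ih (hS'.ph i (by omega) _ _) h
        · obtain ⟨j, rfl⟩ := Nat.exists_eq_add_of_le' him
          -- The neighbour is the output `j`: its operator passes behind the closings and joins the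
          -- local Clifford operators.
          rw [← ef_pow_shift, ← mul_assoc] at h ⊢
          obtain ⟨S'', U, hS'', hU, e⟩ := ih hS' h.of_mul.1
          refine ⟨S'', U * (Hi * Zs 1 1 (pq 0 c)) ↟ j, hS'', ?_, by rw [e, mul_assoc]⟩
          have e1 : Hi * Zs 1 1 (pq 0 c) = ι (hadDag ⨾ᵈ Z 1 1 (pq 0 c).1 (pq 0 c).2) :=
            (ι_seq _ _).symm
          rw [e1]
          exact .cons (by omega) (.seq _ _ .hadDag (isClifford_ph 0 c)) hU
    · exact ih (hS₂.close a b hb g) h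

theorem exists_LC {n : ℕ} (D : Diagram 0 n) (hD : D.IsStabilizer) (h : D.interp ≠ 0) :
    ∃ S U, Gr n S ∧ LC n U ∧ ι D = S * U := by
  obtain ⟨m, S, hS, e⟩ := FA.ι D hD
  have h1 : NZ (ι D) := h
  rw [e] at h1 ⊢
  exact hS.eliminate m h1

/-! ### Graph state diagrams -/

theorem ι_ltf_succ' (a : ℕ) : ι (lastToFront (a + 1)) = ι (lastToFront a) ↟ 1 * sw := by
  induction a with
  | zero => rw [ι_ltf_one, ι_ltf_zero, one_shift, one_mul]
  | succ a ih =>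
    calc ι (lastToFront (a + 2)) = sw ↟ (a + 1) * (ι (lastToFront a) ↟ 1 * sw) := by
          rw [ι_ltf_succ, ih]
      _ = (sw ↟ a * ι (lastToFront a)) ↟ 1 * sw := by
        simp only [mul_shift, shift_shift, mul_assoc]
      _ = _ := by rw [ι_ltf_succ]

theorem hasAr_ltf (a : ℕ) : HasAr (ι (lastToFront a)) (a + 1) (a + 1) :=
  (hasAr_ι _).congr rfl (Nat.add_comm _ _)

theorem row_succ' (k : ℕ) (g : ℕ → ZMod 3) :
    row (k + 1) g = T (g 0) * row k (fun i => g (i + 1)) ↟ 1 := by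
  induction k with
  | zero => simp [row_succ, row_zero]
  | succ k ih =>
    rw [row_succ, ih, row_succ k fun i => g (i + 1)]
    simp only [mul_shift, shift_shift, mul_assoc]

theorem ltf_row (k : ℕ) : ι (lastToFront k) * row k 0 = 1 := by
  induction k with
  | zero => rw [ι_ltf_zero, row_zero, one_mul]
  | succ k ih =>
    have h : (fun i => (0 : ℕ → ZMod 3) (i + 1)) = 0 := rfl
    rw [ι_ltf_succ', row_succ', Pi.zero_apply, T_zero, mul_assoc, sw_sw_assoc, h, ← mul_shift, ih,
      one_shift]

theorem row_ltf (k : ℕ) : row k 0 * ι (lastToFront k) = 1 := by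
  induction k with
  | zero => rw [ι_ltf_zero, row_zero, one_mul]
  | succ k ih =>
    rw [ι_ltf_succ, row_succ, Pi.zero_apply, T_zero, mul_assoc, sw_sw_shift_assoc, ih]

/-- The controlled phase gate between the first and the last of `k + 2` wires. -/
noncomputable def farCZ (k : ℕ) (g : ZMod 3) : M :=
  ι (lastToFront k) ↟ 1 * (CZ g * row k 0 ↟ 1)

theorem farCZ_succ (k : ℕ) (g : ZMod 3) : farCZ (k + 1) g = sw * (farCZ k g ↟ 1 * sw) := by
  have h : (fun i => (0 : ℕ → ZMod 3) (i + 1)) = 0 := rfl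
  have hsw : HasAr sw 2 2 := inferInstance
  calc farCZ (k + 1) g
    _ = ι (lastToFront k) ↟ 2 * ((sw ↟ 1 * (CZ g * sw ↟ 1)) * row k 0 ↟ 2) := by
      rw [farCZ, ι_ltf_succ', row_succ', Pi.zero_apply, T_zero, h]
      simp only [mul_shift, shift_shift, mul_assoc]
    _ = (ι (lastToFront k) ↟ 2 * sw) * (CZ g ↟ 1 * (sw * row k 0 ↟ 2)) := by
      rw [← CZ'_eq', CZ']; simp only [mul_assoc]
    _ = sw * (ι (lastToFront k) ↟ 2 * (CZ g ↟ 1 * (row k 0 ↟ 2 * sw))) := by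
      rw [hsw.comm, ← hsw.comm]; simp only [mul_assoc]
    _ = _ := by simp only [farCZ, mul_shift, shift_shift, mul_assoc]

/-- The gate couples only the outer two wires; carrying the last wire past the middle ones lets
whatever happens on these slide by. -/
theorem farCZ_comm (k : ℕ) (g : ZMod 3) {x : M} (hx : HasAr x k k) :
    farCZ k g * x ↟ 1 = x ↟ 1 * farCZ k g := by
  obtain ⟨D, rfl⟩ := hx
  have hCZ : HasAr (CZ g) 2 2 := inferInstance
  have h1 := ltf_natural D
  have h2 : row k 0 * ι D = ι D ↟ 1 * row k 0 :=
    calc row k 0 * ι D = row k 0 * (ι D * ι (lastToFront k)) * row k 0 := by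
          rw [mul_assoc, mul_assoc, ltf_row, mul_one]
      _ = _ := by rw [h1, ← mul_assoc, row_ltf, one_mul]
  calc farCZ k g * ι D ↟ 1 = ι (lastToFront k) ↟ 1 * (CZ g * (row k 0 * ι D) ↟ 1) := by
        simp only [farCZ, mul_shift, mul_assoc]
    _ = ι (lastToFront k) ↟ 1 * ((CZ g * ι D ↟ 2) * row k 0 ↟ 1) := by
      rw [h2]; simp only [mul_shift, shift_shift, mul_assoc]
    _ = (ι (lastToFront k) * ι D ↟ 1) ↟ 1 * (CZ g * row k 0 ↟ 1) := by
      rw [hCZ.comm]; simp only [mul_shift, shift_shift, mul_assoc]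
    _ = _ := by rw [← h1, farCZ, mul_shift, mul_assoc]

/-- The first of `n + 1` wires coupled to the others. -/
noncomputable def fan : {n : ℕ} → (Fin n → ZMod 3) → M
  | 0, _ => 1
  | _ + 1, g => CZ (g 0) * (sw * (fan (fun i => g i.succ) ↟ 1 * sw))

theorem fan_last {n : ℕ} (g : Fin (n + 1) → ZMod 3) :
    fan g = fan (fun i => g i.castSucc) * farCZ n (g (Fin.last n)) := by
  induction n with
  | zero =>
    simp [fan, farCZ, ι_ltf_zero, row_zero]
  | succ n ih =>
    rw [fan, ih, farCZ_succ, fan]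
    simp only [mul_shift, mul_assoc, sw_sw_assoc]
    rfl

/-- Controlled phase gates between all pairs of `n` wires. -/
noncomputable def allCZ : {n : ℕ} → (Fin n → Fin n → ZMod 3) → M
  | 0, _ => 1
  | _ + 1, Γ => fan (fun i => Γ 0 i.succ) * allCZ (fun i j => Γ i.succ j.succ) ↟ 1

theorem hasAr_fan {n : ℕ} (g : Fin n → ZMod 3) : HasAr (fan g) (n + 1) (n + 1) := by
  have hsw : HasAr sw 2 2 := inferInstance
  have hCZ : ∀ g, HasAr (CZ g) 2 2 := inferInstance
  induction n with
  | zero => exact hasAr_one 1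
  | succ n ih =>
    have hn : 2 + n = n + 1 + 1 := by omega
    have hn' : 1 + (n + 1) = n + 1 + 1 := by omega
    exact (((hCZ _).pad n).congr hn hn).mul (((hsw.pad n).congr hn hn).mul
      ((((ih _).shift 1).congr hn' hn').mul ((hsw.pad n).congr hn hn)))

theorem hasAr_allCZ {n : ℕ} (Γ : Fin n → Fin n → ZMod 3) : HasAr (allCZ Γ) n n := by
  induction n with
  | zero => exact hasAr_one 0
  | succ n ih =>
    exact (hasAr_fan _).mul (((ih _).shift 1).congr (Nat.add_comm _ _) (Nat.add_comm _ _))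

/-- The last of `n + 1` wires coupled to the others. -/
noncomputable def fan' {n : ℕ} (g : Fin n → ZMod 3) : M := ι (lastToFront n) * row n (extend g)

theorem fan'_succ {n : ℕ} (g : Fin (n + 1) → ZMod 3) :
    fan' g = farCZ n (g 0) * fan' (fun i => g i.succ) ↟ 1 := by
  have h : row n (fun i => extend g (i + 1)) = row n (extend fun i => g i.succ) :=
    row_congr fun i hi => by simp [extend, hi, Fin.succ]
  have h0 : extend g 0 = g 0 := by simp [extend]
  have h1 : sw * T (g 0) = CZ (g 0) * 1 := by
    rw [T, ← sw_CZ, sw_sw_assoc, mul_one]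
  calc fan' g = ι (lastToFront n) ↟ 1 * ((sw * T (g 0)) * row n (extend fun i => g i.succ) ↟ 1) := by
        rw [fan', ι_ltf_succ', row_succ', h, h0]; simp only [mul_assoc]
    _ = ι (lastToFront n) ↟ 1 * (CZ (g 0) * ((row n 0 * ι (lastToFront n)) ↟ 1 *
          row n (extend fun i => g i.succ) ↟ 1)) := by
      rw [h1, row_ltf, one_shift]; simp only [mul_assoc]
    _ = _ := by simp only [farCZ, fan', mul_shift, mul_assoc]

/-- The prescribed diagram splits off the first vertex, `Gr` the last. Splitting off both leaves
only the gate between them to be moved, and by `farCZ_comm` it commutes with the gates among the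
middle vertices. -/
theorem allCZ_last {n : ℕ} (Γ : Fin (n + 1) → Fin (n + 1) → ZMod 3) :
    allCZ Γ = allCZ (fun i j => Γ i.castSucc j.castSucc) *
      fan' fun i => Γ i.castSucc (Fin.last n) := by
  induction n with
  | zero => simp [allCZ, fan, fan', ι_ltf_zero, row_zero]
  | succ n ih =>
    rw [allCZ, ih, fan_last, fan'_succ, allCZ]
    have h := farCZ_comm n (Γ 0 (Fin.last (n + 1)))
      (hasAr_allCZ fun i j : Fin n => Γ i.succ.castSucc j.succ.castSucc)
    simp only [mul_shift, mul_assoc]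
    congr 1
    rw [← mul_assoc, ← mul_assoc]
    exact congrArg (· * _) h

/-! ### The prescribed graph diagram as a product of gates -/

/-- Green nodes side by side. -/
noncomputable def nodes : {n : ℕ} → (Fin n → ℕ) → M
  | 0, _ => 1
  | _ + 1, c => Zs (c 0) 1 0 * nodes (fun i => c i.succ) ↟ 1

theorem ι_edgeNodes_succ {n : ℕ} (g : Fin (n + 1) → ZMod 3) :
    ι (edgeNodes g) = lay (if g 0 = 1 then Hd else Hi) (numWires (g 0)) *
      ι (edgeNodes fun i => g i.succ) ↟ numWires (g 0) := by
  have h : ι (if g 0 = 1 then had else hadDag) = if g 0 = 1 then Hd else Hi := by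
    split_ifs <;> rfl
  rw [← h, ← ι_layer_const]
  exact ι_par _ _

theorem ι_cast_seq_wires {a b k t a₁ b₁ c d : ℕ} (B : Diagram a b)
    (h : k + a + t = a₁) (h' : k + b + t = b₁) (E : Diagram c d) (r : ℕ) (hr : b₁ = r + c) :
    ι ((wires k ⊗ᵈ B ⊗ᵈ wires t).cast h (h'.trans hr) ⨾ᵈ (wires r ⊗ᵈ E)) =
      ι B ↟ k * ι E ↟ r := by
  rw [ι_seq, ι_cast, ι_par, ι_par, ι_par, ι_wires, ι_wires, ι_wires, one_mul, one_mul,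
    one_shift, mul_one]

theorem ι_distribute_succ {n : ℕ} (w c : Fin (n + 1) → ℕ) :
    ι (distribute w c) = ι (braid (total fun i => w i.succ) (c 0)) ↟ w 0 *
      ι (distribute (fun i => w i.succ) fun i => c i.succ) ↟ (w 0 + c 0) :=
  ι_cast_seq_wires (braid (total fun i => w i.succ) (c 0)) _ rfl
    (distribute (fun i => w i.succ) fun i => c i.succ) (w 0 + c 0) (by omega)

theorem ι_vertex {c W t N n n' : ℕ} (e : Diagram W W) (D : Diagram (W + t) N) (G : Diagram N n)
    (h : 1 + (W + t) = 1 + W + t) (h' : 1 + n = n') :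
    ι (((Z c (1 + W) 0 0 ⨾ᵈ (wire ⊗ᵈ e)) ⊗ᵈ wires t) ⨾ᵈ (wire ⊗ᵈ (D ⨾ᵈ G)).cast h h') =
      Zs c (1 + W) 0 * (ι e ↟ 1 * (ι D * ι G) ↟ 1) := by
  rw [ι_seq, ι_cast, ι_par, ι_seq, ι_par, ι_par, ι_seq, ι_wires, one_shift, mul_one,
    ι_wire, one_mul, one_mul, mul_assoc]
  rfl

theorem ι_openGraph_succ {n : ℕ} (Γ : Matrix (Fin (n + 1)) (Fin (n + 1)) (ZMod 3))
    (c : Fin (n + 1) → ℕ) :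
    ι (openGraph Γ c) =
      Zs (c 0) (1 + total fun i : Fin n => numWires (Γ 0 i.succ)) 0 *
        (ι (edgeNodes fun i : Fin n => Γ 0 i.succ) ↟ 1 *
        (ι (distribute (fun i : Fin n => numWires (Γ 0 i.succ)) fun i => c i.succ) *
          ι (openGraph (fun i j => Γ i.succ j.succ)
            fun i => numWires (Γ 0 i.succ) + c i.succ)) ↟ 1) :=
  ι_vertex _ _ _ _ _

theorem braid_one_eq (m : ℕ) : ι (braid m 1) = ι (lastToFront m) := by
  rw [ι_braid_succ, ι_braid_zero, one_mul, shift_zero]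

theorem braid_mul {c : ℕ} (m : ℕ) {x : M} (hx : HasAr x c 1) :
    ι (braid m c) * x = x ↟ m * ι (lastToFront m) := by
  obtain ⟨D, rfl⟩ := hx
  have := ι_braid_natural (wires m) D
  rw [ι_wires, one_mul, one_shift, mul_one, braid_one_eq] at this
  exact this.symm

theorem Zs_cp (n m : ℕ) (p : Ph) : Zs n (m + 1) p * cp ↟ m = Zs n (m + 2) p := by
  have := Zs_fuse n m 1 0 2 one_pos p 0
  rwa [add_zero p] at this

theorem mg_Zs (n m : ℕ) (p : Ph) : mg * Zs (n + 1) m p = Zs (n + 2) m p := by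
  have := Zs_fuse 2 0 1 n m one_pos 0 p
  rwa [shift_zero, zero_add p, Nat.zero_add m, Nat.add_comm 1 n, Nat.add_comm 2 n] at this

theorem cp_Zs (m : ℕ) : cp * Zs 1 m 0 = Zs 1 (m + 1) 0 := by
  match m with
  | 0 => rw [cp_ef', ph_zero]
  | 1 => rw [ph_zero, mul_one]
  | m + 2 =>
    have h := congrArg (· ↟ m) cp_cp
    simp only [mul_shift, shift_shift, Nat.add_comm 1 m] at h
    rw [← Zs_cp 1 m 0, ← mul_assoc, cp_Zs (m + 1)]
    change Zs 1 (m + 2) 0 * cp ↟ m = Zs 1 (m + 1 + 2) 0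
    rw [← Zs_cp 1 m 0, mul_assoc, h, ← mul_assoc, Zs_cp 1 m 0, Zs_cp 1 (m + 1) 0]

theorem Zs_mg (n : ℕ) : Zs n 1 0 ↟ 1 * mg = Zs (1 + n) 1 0 := by
  rw [Nat.add_comm]
  match n with
  | 0 => rw [un_mg', ph_zero]
  | 1 => rw [ph_zero, one_shift, one_mul]
  | n + 2 =>
    have h0 := mg_Zs n 1 0
    have h : mg ↟ 1 * Zs (n + 2) 1 0 = mg * Zs (n + 2) 1 0 := by
      rw [← h0, ← mul_assoc, mg_mg, mul_assoc]
    have h1 := Zs_mg (n + 1)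
    rw [Nat.add_comm 1 (n + 1)] at h1
    rw [← h0, mul_shift, mul_assoc, h1]
    refine h.trans ?_
    exact mg_Zs (n + 1) 1 0

theorem Zs_sw (n m : ℕ) (p : Ph) (i : ℕ) (h : i + 2 ≤ m) : Zs n m p * sw ↟ i = Zs n m p := by
  obtain ⟨b, rfl⟩ := Nat.exists_eq_add_of_le h
  have h := ι_eq (.s3_out n i b p.1 p.2)
  rw [ι_seq, ι_par, ι_par, ι_wires, one_mul, ι_wires, one_shift, mul_one] at h
  exact h

theorem Zs_ltf (n m : ℕ) (p : Ph) (i a : ℕ) (h : i + a + 1 ≤ m) :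
    Zs n m p * ι (lastToFront a) ↟ i = Zs n m p := by
  induction a with
  | zero => rw [ι_ltf_zero, one_shift, mul_one]
  | succ a ih =>
    rw [ι_ltf_succ, mul_shift, shift_shift, ← mul_assoc, Zs_sw _ _ _ _ (by omega), ih (by omega)]

/-- A wire between the first vertex and the others is bypassed: it enters and leaves by crossings,
and the known relation is applied one place to the right. -/
theorem fork_tail {W : ℕ} {x D f z : M} (hx : HasAr x 1 (1 + W)) (h : x * D ↟ 1 = z ↟ 1 * f) :
    x * (ι (lastToFront W) ↟ 1 * D ↟ 2) = z ↟ 2 * (sw * (f ↟ 1 * sw)) := by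
  have hsw : HasAr sw 2 2 := inferInstance
  have hL : ι (lastToFront (1 + W)) = ι (lastToFront W) ↟ 1 * sw := by
    rw [← ι_ltf_succ']
    exact congrArg (fun k => ι (lastToFront k)) (Nat.add_comm 1 W)
  obtain ⟨X, rfl⟩ := hx
  have h1 := ltf_natural X
  rw [hL, ι_ltf_one] at h1
  have h2 : ι X * ι (lastToFront W) ↟ 1 = sw * (ι X ↟ 1 * sw) := by
    rw [← mul_assoc sw, ← h1, mul_assoc, mul_assoc, sw_sw, mul_one]
  calc ι X * (ι (lastToFront W) ↟ 1 * D ↟ 2) = sw * (ι X ↟ 1 * (sw * D ↟ 2)) := by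
        rw [← mul_assoc, h2]; simp only [mul_assoc]
    _ = sw * ((ι X * D ↟ 1) ↟ 1 * sw) := by
      rw [hsw.comm]; simp only [mul_shift, shift_shift, mul_assoc]
    _ = (sw * z ↟ 2) * (f ↟ 1 * sw) := by
      rw [h]; simp only [mul_shift, shift_shift, mul_assoc]
    _ = _ := by rw [hsw.comm]; simp only [mul_assoc]

theorem fork_no_edge {W c : ℕ} {e D f z Z : M} (he : HasAr e W W)
    (h : Zs 1 (1 + W) 0 * (e ↟ 1 * (D * Z) ↟ 1) = z ↟ 1 * f) :
    Zs 1 (1 + W) 0 * (e ↟ 1 * (ι (braid W c) * D ↟ c * (Zs c 1 0 * Z ↟ 1)) ↟ 1) =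
      (Zs c 1 0 * z ↟ 1) ↟ 1 * (sw * (f ↟ 1 * sw)) := by
  have hx : HasAr (Zs 1 (1 + W) 0 * e ↟ 1) 1 (1 + W) := HasAr.mul inferInstance (he.shift 1)
  have hx' := hx.congr rfl (Nat.add_comm 1 W)
  have hs : HasAr (Zs c 1 0) c 1 := inferInstance
  have h1 : ι (braid W c) * D ↟ c * (Zs c 1 0 * Z ↟ 1) =
      Zs c 1 0 ↟ W * (ι (lastToFront W) * (D * Z) ↟ 1) :=
    calc _ = ι (braid W c) * (D ↟ c * Zs c 1 0) * Z ↟ 1 := by simp only [mul_assoc]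
      _ = (ι (braid W c) * Zs c 1 0) * (D * Z) ↟ 1 := by
        rw [← hs.comm]; simp only [mul_shift, mul_assoc]
      _ = _ := by rw [braid_mul W hs, mul_assoc]
  calc _ = (Zs 1 (1 + W) 0 * e ↟ 1 * Zs c 1 0 ↟ (W + 1)) *
        (ι (lastToFront W) ↟ 1 * (D * Z) ↟ 2) := by
        rw [h1]; simp only [mul_shift, shift_shift, mul_assoc]
    _ = Zs c 1 0 ↟ 1 * (Zs 1 (1 + W) 0 * e ↟ 1 * (ι (lastToFront W) ↟ 1 * (D * Z) ↟ 2)) := by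
      rw [hx'.comm]; simp only [mul_assoc]
    _ = _ := by
      rw [fork_tail hx (by rw [mul_assoc, h])]
      simp only [mul_shift, shift_shift, mul_assoc]

/-- One leg of the first vertex is split off as a copy; it runs through its edge node into the next
vertex, and copy, edge node and merge make a controlled phase gate. -/
theorem fork_edge {W c : ℕ} {g : ZMod 3} {e D f z Z : M} (he : HasAr e W W)
    (h : Zs 1 (1 + W) 0 * (e ↟ 1 * (D * Z) ↟ 1) = z ↟ 1 * f) :
    Zs 1 (1 + (1 + W)) 0 * ((E g * e ↟ 1) ↟ 1 *
      (ι (braid W c) ↟ 1 * D ↟ (1 + c) * (Zs (1 + c) 1 0 * Z ↟ 1)) ↟ 1) =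
      (Zs c 1 0 * z ↟ 1) ↟ 1 * (CZ g * (sw * (f ↟ 1 * sw))) := by
  have hx : HasAr (Zs 1 (1 + W) 0 * e ↟ 1) 1 (1 + W) := HasAr.mul inferInstance (he.shift 1)
  have hx' := hx.congr rfl (Nat.add_comm 1 W)
  have hs : HasAr (Zs c 1 0) c 1 := inferInstance
  have hs' : HasAr (Zs (1 + c) 1 0) (1 + c) 1 := inferInstance
  have hcp : HasAr cp 1 2 := inferInstance
  have hE : HasAr (E g) 1 1 := inferInstance
  have hCZ : HasAr (CZ g) 2 2 := inferInstance
  have hW : ∀ x : M, x ↟ (W + 1) = x ↟ 1 ↟ W := fun x => by rw [shift_shift, Nat.add_comm]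
  have hmg : HasAr mg 2 1 := inferInstance
  have hL : ι (lastToFront W) * (E g * e ↟ 1) = e * (E g ↟ W * ι (lastToFront W)) := by
    have h1 := braid_mul W hE
    rw [braid_one_eq] at h1
    obtain ⟨e', rfl⟩ := he
    have h2 := (hasAr_ι e').comm (E g)
    rw [← mul_assoc, h1, mul_assoc, ← ltf_natural e', ← mul_assoc, ← mul_assoc, h2]
  have hB : ι (lastToFront W) * (ι (braid W c) ↟ 1 * Zs (1 + c) 1 0) =
      (Zs c 1 0 ↟ 1 * mg) ↟ W * ι (lastToFront W) := by
    have h1 := braid_mul W hmg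
    rw [ι_braid_succ, braid_one_eq] at h1
    calc _ = ι (lastToFront W) * ((ι (braid W c) * Zs c 1 0) ↟ 1 * mg) := by
          rw [← Zs_mg]; simp only [mul_shift, mul_assoc]
      _ = (ι (lastToFront W) * Zs c 1 0 ↟ (W + 1)) * (ι (lastToFront W) ↟ 1 * mg) := by
        rw [braid_mul W hs]; simp only [mul_shift, shift_shift, mul_assoc]
      _ = Zs c 1 0 ↟ (W + 1) * (ι (lastToFront W) * ι (lastToFront W) ↟ 1 * mg) := by
        rw [← mul_assoc, (hasAr_ltf W).comm]; simp only [mul_assoc]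
      _ = _ := by
        rw [h1, hW, mul_shift, mul_assoc]
  have h1 : ι (braid W c) ↟ 1 * D ↟ (1 + c) * (Zs (1 + c) 1 0 * Z ↟ 1) =
      ι (braid W c) ↟ 1 * Zs (1 + c) 1 0 * (D * Z) ↟ 1 :=
    calc _ = ι (braid W c) ↟ 1 * (D ↟ (1 + c) * Zs (1 + c) 1 0) * Z ↟ 1 := by
          simp only [mul_assoc]
      _ = _ := by rw [← hs'.comm]; simp only [mul_shift, mul_assoc]
  have h2 : Zs 1 (1 + (1 + W)) 0 = cp * (Zs 1 (1 + W) 0 * ι (lastToFront W) ↟ 1) := by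
    rw [← mul_assoc, cp_Zs, Zs_ltf _ _ _ _ _ (by omega), Nat.add_comm]
  have h3 : cp * (E g * (Zs c 1 0 ↟ 1 * mg)) ↟ 1 = Zs c 1 0 ↟ 1 * CZ g := by
    calc _ = (cp * ((E g * Zs c 1 0 ↟ 1) * mg) ↟ 1) := by simp only [mul_assoc]
      _ = (cp * Zs c 1 0 ↟ 2) * (E g * mg) ↟ 1 := by
        rw [hE.comm]; simp only [mul_shift, shift_shift, mul_assoc]
      _ = _ := by rw [hcp.comm, CZ, mul_assoc]
  calc _ = cp * (Zs 1 (1 + W) 0 * ((ι (lastToFront W) * (E g * e ↟ 1)) *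
        (ι (braid W c) ↟ 1 * Zs (1 + c) 1 0 * (D * Z) ↟ 1)) ↟ 1) := by
        rw [h1, h2]; simp only [mul_shift, shift_shift, mul_assoc]
    _ = cp * (Zs 1 (1 + W) 0 * (e * (E g ↟ W * (ι (lastToFront W) *
        (ι (braid W c) ↟ 1 * Zs (1 + c) 1 0)) * (D * Z) ↟ 1)) ↟ 1) := by
      rw [hL]; simp only [mul_assoc]
    _ = cp * ((Zs 1 (1 + W) 0 * e ↟ 1 * (E g * (Zs c 1 0 ↟ 1 * mg)) ↟ (W + 1)) *
        (ι (lastToFront W) ↟ 1 * (D * Z) ↟ 2)) := by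
      rw [hB]
      generalize Zs c 1 0 ↟ 1 * mg = y
      simp only [mul_shift, shift_shift, mul_assoc]
    _ = (cp * (E g * (Zs c 1 0 ↟ 1 * mg)) ↟ 1) *
        (Zs 1 (1 + W) 0 * e ↟ 1 * (ι (lastToFront W) ↟ 1 * (D * Z) ↟ 2)) := by
      rw [hx'.comm]; simp only [mul_assoc]
    _ = Zs c 1 0 ↟ 1 * ((CZ g * z ↟ 2) * (sw * (f ↟ 1 * sw))) := by
      rw [fork_tail hx (by rw [mul_assoc, h]), h3]; simp only [mul_assoc]
    _ = _ := by rw [hCZ.comm]; simp only [mul_shift, shift_shift, mul_assoc]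

/-- Drawing the edges of a vertex as extra legs that end in the other green nodes is the same as
applying controlled phase gates to these nodes. The other vertices are added one by one. -/
theorem fork {n : ℕ} (g : Fin n → ZMod 3) (c : Fin n → ℕ) :
    Zs 1 (1 + total fun i => numWires (g i)) 0 * (ι (edgeNodes g) ↟ 1 *
      (ι (distribute (fun i => numWires (g i)) c) * nodes fun i => numWires (g i) + c i) ↟ 1) =
      nodes c ↟ 1 * fan g := by
  induction n with
  | zero =>
    change Zs 1 1 0 * ((1 : M) ↟ 1 * ((1 : M) * 1) ↟ 1) = (1 : M) ↟ 1 * 1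
    rw [ph_zero]; simp
  | succ n ih =>
    have ih := ih (fun i => g i.succ) fun i => c i.succ
    have he := hasAr_ι (edgeNodes fun i => g i.succ)
    rw [ι_edgeNodes_succ, ι_distribute_succ, nodes, nodes, fan]
    have ht : (total fun i => numWires (g i)) =
      numWires (g 0) + total fun i : Fin n => numWires (g i.succ) := rfl
    rw [ht]
    by_cases hg : g 0 = 0
    · have hw : numWires (g 0) = 0 := by rw [hg]; rfl
      rw [hw, hg, CZ_zero, one_mul, lay, one_mul, shift_zero, shift_zero, Nat.zero_add,
        Nat.zero_add]
      exact fork_no_edge he ih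
    · have hw : numWires (g 0) = 1 := if_neg hg
      have hE : (if g 0 = 1 then Hd else Hi) = E (g 0) := by rw [E, if_neg hg]
      rw [hw, lay_one, hE]
      exact fork_edge he ih

theorem vertex_step {x y u e d o N a z f : M} (hx : x = u * y) (ho : o = N * a)
    (h : y * (e * (d * N) ↟ 1) = z ↟ 1 * f) :
    x * (e * (d * o) ↟ 1) = u * z ↟ 1 * (f * a ↟ 1) :=
  calc x * (e * (d * o) ↟ 1) = u * (y * (e * (d * N) ↟ 1)) * a ↟ 1 := by
        rw [hx, ho]; simp only [mul_shift, mul_assoc]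
    _ = _ := by rw [h]; simp only [mul_assoc]

theorem ι_openGraph {n : ℕ} (Γ : Matrix (Fin n) (Fin n) (ZMod 3)) (c : Fin n → ℕ) :
    ι (openGraph Γ c) = nodes c * allCZ Γ := by
  induction n with
  | zero => exact (mul_one _).symm
  | succ n ih =>
    -- The spider is split into a node that collects its inputs and one that distributes its output
    -- and its edges.
    have hf : ∀ m, Zs (c 0) (1 + m) 0 = Zs (c 0) 1 0 * Zs 1 (1 + m) 0 := fun m => by
      have := Zs_fuse (c 0) 0 1 0 (1 + m) one_pos 0 0
      rw [shift_zero, add_zero (0 : Ph)] at this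
      simpa only [Nat.zero_add, Nat.add_zero] using this.symm
    exact (ι_openGraph_succ Γ c).trans (vertex_step (hf _) (ih _ _)
      (fork (fun i : Fin n => Γ 0 i.succ) fun i => c i.succ))

/-! ### GS-LC form -/

theorem LC.hasAr {n : ℕ} {U : M} (h : LC n U) : HasAr U n n := by
  induction h with
  | one => exact hasAr_one n
  | @cons i hi D _ U _ ih =>
    exact ih.mul ((((hasAr_ι D).shift i).pad (n - (i + 1))).congr (by omega) (by omega))

theorem LC.mono {n m : ℕ} {U : M} (h : LC n U) (hnm : n ≤ m) : LC m U := by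
  induction h with
  | one => exact .one
  | cons hi hD _ ih => exact .cons (hi.trans_le hnm) hD ih

theorem LC.mul {n : ℕ} {U V : M} (hU : LC n U) (hV : LC n V) : LC n (U * V) := by
  induction hV with
  | one => rwa [mul_one]
  | cons hi hD _ ih => rw [← mul_assoc]; exact .cons hi hD ih

theorem layer_mul {n : ℕ} (V : Fin n → Diagram 1 1) (hV : ∀ v, IsClifford (V v)) {i : ℕ}
    (hi : i < n) {D : Diagram 1 1} (hD : IsClifford D) :
    ∃ V' : Fin n → Diagram 1 1, (∀ v, IsClifford (V' v)) ∧
      ι (layer V) * ι D ↟ i = ι (layer V') := by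
  induction n with
  | zero => omega
  | succ n ih =>
    obtain h | rfl := Nat.lt_succ_iff_lt_or_eq.1 hi
    · obtain ⟨V', hV', e⟩ := ih (fun j => V j.castSucc) (fun j => hV _) h
      refine ⟨Fin.snoc (α := fun _ => Diagram 1 1) V' (V (Fin.last n)), fun v => ?_, ?_⟩
      · refine Fin.lastCases ?_ (fun j => ?_) v
        · rw [Fin.snoc_last]; exact hV _
        · rw [Fin.snoc_castSucc]; exact hV' j
      · have hc := (hasAr_ι D).far_shift (ι (V (Fin.last n))) i (i := n) (j := n) (by omega) rfl
        simp only [layer, ι_par, Fin.snoc_last, Fin.snoc_castSucc]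
        rw [← e, mul_assoc, ← hc, mul_assoc]
    · refine ⟨Fin.snoc (α := fun _ => Diagram 1 1) (fun j => V j.castSucc)
        (V (Fin.last i) ⨾ᵈ D), fun v => ?_, ?_⟩
      · refine Fin.lastCases ?_ (fun j => ?_) v
        · rw [Fin.snoc_last]; exact .seq _ _ (hV _) hD
        · rw [Fin.snoc_castSucc]; exact hV _
      · simp only [layer, ι_par, Fin.snoc_last, Fin.snoc_castSucc]
        rw [ι_seq, mul_shift, mul_assoc]

theorem LC.exists_layer {n : ℕ} {U : M} (h : LC n U) :
    ∃ V : Fin n → Diagram 1 1, (∀ v, IsClifford (V v)) ∧ U = ι (layer V) := by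
  induction h with
  | one => exact ⟨fun _ => wire, fun _ => .wire, (ι_wires n).symm⟩
  | cons hi hD _ ih =>
    obtain ⟨V, hV, rfl⟩ := ih
    exact layer_mul V hV hi hD

theorem hasAr_un_pow (k : ℕ) : HasAr (un ^ k) 0 k := by
  induction k with
  | zero => exact hasAr_one 0
  | succ k ih => exact (pow_succ un k ▸ ih.mul (((inferInstance : HasAr un 0 1).pad k).congr
      (Nat.zero_add k) (Nat.add_comm 1 k)))

theorem nodes_zero (n : ℕ) : nodes (fun _ : Fin n => 0) = un ^ n := by
  induction n with
  | zero => rfl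
  | succ n ih =>
    have h : HasAr un 0 1 := inferInstance
    rw [nodes, ih, h.comm, shift_zero, pow_succ]

theorem ι_graphState {n : ℕ} (Γ : Matrix (Fin n) (Fin n) (ZMod 3)) :
    ι (graphState Γ) = un ^ n * allCZ Γ := by
  rw [graphState, ι_cast, ι_openGraph, nodes_zero]

/-- Phases are diagonal, so they can be moved to the end and become local Clifford operators. That
they pass through rows is part of the induction, since the next vertex must be carried past them. -/
theorem Gr.exists_graph {k : ℕ} {S : M} (h : Gr k S) :
    ∃ (Γ : Fin k → Fin k → ZMod 3) (U : M), (∀ i j, Γ i j = Γ j i) ∧ (∀ v, Γ v v = 0) ∧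
      LC k U ∧ (∀ g, U ↟ 1 * row k g = row k g * U) ∧ S = un ^ k * allCZ Γ * U := by
  induction h with
  | zero =>
    refine ⟨fun _ _ => 0, 1, fun _ _ => rfl, fun _ => rfl, .one, fun g => ?_, ?_⟩
    · rw [one_shift, one_mul, mul_one]
    · rw [allCZ, pow_zero, mul_one, mul_one]
  | @succ k S a b g _ ih =>
    obtain ⟨Γ, U, hsymm, hdiag, hU, hrow, rfl⟩ := ih
    let Γ' : Fin (k + 1) → Fin (k + 1) → ZMod 3 := fun i j =>
      Fin.lastCases (motive := fun _ => ZMod 3)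
        (Fin.lastCases (motive := fun _ => ZMod 3) 0 (fun j : Fin k => g j) j)
        (fun i => Fin.lastCases (motive := fun _ => ZMod 3) (g i) (fun j : Fin k => Γ i j) j) i
    have hll : Γ' (Fin.last k) (Fin.last k) = 0 := by simp [Γ']
    have hcl : ∀ i : Fin k, Γ' i.castSucc (Fin.last k) = g i := fun i => by simp [Γ']
    have hlc : ∀ i : Fin k, Γ' (Fin.last k) i.castSucc = g i := fun i => by simp [Γ']
    have hcc : ∀ i j : Fin k, Γ' i.castSucc j.castSucc = Γ i j := fun i j => by simp [Γ']
    have hun : HasAr un 0 1 := inferInstance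
    have hph : HasAr (ph (pq a b)) 1 1 := inferInstance
    refine ⟨Γ', U * ph (pq a b) ↟ k, fun i j => ?_, fun v => ?_, ?_, fun h => ?_, ?_⟩
    · refine Fin.lastCases ?_ (fun i => ?_) i <;> refine Fin.lastCases ?_ (fun j => ?_) j
      · rfl
      · rw [hcl, hlc]
      · rw [hcl, hlc]
      · rw [hcc, hcc, hsymm]
    · refine Fin.lastCases hll (fun i => ?_) v
      rw [hcc, hdiag]
    · exact .cons k.lt_succ_self (isClifford_ph a b) (hU.mono k.le_succ)
    · calc (U * ph (pq a b) ↟ k) ↟ 1 * row (k + 1) h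
          = U ↟ 1 * (ph (pq a b) ↟ (k + 1) * row (k + 1) h) := by
            simp only [mul_shift, shift_shift, mul_assoc]
        _ = (U ↟ 1 * row k h) * (T (h k) ↟ k * ph (pq a b) ↟ k) := by
          rw [← row_ph' k (k + 1) k.lt_succ_self, row_succ]; simp only [mul_assoc]
        _ = row k h * (U * T (h k) ↟ k) * ph (pq a b) ↟ k := by
          rw [hrow]; simp only [mul_assoc]
        _ = _ := by rw [hU.hasAr.comm, row_succ]; simp only [mul_assoc]
    · have hfan : (fan' fun i : Fin k => Γ' i.castSucc (Fin.last k)) =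
          ι (lastToFront k) * row k g := by
        rw [fan', row_congr fun i hi => ?_]
        rw [extend, dif_pos hi, hcl]
      -- A node that enters in front is one placed last and carried to the front. With this, the row
      -- of the new vertex becomes `fan'`, the gates coupling the last wire to the others.
      have hun' : un = un ↟ k * ι (lastToFront k) := by
        rw [← Zs_row, mul_assoc, row_ltf, mul_one]
      have hA : (allCZ fun i j => Γ' i.castSucc j.castSucc) = allCZ Γ := by
        congr 1; funext i j; exact hcc i j
      have hφ : Zs 0 1 (pq a b) = un * ph (pq a b) := by rw [Zs_mul_ph, zero_add]
      have hN := (hasAr_un_pow k).comm un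
      rw [shift_zero] at hN
      have hU1 : U * un = un * U ↟ 1 := by rw [hun.comm, shift_zero]
      calc un ^ k * allCZ Γ * U * (Zs 0 1 (pq a b) * row k g)
        _ = un ^ k * allCZ Γ * (U * un) * (ph (pq a b) * row k g) := by
          rw [hφ]; simp only [mul_assoc]
        _ = un ^ k * allCZ Γ * un * (U ↟ 1 * row k g) * ph (pq a b) ↟ k := by
          rw [hU1, ← row_ph]; simp only [mul_assoc]
        _ = un ^ k * (allCZ Γ * un ↟ k) * (ι (lastToFront k) * row k g) *
            (U * ph (pq a b) ↟ k) := by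
          rw [hrow]; nth_rw 2 [hun']; simp only [mul_assoc]
        _ = (un ^ k * un ↟ k) * (allCZ Γ * (ι (lastToFront k) * row k g)) *
            (U * ph (pq a b) ↟ k) := by
          rw [(hasAr_allCZ Γ).comm]; simp only [mul_assoc]
        _ = _ := by rw [hN, allCZ_last, hA, hfan, pow_succ']

end QutritZX

theorem mainTheorem6 (n : ℕ) (D : QutritZX.Diagram 0 n) (hstab : D.IsStabilizer)
    (hne : D.interp ≠ 0) :
    ∃ G : QutritZX.Diagram 0 n, QutritZX.IsGSLC G ∧ QutritZX.ZXEq D G := by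
  obtain ⟨S, U, hS, hU, e⟩ := QutritZX.exists_LC D hstab hne
  obtain ⟨Γ, U', hsymm, hdiag, hU', -, rfl⟩ := hS.exists_graph
  obtain ⟨V, hV, h⟩ := (hU'.mul hU).exists_layer
  refine ⟨_, ⟨Matrix.of Γ, V, Matrix.IsSymm.ext fun i j => hsymm j i, hdiag, hV, rfl⟩,
    QutritZX.zxEq_of_ι_eq ?_⟩
  rw [e, mul_assoc, h, QutritZX.ι_seq, QutritZX.ι_graphState]
  rfl
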